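/- Let $F:\mathbb S^n\to(0,\infty)$ be a smooth function such that $A_F=D^2F+F\,I$ is positive definite on $T_u\mathbb S^n$ for every $u\in\mathbb S^n$, where $DF$ and $D^2F$ are the gradient and Hessian of $F$ on $\mathbb S^n$, and let $\phi:\mathbb S^n\to\mathbb R^{n+1}$, $\phi(u)=DF_u+F(u)u$. For a great (totally geodesic) sphere $\mathbb S^{k}\subset\mathbb S^n$, i.e. the unit sphere of a $(k+1)$-dimensional linear subspace, put $W_F^{k}=\phi(\mathbb S^{k})$. Let $M$ be a smooth $n$-manifold without boundary, $x:M\to\mathbb R^{n+1}$ an immersed oriented hypersurface with Gauss map $\nu:M\to\mathbb S^n$, and let $S_F$ be its $F$-Weingarten operator, the endomorphism of $T_pM$ determined by $dx\circ S_F=-d(\phi\circ\nu)$. Suppose that $M$ is anisotropic isoparametric: the eigenvalues of $S_F$, counted with multiplicity, are the same at all points of $M$. Let $\lambda_1,\dots,\lambda_g$ be the distinct eigenvalues, $m_1,\dots,m_g$ their multiplicities, and $D_i(p)=\{X\in T_pM: S_FX=\lambda_iX\}$. Then each $D_i$ is an integrable distribution of rank $m_i$ (around each point of $M$ there is a smooth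 chart in which $D_i$ is spanned by the first $m_i$ coordinate fields), and through each point $p\in M$ there passes a unique maximal connected integral manifold of $D_i$, which contains every connected integral manifold through $p$. If $\lambda_i\neq0$, then for each maximal connected integral manifold $L$ of $D_i$ there are a great sphere $\mathbb S^{m_i}\subset\mathbb S^n$, a point $q\in\mathbb R^{n+1}$ and a real number $c\ne0$ such that, with $W=q+c\,W^{m_i}_F$, the image $x(L)$ is an open subset of $W$. If moreover $M$ is complete in the metric induced by $x$, then $x(L)=W$ and $x|_L:L\to W$ is a covering map, which is injective if $m_i\geq2$. -/

import Mathlib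

open Set Filter Topology Metric Module
open scoped Manifold ContDiff ENNReal

noncomputable section

namespace AnisoIso

/-- The Euclidean space `ℝ^{n+1}`. -/
abbrev Ambient (n : ℕ) : Type := EuclideanSpace ℝ (Fin (n + 1))

/-- The unit sphere `S^n` in `ℝ^{n+1}`, with the smooth structure it has in Mathlib. -/
abbrev UnitSphere (n : ℕ) : Type := sphere (0 : Ambient n) 1

section Wulff

variable {n : ℕ}

open Classical in
/-- The radially constant extension `y ↦ F (y / ‖y‖)` of a function on the sphere
(with value `0` at the origin, which plays no role). -/
def radialExt (F : UnitSphere n → ℝ) (y : Ambient n) : ℝ :=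
  if h : y ≠ 0 then F ⟨‖y‖⁻¹ • y, by simp [norm_smul, norm_ne_zero_iff.mpr h]⟩ else 0

/-- The gradient vector `DF_u ∈ T_u S^n ⊂ ℝ^{n+1}` of `F` on the sphere.  As the extension is
constant along rays, its Euclidean gradient at `u` is tangent to the sphere and represents the
differential of `F` at `u`. -/
def sphereGrad (F : UnitSphere n → ℝ) (u : UnitSphere n) : Ambient n :=
  gradient (radialExt F) (u : Ambient n)

/-- The Hessian `D²F` of `F` on the sphere at `u`, as an operator: `X ↦ ∇_X DF`, the covariant
derivative of the gradient field, i.e. the tangential part of the Euclidean derivative of the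
field `DF` in the direction `X ⟂ u`. (The gradient of the radially constant extension extends the
field `DF` to a neighbourhood of the sphere, so its derivative in a direction tangent to the sphere
is that of `DF`.) -/
def sphereHess (F : UnitSphere n → ℝ) (u : UnitSphere n) (X : Ambient n) : Ambient n :=
  (ℝ ∙ (u : Ambient n))ᗮ.starProjection
    (fderiv ℝ (gradient (radialExt F)) (u : Ambient n) X)

/-- The operator `A_F = D²F + F I` at `u`, for vectors `X` in `T_u S^n = u^⊥`. -/
def AF (F : UnitSphere n → ℝ) (u : UnitSphere n) (X : Ambient n) : Ambient n :=
  sphereHess F u X + F u • X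

/-- The anisotropy functions: smooth positive functions on the sphere such that
`A_F = D²F + F I` is positive definite on each tangent space. -/
structure IsAnisotropyFunction (F : UnitSphere n → ℝ) : Prop where
  smooth : ContMDiff (𝓡 n) 𝓘(ℝ, ℝ) ∞ F
  pos : ∀ u, 0 < F u
  convex : ∀ (u : UnitSphere n) (X : Ambient n), inner ℝ (u : Ambient n) X = 0 → X ≠ 0 →
    0 < inner ℝ (AF F u X) X

/-- The map `φ(u) = DF_u + F(u) u`, whose image is the Wulff shape `W_F`. -/
def wulffMap (F : UnitSphere n → ℝ) (u : UnitSphere n) : Ambient n :=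
  sphereGrad F u + F u • (u : Ambient n)

/-- The subset `φ(S(V))` of the Wulff shape, where `S(V) = S^n ∩ V` is the totally geodesic sphere
cut out by the linear subspace `V`.  It is `W^k_F` for the great `k`-sphere `S(V)` when
`dim V = k + 1`. -/
def subWulff (F : UnitSphere n → ℝ) (V : Submodule ℝ (Ambient n)) : Set (Ambient n) :=
  wulffMap F '' {u : UnitSphere n | (u : Ambient n) ∈ V}

end Wulff

section Hypersurface

variable {n : ℕ} {M : Type*} [TopologicalSpace M] [ChartedSpace (EuclideanSpace ℝ (Fin n)) M]

/-- `x : M → ℝ^{n+1}` is a smooth immersion of the `n`-manifold `M` and `ν : M → S^n` is a smooth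
unit normal field along it (the Gauss map given by the orientation). -/
structure IsOrientedHypersurface (x : M → Ambient n) (ν : M → UnitSphere n) : Prop where
  smooth : ContMDiff (𝓡 n) 𝓘(ℝ, Ambient n) ∞ x
  immersion : ∀ p, Function.Injective (mvfderiv (𝓡 n) x p)
  smooth_normal : ContMDiff (𝓡 n) (𝓡 n) ∞ ν
  normal : ∀ (p : M) (v : TangentSpace (𝓡 n) p),
    inner ℝ (ν p : Ambient n) (mvfderiv (𝓡 n) x p v) = 0

variable {x : M → Ambient n} {ν : M → UnitSphere n}

/-- The inverse of `dx : T_pM → dx(T_pM)`, precomposed with the orthogonal projection of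
`ℝ^{n+1}` onto `dx(T_pM)`. -/
def IsOrientedHypersurface.pullback (h : IsOrientedHypersurface x ν) (p : M) :
    Ambient n →ₗ[ℝ] TangentSpace (𝓡 n) p :=
  (LinearEquiv.ofInjective (mvfderiv (𝓡 n) x p).toLinearMap (h.immersion p)).symm.toLinearMap ∘ₗ
    (LinearMap.range (mvfderiv (𝓡 n) x p).toLinearMap).orthogonalProjectionOnto.toLinearMap

/-- The `F`-Weingarten operator `S_F = - d(φ ∘ ν)` on `T_pM`, i.e. the operator with
`dx (S_F X) = - d(φ ∘ ν) X`. (The vectors `d(φ ∘ ν) X` are orthogonal to `ν`, so they lie in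
`dx(T_pM)`, where the projection in `pullback` is the identity.) -/
def IsOrientedHypersurface.weingarten (h : IsOrientedHypersurface x ν) (F : UnitSphere n → ℝ)
    (p : M) : TangentSpace (𝓡 n) p →ₗ[ℝ] TangentSpace (𝓡 n) p :=
  -(h.pullback p ∘ₗ (mvfderiv (𝓡 n) (fun q => wulffMap F (ν q)) p).toLinearMap)

/-- The anisotropic principal curvatures at `p`: the eigenvalues of `S_F`, listed with
multiplicities. -/
def IsOrientedHypersurface.principalCurvatures (h : IsOrientedHypersurface x ν)
    (F : UnitSphere n → ℝ) (p : M) : Multiset ℝ :=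
  haveI : Module.Free ℝ (TangentSpace (𝓡 n) p) := .of_divisionRing _ _
  haveI : Module.Finite ℝ (TangentSpace (𝓡 n) p) :=
    inferInstanceAs (Module.Finite ℝ (EuclideanSpace ℝ (Fin n)))
  (LinearMap.charpoly (h.weingarten F p)).roots

/-- `M` is anisotropic isoparametric, with the list `Λ` of constant anisotropic principal
curvatures (each repeated according to its multiplicity). -/
def IsOrientedHypersurface.IsAnisotropicIsoparametric (h : IsOrientedHypersurface x ν)
    (F : UnitSphere n → ℝ) (Λ : Multiset ℝ) : Prop :=
  ∀ p : M, h.principalCurvatures F p = Λ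

/-- The eigen-distribution `D(p) = {X ∈ T_pM | S_F X = lam X}`. -/
def IsOrientedHypersurface.eigenDistribution (h : IsOrientedHypersurface x ν)
    (F : UnitSphere n → ℝ) (lam : ℝ) (p : M) : Submodule ℝ (TangentSpace (𝓡 n) p) :=
  Module.End.eigenspace (h.weingarten F p) lam

/-- The Riemannian distance of the metric induced on `M` by `x`: the infimum of the lengths
`∫ ‖dx(γ')‖` of `C¹` paths (it is `∞` between different components). -/
def inducedEDist (x : M → Ambient n) (p q : M) : ℝ≥0∞ :=
  letI : ∀ r : M, ENorm (TangentSpace (𝓡 n) r) :=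
    fun r => ⟨fun v => ENNReal.ofReal ‖mvfderiv (𝓡 n) x r v‖⟩
  Manifold.riemannianEDist (𝓡 n) p q

/-- The hypersurface is complete: Cauchy sequences for the induced Riemannian distance
converge in `M`. -/
def IsCompleteHypersurface (x : M → Ambient n) : Prop :=
  ∀ s : ℕ → M, (∀ ε : ℝ≥0∞, 0 < ε → ∃ K, ∀ i ≥ K, ∀ j ≥ K, inducedEDist x (s i) (s j) < ε) →
    ∃ p, Tendsto s atTop (𝓝 p)

end Hypersurface

section Distribution

/-- A field of `k`-planes on the `n`-manifold `M` is integrable if around every point there is a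
smooth chart `e = (e_1, …, e_n)` of `M` (a flat chart) in which it is given by
`de_{k+1} = … = de_n = 0`, i.e. it is spanned by the first `k` coordinate fields.  In particular it
is then smooth, of rank `k` and involutive, and the slices `(e_{k+1}, …, e_n) = const` are
integral manifolds. -/
def IsIntegrable {n : ℕ} {M : Type*} [TopologicalSpace M]
    [ChartedSpace (EuclideanSpace ℝ (Fin n)) M]
    (D : ∀ p : M, Submodule ℝ (TangentSpace (𝓡 n) p)) (k : ℕ) : Prop :=
  ∀ p : M, k ≤ n ∧ ∃ e ∈ IsManifold.maximalAtlas (𝓡 n) ∞ M, p ∈ e.source ∧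
    ∀ q ∈ e.source, ∀ v : TangentSpace (𝓡 n) q,
      v ∈ D q ↔ ∀ j : Fin n, k ≤ (j : ℕ) → mvfderiv (𝓡 n) e q v j = 0

universe u

/-- A connected integral manifold of a field `D` of `k`-planes on `M`: a connected `k`-dimensional
manifold together with an injective immersion into `M` whose tangent spaces are the planes of
`D`. -/
structure IntegralManifold {n : ℕ} {M : Type u} [TopologicalSpace M]
    [ChartedSpace (EuclideanSpace ℝ (Fin n)) M]
    (D : ∀ p : M, Submodule ℝ (TangentSpace (𝓡 n) p)) (k : ℕ) where
  carrier : Type u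
  [top : TopologicalSpace carrier]
  [charted : ChartedSpace (EuclideanSpace ℝ (Fin k)) carrier]
  [mfd : IsManifold (𝓡 k) ∞ carrier]
  [t2 : T2Space carrier]
  [secondCountable : SecondCountableTopology carrier]
  [connected : ConnectedSpace carrier]
  incl : carrier → M
  smooth : ContMDiff (𝓡 k) (𝓡 n) ∞ incl
  injective : Function.Injective incl
  immersion : ∀ a, Function.Injective (mfderiv (𝓡 k) (𝓡 n) incl a)
  tangent : ∀ a, LinearMap.range (mfderiv (𝓡 k) (𝓡 n) incl a).toLinearMap = D (incl a)

attribute [instance] IntegralManifold.top IntegralManifold.charted IntegralManifold.mfd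
  IntegralManifold.t2 IntegralManifold.secondCountable IntegralManifold.connected

/-- The subset of `M` underlying an integral manifold. -/
def IntegralManifold.image {n : ℕ} {M : Type u} [TopologicalSpace M]
    [ChartedSpace (EuclideanSpace ℝ (Fin n)) M]
    {D : ∀ p : M, Submodule ℝ (TangentSpace (𝓡 n) p)} {k : ℕ}
    (L : IntegralManifold D k) : Set M :=
  range L.incl

/-- An integral manifold is maximal if no connected integral manifold is strictly larger. -/
def IntegralManifold.IsMaximal {n : ℕ} {M : Type u} [TopologicalSpace M]
    [ChartedSpace (EuclideanSpace ℝ (Fin n)) M]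
    {D : ∀ p : M, Submodule ℝ (TangentSpace (𝓡 n) p)} {k : ℕ}
    (L : IntegralManifold D k) : Prop :=
  ∀ N : IntegralManifold D k, L.image ⊆ N.image → N.image = L.image

end Distribution

end AnisoIso

end

open scoped NNReal

noncomputable section

namespace AnisoIso

/-! ### The Wulff map as the gradient of a convex support function. -/

section WulffAnalysis

variable {n : ℕ} {F : UnitSphere n → ℝ}

/-! For an eigenvalue `lam` consider the focal map `f = lam • x + φ ∘ ν`. By the definition of the
Weingarten operator `S`, `df = dx ∘ (lam - S)`, so the kernel of `df` is the eigen-distribution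
(`eigenDistribution_eq_ker`). The operator `S` is self-adjoint for a suitable inner product, since
the derivative of `φ` is symmetric and positive definite on `ν^⊥` (`weingarten_semisimple`).
Geometric and algebraic multiplicities therefore agree, and `f` has constant rank `n - m`
(`hasConstantCorank_focalMap`). The constant rank theorem in the form of flat charts gives
integrability, and the maximal integral manifolds are the connected components of the fibres of `f`
(`exists_leaf`).

On a leaf `f` is constant, so for `lam ≠ 0` we have `x = f / lam - φ(ν) / lam` there. The range of
`df` is also constant along the leaf, because in a flat chart `f` depends only on the transverse
coordinates. It has dimension `n - m` and is orthogonal to `ν`, so `ν` stays in one subspace `V` of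
dimension `m + 1` (`exists_isWulffLeaf`). Since `x` is an immersion on the leaf and factors through
`ν`, the Gauss map from the leaf to the `m`-sphere `S(V)` is a local homeomorphism. As `φ` is
injective (`wulffMap_injective`), `S(V)` is homeomorphic to the homothetic copy of the Wulff shape,
and the image of the leaf is open in it.

If `M` is complete, distances between points of the leaf, measured in `M`, are locally bounded by a
constant times the distances of their Gauss images (`exists_nhds_inducedEDist_le`), and leaves are
closed in `M`. Lipschitz paths in `S(V)` therefore lift (`exists_path_lift`). Lifting the segments
of a stereographic chart produces sections over the sphere minus a point, which yield the covering
property and surjectivity. For `m ≥ 2` two such charts meet in a connected set, and this forces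
injectivity. -/

lemma UnitSphere.norm_eq (u : UnitSphere n) : ‖(u : Ambient n)‖ = 1 := by
  simp

lemma UnitSphere.ne_zero (u : UnitSphere n) : (u : Ambient n) ≠ 0 := by
  intro h
  have := u.norm_eq
  simp [h] at this

lemma hasFDerivAt_norm {E : Type*} [NormedAddCommGroup E] [InnerProductSpace ℝ E] {y : E}
    (hy : y ≠ 0) : HasFDerivAt (fun z : E => ‖z‖) (‖y‖⁻¹ • innerSL ℝ y) y := by
  have h1 : HasFDerivAt (fun z : E => ‖z‖ ^ 2) (2 • innerSL ℝ y) y := by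
    simpa using! (hasFDerivAt_id y).norm_sq
  have hy' : ‖y‖ ≠ 0 := norm_ne_zero_iff.mpr hy
  have h2 := h1.sqrt (pow_ne_zero 2 hy')
  simp only [Real.sqrt_sq (norm_nonneg _)] at h2
  convert! h2 using 1
  ext v
  simp
  field_simp

/-- The radial projection `y / ‖y‖` is the point at which `radialExt` evaluates `F`. -/
lemma radialExt_of_ne (F : UnitSphere n → ℝ) {y : Ambient n} (hy : y ≠ 0)
    (h : ‖y‖⁻¹ • y ∈ sphere (0 : Ambient n) 1) : radialExt F y = F ⟨‖y‖⁻¹ • y, h⟩ := by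
  rw [radialExt, dif_pos hy]

lemma radialExt_coe (F : UnitSphere n → ℝ) (u : UnitSphere n) :
    radialExt F (u : Ambient n) = F u := by
  rw [radialExt, dif_pos u.ne_zero]
  congr 1
  ext1
  simp [u.norm_eq]

lemma radialExt_smul (F : UnitSphere n → ℝ) (y : Ambient n) {t : ℝ} (ht : 0 < t) :
    radialExt F (t • y) = radialExt F y := by
  by_cases hy : y = 0
  · simp [hy]
  have hty : t • y ≠ 0 := smul_ne_zero ht.ne' hy
  rw [radialExt, radialExt, dif_pos hy, dif_pos hty]
  congr 2
  rw [norm_smul, smul_smul, Real.norm_of_nonneg ht.le, mul_inv]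
  field_simp

lemma contDiffAt_radialExt (hF : ContMDiff (𝓡 n) 𝓘(ℝ, ℝ) ∞ F) {y : Ambient n} (hy : y ≠ 0) :
    ContDiffAt ℝ ∞ (radialExt F) y := by
  let s : TopologicalSpace.Opens (Ambient n) := ⟨{0}ᶜ, isOpen_compl_singleton⟩
  have hs : ∀ z : s, (z : Ambient n) ≠ 0 := fun z => z.2
  let g : s → Ambient n := fun z => ‖(z : Ambient n)‖⁻¹ • (z : Ambient n)
  have hg : ∀ z : s, g z ∈ sphere (0 : Ambient n) 1 := fun z => by
    simp [g, norm_smul, norm_ne_zero_iff.mpr (hs z)]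
  have hgs : ContMDiff 𝓘(ℝ, Ambient n) 𝓘(ℝ, Ambient n) ∞ g := by
    intro z
    have : ContDiffAt ℝ ∞ (fun w : Ambient n => ‖w‖⁻¹ • w) (z : Ambient n) :=
      ((contDiffAt_id.norm ℝ (hs z)).inv (norm_ne_zero_iff.mpr (hs z))).smul contDiffAt_id
    exact this.contMDiffAt.comp z contMDiff_subtype_val.contMDiffAt
  have : Fact (finrank ℝ (Ambient n) = n + 1) := ⟨by simp⟩
  have h := hF.comp (ContMDiff.codRestrict_sphere (n := n) hgs hg)
  have h' : (fun z : s => radialExt F z) = F ∘ codRestrict g (sphere 0 1) hg := by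
    funext z
    exact radialExt_of_ne F (hs z) (hg z)
  have h2 : ContMDiffAt 𝓘(ℝ, Ambient n) 𝓘(ℝ, ℝ) ∞ (fun z : s => radialExt F z) ⟨y, hy⟩ := by
    rw [h']
    exact h.contMDiffAt
  exact (contMDiffAt_subtype_iff.mp h2).contDiffAt

/-- The support function: the extension of `F` that is positively homogeneous of degree one. -/
def supportFun (F : UnitSphere n → ℝ) (y : Ambient n) : ℝ := ‖y‖ * radialExt F y

/-- The gradient of the support function, an extension of the Wulff map that is homogeneous of
degree zero. -/
def wulffExt (F : UnitSphere n → ℝ) : Ambient n → Ambient n := gradient (supportFun F)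

lemma contDiffAt_gradient {E : Type*} [NormedAddCommGroup E] [InnerProductSpace ℝ E]
    [CompleteSpace E] {f : E → ℝ} {y : E} (hf : ContDiffAt ℝ ∞ f y) :
    ContDiffAt ℝ ∞ (gradient f) y :=
  (InnerProductSpace.toDual ℝ E).symm.toContinuousLinearEquiv.contDiff.contDiffAt.comp y
    (hf.fderiv_right (m := ∞) (by simp))

lemma contDiffAt_supportFun (hF : ContMDiff (𝓡 n) 𝓘(ℝ, ℝ) ∞ F) {y : Ambient n} (hy : y ≠ 0) :
    ContDiffAt ℝ ∞ (supportFun F) y :=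
  (contDiffAt_id.norm ℝ hy).mul (contDiffAt_radialExt hF hy)

lemma contDiffAt_wulffExt (hF : ContMDiff (𝓡 n) 𝓘(ℝ, ℝ) ∞ F) {y : Ambient n} (hy : y ≠ 0) :
    ContDiffAt ℝ ∞ (wulffExt F) y :=
  contDiffAt_gradient (contDiffAt_supportFun hF hy)

lemma wulffExt_eq (hF : ContMDiff (𝓡 n) 𝓘(ℝ, ℝ) ∞ F) {y : Ambient n} (hy : y ≠ 0) :
    wulffExt F y = ‖y‖ • gradient (radialExt F) y + (radialExt F y * ‖y‖⁻¹) • y := by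
  have h : HasFDerivAt (supportFun F) _ y := (hasFDerivAt_norm hy).mul
    ((contDiffAt_radialExt hF hy).differentiableAt (by simp)).hasFDerivAt
  refine ext_inner_right ℝ fun v => ?_
  rw [wulffExt, inner_gradient_left]
  rw [h.fderiv, inner_add_left, real_inner_smul_left, inner_gradient_left,
    real_inner_smul_left]
  simp
  ring

lemma wulffExt_coe (hF : ContMDiff (𝓡 n) 𝓘(ℝ, ℝ) ∞ F) (u : UnitSphere n) :
    wulffExt F u = wulffMap F u := by
  rw [wulffExt_eq hF u.ne_zero, u.norm_eq, radialExt_coe, wulffMap, sphereGrad]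
  simp

lemma supportFun_smul (F : UnitSphere n → ℝ) (y : Ambient n) {t : ℝ} (ht : 0 < t) :
    supportFun F (t • y) = t * supportFun F y := by
  rw [supportFun, supportFun, radialExt_smul F y ht, norm_smul, Real.norm_of_nonneg ht.le, mul_assoc]

/-- Differentiate the degree-one homogeneity of `supportFun F` and cancel the factor `t`. -/
lemma wulffExt_smul (hF : ContMDiff (𝓡 n) 𝓘(ℝ, ℝ) ∞ F) (y : Ambient n) {t : ℝ} (ht : 0 < t) :
    wulffExt F (t • y) = wulffExt F y := by
  rcases eq_or_ne y 0 with rfl | hy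
  · rw [smul_zero]
  refine ext_inner_right ℝ fun v => ?_
  rw [wulffExt, inner_gradient_left, inner_gradient_left]
  have h1 : fderiv ℝ (fun z => supportFun F (t • z)) y = t • fderiv ℝ (supportFun F) (t • y) :=
    fderiv_comp_smul t
  have h2 : (fun z => supportFun F (t • z)) = fun z => t • supportFun F z := by
    funext z
    exact supportFun_smul F z ht
  rw [h2, fderiv_fun_const_smul
    ((contDiffAt_supportFun hF hy).differentiableAt (by simp))] at h1
  have h3 := smul_right_injective _ ht.ne' h1
  rw [h3]

/-- The derivative of a gradient is a Hessian, so this is the symmetry of second derivatives. -/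
lemma fderiv_wulffExt_symm (hF : ContMDiff (𝓡 n) 𝓘(ℝ, ℝ) ∞ F) {y : Ambient n} (hy : y ≠ 0)
    (a b : Ambient n) :
    inner ℝ (fderiv ℝ (wulffExt F) y a) b = inner ℝ a (fderiv ℝ (wulffExt F) y b) := by
  have hs : IsSymmSndFDerivAt ℝ (supportFun F) y :=
    (contDiffAt_supportFun hF hy).isSymmSndFDerivAt (by
      simpa using! (WithTop.coe_le_coe.mpr (le_top : (2 : ℕ∞) ≤ ⊤)))
  have key : ∀ a b : Ambient n, inner ℝ (fderiv ℝ (wulffExt F) y a) b =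
      fderiv ℝ (fderiv ℝ (supportFun F)) y a b := by
    intro a b
    have hd : DifferentiableAt ℝ (fderiv ℝ (supportFun F)) y :=
      ((contDiffAt_supportFun hF hy).fderiv_right (m := ∞) (by simp)).differentiableAt (by simp)
    have : HasFDerivAt (wulffExt F)
        ((InnerProductSpace.toDual ℝ (Ambient n)).symm.toContinuousLinearEquiv.toContinuousLinearMap
          ∘L fderiv ℝ (fderiv ℝ (supportFun F)) y) y :=
      ((InnerProductSpace.toDual ℝ
        (Ambient n)).symm.toContinuousLinearEquiv.toContinuousLinearMap.hasFDerivAt).comp y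
          hd.hasFDerivAt
    rw [this.fderiv]
    simp
  rw [key, real_inner_comm, key]
  exact hs a b

/-- Euler's relation in degree zero: `wulffExt F` is constant along the ray through `y`. -/
lemma fderiv_wulffExt_self (hF : ContMDiff (𝓡 n) 𝓘(ℝ, ℝ) ∞ F) {y : Ambient n} (hy : y ≠ 0) :
    fderiv ℝ (wulffExt F) y y = 0 := by
  have h1 : HasDerivAt (fun t : ℝ => t • y) y 1 := by
    simpa using (hasDerivAt_id (1 : ℝ)).smul_const y
  have hd : HasFDerivAt (wulffExt F) (fderiv ℝ (wulffExt F) y) ((1 : ℝ) • y) := by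
    rw [one_smul]
    exact ((contDiffAt_wulffExt hF hy).differentiableAt (by simp)).hasFDerivAt
  have h2 := hd.comp_hasDerivAt (1 : ℝ) h1
  have h3 : (wulffExt F ∘ fun t : ℝ => t • y) =ᶠ[𝓝 1] fun _ => wulffExt F y := by
    filter_upwards [lt_mem_nhds (zero_lt_one (α := ℝ))] with t ht
    exact wulffExt_smul hF y ht
  exact h2.unique ((hasDerivAt_const (1 : ℝ) (wulffExt F y)).congr_of_eventuallyEq h3)

/-- `radialExt F` is constant along rays, so its gradient at `u` is orthogonal to `u` and only the
term `F u • u` contributes. -/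
lemma inner_wulffMap_self (hF : ContMDiff (𝓡 n) 𝓘(ℝ, ℝ) ∞ F) (u : UnitSphere n) :
    inner ℝ (wulffMap F u) (u : Ambient n) = F u := by
  have h1 : HasDerivAt (fun t : ℝ => t • (u : Ambient n)) (u : Ambient n) 1 := by
    simpa using (hasDerivAt_id (1 : ℝ)).smul_const (u : Ambient n)
  have hd : HasFDerivAt (radialExt F) (fderiv ℝ (radialExt F) u) ((1 : ℝ) • (u : Ambient n)) := by
    rw [one_smul]
    exact ((contDiffAt_radialExt hF u.ne_zero).differentiableAt (by simp)).hasFDerivAt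
  have h2 := hd.comp_hasDerivAt (1 : ℝ) h1
  have h3 : (radialExt F ∘ fun t : ℝ => t • (u : Ambient n)) =ᶠ[𝓝 1]
      fun _ => radialExt F (u : Ambient n) := by
    filter_upwards [lt_mem_nhds (zero_lt_one (α := ℝ))] with t ht
    exact radialExt_smul F _ ht
  have h4 := h2.unique ((hasDerivAt_const (1 : ℝ) _).congr_of_eventuallyEq h3)
  rw [wulffMap, inner_add_left, sphereGrad, inner_gradient_left, h4, real_inner_smul_left,
    real_inner_self_eq_norm_sq, u.norm_eq]
  simp

/-- The derivative of the extended Wulff map along the tangent space is `A_F`, up to the part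
normal to the sphere. -/
lemma inner_AF (hF : ContMDiff (𝓡 n) 𝓘(ℝ, ℝ) ∞ F) (u : UnitSphere n) {X : Ambient n}
    (hX : inner ℝ (u : Ambient n) X = 0) :
    inner ℝ X (AF F u X) = inner ℝ (fderiv ℝ (wulffExt F) u X) X := by
  have hu := u.ne_zero
  have hproj : (ℝ ∙ (u : Ambient n))ᗮ.starProjection X = X :=
    Submodule.starProjection_eq_self_iff.mpr (Submodule.mem_orthogonal_singleton_iff_inner_right.mpr hX)
  have hG := contDiffAt_radialExt hF hu
  have h1 : HasFDerivAt (fun y : Ambient n => ‖y‖ • gradient (radialExt F) y) _ u :=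
    (hasFDerivAt_norm hu).smul ((contDiffAt_gradient hG).differentiableAt (by simp)).hasFDerivAt
  have h2 : HasFDerivAt (fun y : Ambient n => (radialExt F y * ‖y‖⁻¹) • y) _ u :=
    ((hG.differentiableAt (by simp)).mul (((hasFDerivAt_norm hu).differentiableAt).inv
      (norm_ne_zero_iff.mpr hu))).hasFDerivAt.smul (hasFDerivAt_id _)
  have h3 : wulffExt F =ᶠ[𝓝 (u : Ambient n)] fun y =>
      ‖y‖ • gradient (radialExt F) y + (radialExt F y * ‖y‖⁻¹) • y := by
    filter_upwards [isOpen_ne.mem_nhds hu] with y hy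
    exact wulffExt_eq hF hy
  rw [real_inner_comm, h3.fderiv_eq, (h1.fun_add h2).fderiv, AF, sphereHess, inner_add_left, 
    Submodule.inner_starProjection_left_eq_right, hproj]
  simp [inner_add_left, real_inner_smul_left, hX, radialExt_coe, u.norm_eq]

lemma fderiv_wulffExt_pos_unit (hF : IsAnisotropyFunction F) (u : UnitSphere n) {X : Ambient n}
    (hX : inner ℝ (u : Ambient n) X = 0) (hX0 : X ≠ 0) :
    0 < inner ℝ (fderiv ℝ (wulffExt F) u X) X := by
  rw [← inner_AF hF.smooth u hX, real_inner_comm]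
  exact hF.convex u X hX hX0

lemma fderiv_wulffExt_smul (hF : ContMDiff (𝓡 n) 𝓘(ℝ, ℝ) ∞ F) (y : Ambient n) {t : ℝ} (ht : 0 < t) :
    t • fderiv ℝ (wulffExt F) (t • y) = fderiv ℝ (wulffExt F) y := by
  rw [← fderiv_comp_smul]
  congr 1
  funext z
  exact wulffExt_smul hF z ht

/-- Homogeneity reduces to a unit vector `u`. The radial part of `w` is killed by the derivative,
and by symmetry it also drops out of the cross term; what remains is the positivity of `A_F` on the
nonzero tangential part of `w`. -/
lemma fderiv_wulffExt_pos (hF : IsAnisotropyFunction F) {y w : Ambient n} (hy : y ≠ 0)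
    (hw : ∀ s : ℝ, w ≠ s • y) : 0 < inner ℝ (fderiv ℝ (wulffExt F) y w) w := by
  have hn : 0 < ‖y‖ := norm_pos_iff.mpr hy
  let u : UnitSphere n := ⟨‖y‖⁻¹ • y, by simp [norm_smul, hn.ne']⟩
  have hyu : y = ‖y‖ • (u : Ambient n) := by simp [u, smul_smul, hn.ne']
  have hu1 : inner ℝ (u : Ambient n) (u : Ambient n) = (1 : ℝ) := by
    rw [real_inner_self_eq_norm_sq, u.norm_eq]; norm_num
  let s : ℝ := inner ℝ (u : Ambient n) w
  let X : Ambient n := w - s • (u : Ambient n)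
  have hX : inner ℝ (u : Ambient n) X = 0 := by
    simp [X, inner_sub_right, real_inner_smul_right, s]
  have hX0 : X ≠ 0 := by
    intro h
    apply hw (s * ‖y‖⁻¹)
    rw [sub_eq_zero.mp h, mul_smul]
  have hwX : w = X + s • (u : Ambient n) := by simp [X]
  have hpos := fderiv_wulffExt_pos_unit hF u hX hX0
  have h0 := fderiv_wulffExt_self hF.smooth u.ne_zero
  have hsymm := fderiv_wulffExt_symm hF.smooth u.ne_zero X (u : Ambient n)
  rw [h0, inner_zero_right] at hsymm
  have hw' : inner ℝ (fderiv ℝ (wulffExt F) u w) w =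
      inner ℝ (fderiv ℝ (wulffExt F) u X) X := by
    rw [hwX, map_add, map_smul, h0, inner_add_right, inner_add_left, real_inner_smul_right]
    simp [hsymm]
  have hsc := fderiv_wulffExt_smul hF.smooth (u : Ambient n) hn
  rw [← hyu] at hsc
  rw [← hw', ← hsc] at hpos
  simp only [smul_apply, real_inner_smul_left] at hpos
  exact pos_of_mul_pos_right hpos hn.le

/-- The gradient of a convex function is monotone: along the line from `v` to `u` the component of
`wulffExt F` in the direction `u - v` increases strictly, so its values at the two ends differ. -/
lemma wulffMap_injective (hF : IsAnisotropyFunction F) : Function.Injective (wulffMap F) := by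
  intro u v huv
  by_contra hne
  have hne' : (u : Ambient n) ≠ v := fun h => hne (Subtype.ext h)
  -- For antipodal points the line would meet the origin; here positivity of `F` decides, through
  -- `⟨φ(u), u⟩ = F u`.
  by_cases hanti : (u : Ambient n) = -v
  · have h1 := inner_wulffMap_self hF.smooth u
    have h2 := inner_wulffMap_self hF.smooth v
    rw [hanti, inner_neg_right, huv, h2] at h1
    linarith [hF.pos u, hF.pos v]
  have hlin : ∀ a b : ℝ, a • (u : Ambient n) = b • (v : Ambient n) → a = 0 ∧ b = 0 := by
    intro a b hab
    have hn : |a| = |b| := by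
      have := congrArg norm hab
      simpa [norm_smul, u.norm_eq, v.norm_eq] using this
    rcases abs_eq_abs.mp hn with h | h
    · by_cases ha : b = 0
      · exact ⟨h.trans ha, ha⟩
      · rw [h] at hab
        exact absurd (smul_right_injective _ ha hab) hne'
    · by_cases ha : b = 0
      · exact ⟨by rw [h, ha, neg_zero], ha⟩
      · rw [h, neg_smul, ← smul_neg] at hab
        exact absurd (by rw [← smul_right_injective _ ha hab, neg_neg]) hanti
  -- As `u` and `v` are independent, the whole line misses the origin and its direction is never
  -- radial.
  let c : ℝ → Ambient n := fun t => (v : Ambient n) + t • ((u : Ambient n) - v)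
  have hc0 : ∀ t, c t ≠ 0 := by
    intro t ht
    have : t • (u : Ambient n) = (t - 1) • (v : Ambient n) := by
      rw [← sub_eq_zero]
      exact Eq.trans (by simp only [c]; module) ht
    obtain ⟨h1, h2⟩ := hlin _ _ this
    linarith
  have hcw : ∀ t s : ℝ, (u : Ambient n) - v ≠ s • c t := by
    intro t s hts
    have : (1 - s * t) • (u : Ambient n) = (1 + s - s * t) • (v : Ambient n) := by
      rw [← sub_eq_zero] at hts ⊢
      exact Eq.trans (by simp only [c]; module) hts
    obtain ⟨h1, h2⟩ := hlin _ _ this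
    have hs : s = 0 := by linarith
    rw [hs] at h1
    norm_num at h1
  have hderiv : ∀ t, HasDerivAt (fun t => inner ℝ (wulffExt F (c t)) ((u : Ambient n) - v))
      (inner ℝ (fderiv ℝ (wulffExt F) (c t) ((u : Ambient n) - v)) ((u : Ambient n) - v)) t := by
    intro t
    have h1 : HasDerivAt c ((u : Ambient n) - v) t := by
      simpa [c] using! ((hasDerivAt_id t).smul_const ((u : Ambient n) - v)).const_add (v : Ambient n)
    have h2 := ((contDiffAt_wulffExt hF.smooth (hc0 t)).differentiableAt
      (by simp)).hasFDerivAt.comp_hasDerivAt t h1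
    simpa using! h2.inner ℝ (hasDerivAt_const t ((u : Ambient n) - v))
  have hmono := strictMono_of_hasDerivAt_pos hderiv fun t => fderiv_wulffExt_pos hF (hc0 t) (hcw t)
  have := hmono (zero_lt_one (α := ℝ))
  simp only [c, zero_smul, add_zero, one_smul, add_sub_cancel, wulffExt_coe hF.smooth, huv] at this
  exact lt_irrefl _ this

lemma continuous_wulffMap (hF : ContMDiff (𝓡 n) 𝓘(ℝ, ℝ) ∞ F) : Continuous (wulffMap F) := by
  have : wulffMap F = fun u : UnitSphere n => wulffExt F u := by
    funext u
    exact (wulffExt_coe hF u).symm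
  rw [this, continuous_iff_continuousAt]
  intro u
  exact (contDiffAt_wulffExt hF u.ne_zero).continuousAt.comp continuous_subtype_val.continuousAt

/-- The image of the derivative of the extended Wulff map is tangent to the sphere. -/
lemma inner_fderiv_wulffExt_self (hF : ContMDiff (𝓡 n) 𝓘(ℝ, ℝ) ∞ F) (u : UnitSphere n)
    (X : Ambient n) : inner ℝ (u : Ambient n) (fderiv ℝ (wulffExt F) u X) = 0 := by
  rw [← fderiv_wulffExt_symm hF u.ne_zero, fderiv_wulffExt_self hF u.ne_zero, inner_zero_left]

lemma exists_bound_fderiv_wulffExt (hF : ContMDiff (𝓡 n) 𝓘(ℝ, ℝ) ∞ F) :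
    ∃ C : ℝ, 0 < C ∧ ∀ u : UnitSphere n, ‖fderiv ℝ (wulffExt F) u‖ ≤ C := by
  have hc : Continuous fun u : UnitSphere n => fderiv ℝ (wulffExt F) u := by
    rw [continuous_iff_continuousAt]
    intro u
    exact ((contDiffAt_wulffExt hF u.ne_zero).fderiv_right (m := ∞)
      (by simp)).continuousAt.comp continuous_subtype_val.continuousAt
  obtain ⟨C, hC⟩ := (isCompact_range hc).isBounded.exists_norm_le
  exact ⟨max C 1, by positivity, fun u => (hC _ ⟨u, rfl⟩).trans (le_max_left _ _)⟩

end WulffAnalysis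

/-! ### Derivatives of vector valued maps read in charts. -/

section Charts

variable {n : ℕ} {M : Type*} [TopologicalSpace M] [ChartedSpace (EuclideanSpace ℝ (Fin n)) M]
  {Y : Type*} [NormedAddCommGroup Y] [NormedSpace ℝ Y]
  {e : OpenPartialHomeomorph M (EuclideanSpace ℝ (Fin n))} {f : M → Y}

lemma contDiffOn_comp_chart_symm (hf : ContMDiff (𝓡 n) 𝓘(ℝ, Y) ∞ f)
    (he : e ∈ IsManifold.maximalAtlas (𝓡 n) ∞ M) : ContDiffOn ℝ ∞ (f ∘ e.symm) e.target :=
  contMDiffOn_iff_contDiffOn.mp (hf.comp_contMDiffOn (contMDiffOn_symm_of_mem_maximalAtlas he))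

lemma contDiffAt_comp_chart_symm (hf : ContMDiff (𝓡 n) 𝓘(ℝ, Y) ∞ f)
    (he : e ∈ IsManifold.maximalAtlas (𝓡 n) ∞ M) {y : EuclideanSpace ℝ (Fin n)}
    (hy : y ∈ e.target) : ContDiffAt ℝ ∞ (f ∘ e.symm) y :=
  (contDiffOn_comp_chart_symm hf he).contDiffAt (e.open_target.mem_nhds hy)

lemma mdifferentiable_of_mem_maximalAtlas (he : e ∈ IsManifold.maximalAtlas (𝓡 n) ∞ M) :
    e.MDifferentiable (𝓡 n) (𝓡 n) :=
  ⟨(contMDiffOn_of_mem_maximalAtlas he).mdifferentiableOn (by simp),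
    (contMDiffOn_symm_of_mem_maximalAtlas he).mdifferentiableOn (by simp)⟩

lemma mvfderiv_chart_bijective (he : e ∈ IsManifold.maximalAtlas (𝓡 n) ∞ M) {q : M}
    (hq : q ∈ e.source) : Function.Bijective (mvfderiv (𝓡 n) e q) :=
  (mdifferentiable_of_mem_maximalAtlas he).mfderiv_bijective hq

lemma mvfderiv_eq_fderiv_comp_chart (hf : ContMDiff (𝓡 n) 𝓘(ℝ, Y) ∞ f)
    (he : e ∈ IsManifold.maximalAtlas (𝓡 n) ∞ M) {q : M} (hq : q ∈ e.source)
    (v : TangentSpace (𝓡 n) q) :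
    mvfderiv (𝓡 n) f q v = fderiv ℝ (f ∘ e.symm) (e q) (mvfderiv (𝓡 n) e q v) := by
  have h1 : HasMFDerivAt (𝓡 n) (𝓡 n) e q (mfderiv (𝓡 n) (𝓡 n) e q) :=
    ((mdifferentiable_of_mem_maximalAtlas he).mdifferentiableAt hq).hasMFDerivAt
  have h2 : HasMFDerivAt (𝓡 n) 𝓘(ℝ, Y) (f ∘ e.symm) (e q) (fderiv ℝ (f ∘ e.symm) (e q)) :=
    (((contDiffAt_comp_chart_symm hf he (e.map_source hq)).differentiableAt
      (by simp)).hasFDerivAt).hasMFDerivAt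
  have h3 := h2.comp q h1
  have h4 : (f ∘ e.symm) ∘ e =ᶠ[𝓝 q] f := by
    filter_upwards [e.open_source.mem_nhds hq] with z hz
    simp [e.left_inv hz]
  have h5 := (h3.congr_of_eventuallyEq h4.symm).mfderiv
  exact DFunLike.congr_fun h5 v

lemma chartAt_mem [IsManifold (𝓡 n) ∞ M] (p : M) :
    chartAt (EuclideanSpace ℝ (Fin n)) p ∈ IsManifold.maximalAtlas (𝓡 n) ∞ M :=
  IsManifold.chart_mem_maximalAtlas p

/-- The chain rule for the derivative of a vector valued function on a manifold. -/
lemma mvfderiv_comp_vec {Z : Type*} [NormedAddCommGroup Z] [NormedSpace ℝ Z] {g : Y → Z} {p : M}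
    (hg : DifferentiableAt ℝ g (f p)) (hf : ContMDiff (𝓡 n) 𝓘(ℝ, Y) ∞ f)
    (v : TangentSpace (𝓡 n) p) :
    mvfderiv (𝓡 n) (fun q => g (f q)) p v = fderiv ℝ g (f p) (mvfderiv (𝓡 n) f p v) := by
  have h2 : HasMFDerivAt 𝓘(ℝ, Y) 𝓘(ℝ, Z) g (f p) (fderiv ℝ g (f p)) :=
    hg.hasFDerivAt.hasMFDerivAt
  have h1 := (hf.mdifferentiableAt (x := p) (by simp)).hasMFDerivAt
  exact DFunLike.congr_fun (h2.comp p h1).mfderiv v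

end Charts

/-! ### The Weingarten operator, its semisimplicity, and the focal map. -/

section Hypersurface

variable {n : ℕ} {M : Type*} [TopologicalSpace M] [ChartedSpace (EuclideanSpace ℝ (Fin n)) M]
  {x : M → Ambient n} {ν : M → UnitSphere n} {F : UnitSphere n → ℝ}

instance (p : M) : Module.Free ℝ (TangentSpace (𝓡 n) p) := .of_divisionRing _ _

instance (p : M) : Module.Finite ℝ (TangentSpace (𝓡 n) p) :=
  inferInstanceAs (Module.Finite ℝ (EuclideanSpace ℝ (Fin n)))

lemma finrank_tangentSpace (p : M) : finrank ℝ (TangentSpace (𝓡 n) p) = n :=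
  (finrank_euclideanSpace_fin (𝕜 := ℝ) (n := n) :)

lemma contMDiff_coe_unitSphere :
    ContMDiff (𝓡 n) 𝓘(ℝ, Ambient n) ∞ ((↑) : UnitSphere n → Ambient n) := by
  have : Fact (finrank ℝ (Ambient n) = n + 1) := ⟨by simp⟩
  exact contMDiff_coe_sphere

namespace IsOrientedHypersurface

lemma contMDiff_normal (h : IsOrientedHypersurface x ν) :
    ContMDiff (𝓡 n) 𝓘(ℝ, Ambient n) ∞ (fun p => (ν p : Ambient n)) :=
  contMDiff_coe_unitSphere.comp h.smooth_normal

lemma inner_mvfderiv_normal (h : IsOrientedHypersurface x ν) (p : M) (v : TangentSpace (𝓡 n) p) :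
    inner ℝ (ν p : Ambient n) (mvfderiv (𝓡 n) (fun p => (ν p : Ambient n)) p v) = 0 := by
  have hd : DifferentiableAt ℝ (fun z : Ambient n => ‖z‖ ^ 2) (ν p : Ambient n) :=
    (contDiff_norm_sq ℝ (n := 1)).differentiable (by simp) _
  have h1 := mvfderiv_comp_vec (f := fun q => (ν q : Ambient n)) hd h.contMDiff_normal v
  have h2 : (fun q => ‖(ν q : Ambient n)‖ ^ 2) = fun _ => (1 : ℝ) := by
    funext q
    rw [(ν q).norm_eq, one_pow]
  rw [h2, mvfderiv_const, fderiv_norm_sq_apply] at h1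
  simpa using h1.symm

/-- Symmetry of the second fundamental form: differentiating `⟨N, dx a⟩ = 0` in a chart turns `⟨dN
b, dx a⟩` into `-⟨N, d²x(b, a)⟩`, which is symmetric in `a` and `b`. -/
lemma inner_mvfderiv_symm [IsManifold (𝓡 n) ∞ M] (h : IsOrientedHypersurface x ν) (p : M) (v w : TangentSpace (𝓡 n) p) :
    inner ℝ (mvfderiv (𝓡 n) (fun p => (ν p : Ambient n)) p v) (mvfderiv (𝓡 n) x p w) =
      inner ℝ (mvfderiv (𝓡 n) (fun p => (ν p : Ambient n)) p w) (mvfderiv (𝓡 n) x p v) := by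
  set N : M → Ambient n := fun p => (ν p : Ambient n) with hN
  let e := chartAt (EuclideanSpace ℝ (Fin n)) p
  have he : e ∈ IsManifold.maximalAtlas (𝓡 n) ∞ M := chartAt_mem p
  have hp : p ∈ e.source := mem_chart_source _ p
  have hx := contDiffAt_comp_chart_symm h.smooth he (e.map_source hp)
  have hn := contDiffAt_comp_chart_symm h.contMDiff_normal he (e.map_source hp)
  have hzero : ∀ a : EuclideanSpace ℝ (Fin n), ∀ y ∈ e.target,
      inner ℝ ((N ∘ e.symm) y) (fderiv ℝ (x ∘ e.symm) y a) = 0 := by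
    intro a y hy
    obtain ⟨w, rfl⟩ := (mvfderiv_chart_bijective he (e.map_target hy)).2 a
    have := mvfderiv_eq_fderiv_comp_chart h.smooth he (e.map_target hy) w
    rw [e.right_inv hy] at this
    rw [← this]
    exact h.normal _ w
  have hd2 : DifferentiableAt ℝ (fderiv ℝ (x ∘ e.symm)) (e p) :=
    (hx.fderiv_right (m := ∞) (by simp)).differentiableAt (by simp)
  have key : ∀ a b : EuclideanSpace ℝ (Fin n),
      inner ℝ (fderiv ℝ (N ∘ e.symm) (e p) b) (fderiv ℝ (x ∘ e.symm) (e p) a) =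
        -inner ℝ ((N ∘ e.symm) (e p)) (fderiv ℝ (fderiv ℝ (x ∘ e.symm)) (e p) b a) := by
    intro a b
    have h1 : HasFDerivAt (fun y => fderiv ℝ (x ∘ e.symm) y a) _ (e p) :=
      (hd2.hasFDerivAt).clm_apply (hasFDerivAt_const a _)
    have h2 := ((hn.differentiableAt (by simp)).hasFDerivAt).inner ℝ h1
    have h3 : (fun y => inner ℝ ((N ∘ e.symm) y) (fderiv ℝ (x ∘ e.symm) y a)) =ᶠ[𝓝 (e p)]
        fun _ => (0 : ℝ) := by
      filter_upwards [e.open_target.mem_nhds (e.map_source hp)] with y hy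
      exact hzero a y hy
    have h4 := h2.unique ((hasFDerivAt_const (0 : ℝ) (e p)).congr_of_eventuallyEq h3)
    have h5 := DFunLike.congr_fun h4 b
    simp at h5
    simp only [Function.comp_apply]
    linarith
  have hsymm : IsSymmSndFDerivAt ℝ (x ∘ e.symm) (e p) :=
    hx.isSymmSndFDerivAt (by simpa using! (WithTop.coe_le_coe.mpr (le_top : (2 : ℕ∞) ≤ ⊤)))
  rw [mvfderiv_eq_fderiv_comp_chart h.smooth he hp, mvfderiv_eq_fderiv_comp_chart h.smooth he hp,
    mvfderiv_eq_fderiv_comp_chart h.contMDiff_normal he hp,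
    mvfderiv_eq_fderiv_comp_chart h.contMDiff_normal he hp, key, key, hsymm]

lemma range_mvfderiv (h : IsOrientedHypersurface x ν) (p : M) :
    LinearMap.range (mvfderiv (𝓡 n) x p).toLinearMap = (ℝ ∙ (ν p : Ambient n))ᗮ := by
  apply Submodule.eq_of_le_of_finrank_eq
  · rintro _ ⟨v, rfl⟩
    exact Submodule.mem_orthogonal_singleton_iff_inner_right.mpr (h.normal p v)
  · have : Fact (finrank ℝ (Ambient n) = n + 1) := ⟨by simp⟩
    rw [LinearMap.finrank_range_of_inj (h.immersion p), finrank_tangentSpace,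
      Submodule.finrank_orthogonal_span_singleton (n := n) (ν p).ne_zero]

lemma mvfderiv_wulffMap (h : IsOrientedHypersurface x ν) (hF : ContMDiff (𝓡 n) 𝓘(ℝ, ℝ) ∞ F)
    (p : M) (v : TangentSpace (𝓡 n) p) :
    mvfderiv (𝓡 n) (fun q => wulffMap F (ν q)) p v =
      fderiv ℝ (wulffExt F) (ν p) (mvfderiv (𝓡 n) (fun p => (ν p : Ambient n)) p v) := by
  rw [← mvfderiv_comp_vec (f := fun q => (ν q : Ambient n)) ((contDiffAt_wulffExt hF (ν p).ne_zero).differentiableAt (by simp))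
    h.contMDiff_normal v]
  simp_rw [wulffExt_coe hF]

lemma contMDiff_wulffMap (h : IsOrientedHypersurface x ν) (hF : ContMDiff (𝓡 n) 𝓘(ℝ, ℝ) ∞ F) :
    ContMDiff (𝓡 n) 𝓘(ℝ, Ambient n) ∞ (fun q => wulffMap F (ν q)) := by
  simp_rw [← wulffExt_coe hF]
  intro p
  exact (contDiffAt_wulffExt hF (ν p).ne_zero).contMDiffAt.comp p (h.contMDiff_normal p)

/-- The defining property of the `F`-Weingarten operator. -/
lemma mvfderiv_weingarten (h : IsOrientedHypersurface x ν) (hF : ContMDiff (𝓡 n) 𝓘(ℝ, ℝ) ∞ F)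
    (p : M) (v : TangentSpace (𝓡 n) p) :
    mvfderiv (𝓡 n) x p (h.weingarten F p v) =
      -fderiv ℝ (wulffExt F) (ν p) (mvfderiv (𝓡 n) (fun p => (ν p : Ambient n)) p v) := by
  have hpull : ∀ w ∈ LinearMap.range (mvfderiv (𝓡 n) x p).toLinearMap,
      mvfderiv (𝓡 n) x p (h.pullback p w) = w := by
    intro w hw
    have h1 := LinearEquiv.ofInjective_symm_apply (f := (mvfderiv (𝓡 n) x p).toLinearMap)
      (h := h.immersion p)
      ((LinearMap.range (mvfderiv (𝓡 n) x p).toLinearMap).orthogonalProjectionOnto w)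
    refine Eq.trans h1 ?_
    exact Submodule.starProjection_eq_self_iff.mpr hw
  have h2 : mvfderiv (𝓡 n) x p (h.weingarten F p v) =
      -mvfderiv (𝓡 n) x p (h.pullback p (mvfderiv (𝓡 n) (fun q => wulffMap F (ν q)) p v)) := by
    rw [weingarten, ← map_neg]
    rfl
  rw [h2, h.mvfderiv_wulffMap hF, hpull]
  rw [h.range_mvfderiv, Submodule.mem_orthogonal_singleton_iff_inner_right]
  exact inner_fderiv_wulffExt_self hF _ _

/-- The `F`-Weingarten operator is semisimple: generalized eigenvectors are eigenvectors. -/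
lemma weingarten_semisimple [IsManifold (𝓡 n) ∞ M] (h : IsOrientedHypersurface x ν) (hF : IsAnisotropyFunction F)
    (p : M) (lam : ℝ) (v : TangentSpace (𝓡 n) p)
    (hv : h.weingarten F p (h.weingarten F p v - lam • v) =
      lam • (h.weingarten F p v - lam • v)) : h.weingarten F p v = lam • v := by
  set S := h.weingarten F p with hS
  set u := ν p
  set A := fderiv ℝ (wulffExt F) (u : Ambient n) with hA
  set dx := mvfderiv (𝓡 n) x p with hdx
  set dN := mvfderiv (𝓡 n) (fun p => (ν p : Ambient n)) p with hdN
  have hdS : ∀ v, dx (S v) = -A (dN v) := h.mvfderiv_weingarten hF.smooth p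
  have hsym : ∀ a b, inner ℝ (A a) b = inner ℝ a (A b) :=
    fderiv_wulffExt_symm hF.smooth u.ne_zero
  have hpos : ∀ a, inner ℝ (u : Ambient n) a = 0 → a ≠ 0 → 0 < inner ℝ (A a) a :=
    fun a ha ha0 => fderiv_wulffExt_pos_unit hF u ha ha0
  have hinj : ∀ a, inner ℝ (u : Ambient n) a = 0 → A a = 0 → a = 0 := by
    intro a ha hAa
    by_contra ha0
    have := hpos a ha ha0
    rw [hAa, inner_zero_left] at this
    exact lt_irrefl _ this
  -- `A` maps `u^⊥` injectively into itself, hence onto; the vector `a` stands for `A⁻¹ (dx w)`.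
  have hsurj : ∀ w, ∃ a, inner ℝ (u : Ambient n) a = 0 ∧ A a = dx w := by
    let K := (ℝ ∙ (u : Ambient n))ᗮ
    have hAK : ∀ a ∈ K, A.toLinearMap a ∈ K := fun a _ =>
      Submodule.mem_orthogonal_singleton_iff_inner_right.mpr
        (inner_fderiv_wulffExt_self hF.smooth u a)
    have hAi : Function.Injective (A.toLinearMap.restrict hAK) := by
      rw [injective_iff_map_eq_zero]
      rintro ⟨a, ha⟩ h0
      exact Subtype.ext (hinj a (Submodule.mem_orthogonal_singleton_iff_inner_right.mp ha)
        (congrArg Subtype.val h0))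
    have hAs := LinearMap.injective_iff_surjective.mp hAi
    intro w
    obtain ⟨⟨a, ha⟩, hA'⟩ := hAs ⟨dx w,
      Submodule.mem_orthogonal_singleton_iff_inner_right.mpr (h.normal p w)⟩
    exact ⟨a, Submodule.mem_orthogonal_singleton_iff_inner_right.mp ha, congrArg Subtype.val hA'⟩
  set w := S v - lam • v with hw
  obtain ⟨a, hua, ha⟩ := hsurj w
  obtain ⟨b, hub, hb⟩ := hsurj v
  have hNw : dN w = -(lam • a) := by
    have h1 : A (dN w + lam • a) = 0 := by
      have := hdS w
      rw [hv, map_smul, ← ha] at this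
      rw [map_add, map_smul, this]
      simp
    have h2 := hinj _ (by
      rw [inner_add_right, real_inner_smul_right, hua, h.inner_mvfderiv_normal]; simp) h1
    exact eq_neg_of_add_eq_zero_left h2
  have hdw : dx w = -A (dN v) - lam • dx v := by rw [hw, map_sub, map_smul, hdS]
  -- `S` is self-adjoint for the inner product `⟨A⁻¹ dx ·, dx ·⟩`, because `⟨dN ·, dx ·⟩` is
  -- symmetric. In this product `⟨A a, a⟩` is the squared length of `w`, which lies both in the
  -- image and in the kernel of `S - lam`, hence is orthogonal to itself.
  have h0 : inner ℝ (A a) a = 0 := by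
    have h1 : inner ℝ (dN v) (A a) = -lam * inner ℝ a (A b) := by
      rw [ha, h.inner_mvfderiv_symm p v w]
      change inner ℝ (dN w) (dx v) = _
      rw [hNw, hb, ← real_inner_smul_left, neg_smul]
    have h2 : A a = -A (dN v) - lam • A b := by rw [ha, hb, hdw]
    calc inner ℝ (A a) a = -inner ℝ (A (dN v)) a - lam * inner ℝ (A b) a := by
          conv_lhs => rw [h2]
          rw [inner_sub_left, inner_neg_left, real_inner_smul_left]
      _ = 0 := by rw [hsym, h1, real_inner_comm (A b) a]; ring
  have ha0 : a = 0 := by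
    by_contra hne
    exact (hpos a hua hne).ne' h0
  rw [ha0, map_zero] at ha
  have : w = 0 := h.immersion p (by rw [map_zero]; exact ha.symm)
  exact sub_eq_zero.mp this

/-- The root multiplicity in the characteristic polynomial is the dimension of the generalized
eigenspace, which semisimplicity reduces to the eigenspace. -/
lemma finrank_eigenDistribution [IsManifold (𝓡 n) ∞ M] (h : IsOrientedHypersurface x ν) (hF : IsAnisotropyFunction F)
    {Λ : Multiset ℝ} (hΛ : h.IsAnisotropicIsoparametric F Λ) (lam : ℝ) (p : M) :
    finrank ℝ (h.eigenDistribution F lam p) = Λ.count lam := by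
  have h1 : Module.End.maxGenEigenspace (h.weingarten F p) lam = h.eigenDistribution F lam p := by
    apply le_antisymm
    · intro v hv
      rw [Module.End.mem_maxGenEigenspace] at hv
      obtain ⟨k, hk⟩ := hv
      induction k with
      | zero => simp at hk; simp [hk]
      | succ k ih =>
        rcases k with _ | k
        · simp only [zero_add, pow_one] at hk
          rw [eigenDistribution, Module.End.mem_eigenspace_iff]
          exact sub_eq_zero.mp hk
        · apply ih
          set T := h.weingarten F p - lam • 1 with hT
          have hTT : ∀ w, T (T w) = 0 → T w = 0 := by
            intro w hw
            have hTw : ∀ w, T w = h.weingarten F p w - lam • w := fun w => rfl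
            rw [hTw]
            apply sub_eq_zero.mpr
            apply h.weingarten_semisimple hF
            rw [← hTw, ← sub_eq_zero, ← hTw]
            exact hw
          rw [pow_succ', pow_succ', Module.End.mul_apply, Module.End.mul_apply] at hk
          rw [pow_succ', Module.End.mul_apply]
          exact hTT _ hk
    · exact Module.End.genEigenspace_le_maximal _ _ _
  rw [← h1, LinearMap.finrank_maxGenEigenspace_eq, ← hΛ p, principalCurvatures,
    Polynomial.count_roots]

/-- The focal map `lam • x + φ ∘ ν`, whose derivative has the eigen-distribution as kernel. -/
def focalMap (_ : IsOrientedHypersurface x ν) (F : UnitSphere n → ℝ) (lam : ℝ) (p : M) :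
    Ambient n :=
  lam • x p + wulffMap F (ν p)

lemma contMDiff_focalMap (h : IsOrientedHypersurface x ν) (hF : ContMDiff (𝓡 n) 𝓘(ℝ, ℝ) ∞ F)
    (lam : ℝ) : ContMDiff (𝓡 n) 𝓘(ℝ, Ambient n) ∞ (h.focalMap F lam) := by
  have h1 : ContMDiff (𝓡 n) 𝓘(ℝ, Ambient n) ∞ (fun q => lam • x q) := by
    intro p
    exact (contDiff_const_smul lam).contDiffAt.contMDiffAt.comp p (h.smooth p)
  exact h1.add (h.contMDiff_wulffMap hF)

lemma mvfderiv_focalMap (h : IsOrientedHypersurface x ν) (hF : ContMDiff (𝓡 n) 𝓘(ℝ, ℝ) ∞ F)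
    (lam : ℝ) (p : M) (v : TangentSpace (𝓡 n) p) :
    mvfderiv (𝓡 n) (h.focalMap F lam) p v =
      mvfderiv (𝓡 n) x p (lam • v - h.weingarten F p v) := by
  have h1 : mvfderiv (𝓡 n) (fun q => lam • x q) p v = lam • mvfderiv (𝓡 n) x p v := by
    have := mvfderiv_comp_vec (f := x) (p := p) (g := fun z => lam • z)
      (differentiable_id.const_smul lam _) h.smooth v
    rw [this]
    exact DFunLike.congr_fun (((hasFDerivAt_id (𝕜 := ℝ) (x p)).const_smul lam).fderiv) _
  have h1' : MDifferentiableAt (𝓡 n) 𝓘(ℝ, Ambient n) (fun q => lam • x q) p :=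
    ((contDiff_const_smul lam).contDiffAt.contMDiffAt.comp p (h.smooth p)).mdifferentiableAt
      (n := ∞) (by simp)
  have h2 : mvfderiv (𝓡 n) (h.focalMap F lam) p =
      mvfderiv (𝓡 n) (fun q => lam • x q) p + mvfderiv (𝓡 n) (fun q => wulffMap F (ν q)) p :=
    mvfderiv_add h1' ((h.contMDiff_wulffMap hF).mdifferentiableAt (by simp))
  rw [h2, add_apply, h1, map_sub, map_smul, h.mvfderiv_weingarten hF,
    h.mvfderiv_wulffMap hF, sub_neg_eq_add]

lemma eigenDistribution_eq_ker (h : IsOrientedHypersurface x ν)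
    (hF : ContMDiff (𝓡 n) 𝓘(ℝ, ℝ) ∞ F) (lam : ℝ) (p : M) :
    h.eigenDistribution F lam p =
      LinearMap.ker (mvfderiv (𝓡 n) (h.focalMap F lam) p).toLinearMap := by
  ext v
  rw [eigenDistribution, Module.End.mem_eigenspace_iff, LinearMap.mem_ker]
  change _ ↔ mvfderiv (𝓡 n) (h.focalMap F lam) p v = 0
  rw [h.mvfderiv_focalMap hF, map_eq_zero_iff _ (h.immersion p), sub_eq_zero, eq_comm]

end IsOrientedHypersurface

end Hypersurface

/-! ### Splitting off the first `m` coordinates. -/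

section Coordinates

variable {m n : ℕ}

/-- The inclusion of `ℝ^m` into `ℝ^n` as the first `m` coordinates. -/
def padZero (hm : m ≤ n) : EuclideanSpace ℝ (Fin m) →ₗᵢ[ℝ] EuclideanSpace ℝ (Fin n) where
  toFun y := WithLp.toLp 2 fun j => if h : (j : ℕ) < m then y ⟨j, h⟩ else 0
  map_add' y z := by
    ext j
    by_cases h : (j : ℕ) < m <;> simp [h]
  map_smul' c y := by
    ext j
    by_cases h : (j : ℕ) < m <;> simp [h]
  norm_map' y := by
    obtain ⟨k, rfl⟩ := Nat.exists_eq_add_of_le hm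
    rw [EuclideanSpace.norm_eq, EuclideanSpace.norm_eq, Fin.sum_univ_add]
    simp

lemma padZero_apply_of_le (hm : m ≤ n) (y : EuclideanSpace ℝ (Fin m)) {j : Fin n}
    (hj : m ≤ (j : ℕ)) : padZero hm y j = 0 := by
  simp [padZero, not_lt.mpr hj]

lemma padZero_castLE (hm : m ≤ n) (y : EuclideanSpace ℝ (Fin m)) (i : Fin m) :
    padZero hm y (Fin.castLE hm i) = y i := by
  simp [padZero]

/-- The projection of `ℝ^n` onto the first `m` coordinates. -/
def takeFirst (hm : m ≤ n) : EuclideanSpace ℝ (Fin n) →L[ℝ] EuclideanSpace ℝ (Fin m) :=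
  LinearMap.toContinuousLinearMap
    { toFun := fun v => WithLp.toLp 2 fun i => v (Fin.castLE hm i)
      map_add' := fun _ _ => rfl
      map_smul' := fun _ _ => rfl }

lemma takeFirst_apply (hm : m ≤ n) (v : EuclideanSpace ℝ (Fin n)) (i : Fin m) :
    takeFirst hm v i = v (Fin.castLE hm i) := rfl

lemma takeFirst_padZero (hm : m ≤ n) (y : EuclideanSpace ℝ (Fin m)) :
    takeFirst hm (padZero hm y) = y := by
  ext i
  rw [takeFirst_apply, padZero_castLE]

lemma ext_takeFirst (hm : m ≤ n) {v w : EuclideanSpace ℝ (Fin n)}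
    (h1 : takeFirst hm v = takeFirst hm w) (h2 : ∀ j : Fin n, m ≤ (j : ℕ) → v j = w j) :
    v = w := by
  ext j
  by_cases hj : (j : ℕ) < m
  · simpa [takeFirst_apply] using congrArg (fun u => u ⟨j, hj⟩) h1
  · exact h2 j (not_lt.mp hj)

lemma mem_range_padZero (hm : m ≤ n) {v : EuclideanSpace ℝ (Fin n)} :
    v ∈ LinearMap.range (padZero hm).toLinearMap ↔ ∀ j : Fin n, m ≤ (j : ℕ) → v j = 0 := by
  constructor
  · rintro ⟨y, rfl⟩ j hj
    exact padZero_apply_of_le hm y hj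
  · intro h
    refine ⟨takeFirst hm v, ext_takeFirst hm (takeFirst_padZero hm _) fun j hj => ?_⟩
    rw [h j hj]
    exact padZero_apply_of_le hm _ hj

lemma finrank_range_padZero (hm : m ≤ n) :
    finrank ℝ (LinearMap.range (padZero hm).toLinearMap) = m := by
  rw [LinearMap.finrank_range_of_inj (padZero hm).injective]
  simp

/-- A subspace of dimension `m` can be moved isometrically to the first `m` coordinates. -/
lemma exists_isometryEquiv_map_le (hm : m ≤ n) (K : Submodule ℝ (EuclideanSpace ℝ (Fin n)))
    (hK : finrank ℝ K = m) :
    ∃ T : EuclideanSpace ℝ (Fin n) ≃ₗᵢ[ℝ] EuclideanSpace ℝ (Fin n),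
      ∀ v ∈ K, ∀ j : Fin n, m ≤ (j : ℕ) → T v j = 0 := by
  let b := (stdOrthonormalBasis ℝ K).reindex (finCongr hK)
  let L : K →ₗᵢ[ℝ] EuclideanSpace ℝ (Fin n) := (padZero hm).comp b.repr.toLinearIsometry
  refine ⟨L.extend.toLinearIsometryEquiv rfl, fun v hv j hj => ?_⟩
  have : L.extend v = L ⟨v, hv⟩ := L.extend_apply ⟨v, hv⟩
  rw [LinearIsometry.coe_toLinearIsometryEquiv, this]
  exact padZero_apply_of_le hm _ hj

/-- `B` descends to the quotient by the kernel of `A`, that is to the range of `A`, and extends from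
there to `W`. This makes transverse coordinates into linear functions of `f`. -/
lemma exists_comp_eq_of_ker_le {V W Z : Type*} [AddCommGroup V] [Module ℝ V] [AddCommGroup W]
    [Module ℝ W] [AddCommGroup Z] [Module ℝ Z] (A : V →ₗ[ℝ] W) (B : V →ₗ[ℝ] Z)
    (h : LinearMap.ker A ≤ LinearMap.ker B) : ∃ P : W →ₗ[ℝ] Z, P ∘ₗ A = B := by
  obtain ⟨P, hP⟩ := LinearMap.exists_extend
    ((LinearMap.ker A).liftQ B h ∘ₗ A.quotKerEquivRange.symm.toLinearMap)
  refine ⟨P, LinearMap.ext fun v => ?_⟩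
  have h1 := DFunLike.congr_fun hP ⟨A v, v, rfl⟩
  have h2 : A.quotKerEquivRange.symm ⟨A v, v, rfl⟩ = (LinearMap.ker A).mkQ v := by
    rw [LinearEquiv.symm_apply_eq]
    rfl
  simp only [LinearMap.comp_apply, LinearEquiv.coe_coe, h2] at h1
  exact h1

end Coordinates

/-! ### Maps of constant rank and flat charts. -/

section ConstantRank

variable {n m : ℕ} {M : Type*} [TopologicalSpace M] [ChartedSpace (EuclideanSpace ℝ (Fin n)) M]
  {Y : Type*} [NormedAddCommGroup Y] [NormedSpace ℝ Y]
  {e : OpenPartialHomeomorph M (EuclideanSpace ℝ (Fin n))} {f : M → Y}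

/-- A smooth map of constant rank `n - m`. -/
structure HasConstantCorank (n : ℕ) {M : Type*} [TopologicalSpace M]
    [ChartedSpace (EuclideanSpace ℝ (Fin n)) M] {Y : Type*} [NormedAddCommGroup Y]
    [NormedSpace ℝ Y] (f : M → Y) (m : ℕ) : Prop where
  smooth : ContMDiff (𝓡 n) 𝓘(ℝ, Y) ∞ f
  finrank_ker : ∀ p, finrank ℝ (LinearMap.ker (mvfderiv (𝓡 n) f p).toLinearMap) = m

/-- A chart with convex target whose last `n - m` coordinates are linear functions of `f`. -/
structure IsFlatChart (f : M → Y) (m : ℕ)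
    (e : OpenPartialHomeomorph M (EuclideanSpace ℝ (Fin n))) : Prop where
  mem_atlas : e ∈ IsManifold.maximalAtlas (𝓡 n) ∞ M
  convex : Convex ℝ e.target
  factors : ∃ P : Y →L[ℝ] EuclideanSpace ℝ (Fin n), ∀ q ∈ e.source, ∀ j : Fin n, m ≤ (j : ℕ) →
    e q j = P (f q) j

lemma HasConstantCorank.le (hf : HasConstantCorank n f m) (p : M) : m ≤ n := by
  have h1 := Submodule.finrank_le (LinearMap.ker (mvfderiv (𝓡 n) f p).toLinearMap)
  rwa [hf.finrank_ker, finrank_tangentSpace] at h1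

/-- The kernel of the derivative in a chart has the same dimension. -/
lemma finrank_ker_fderiv_chart (hf : HasConstantCorank n f m)
    (he : e ∈ IsManifold.maximalAtlas (𝓡 n) ∞ M) {y : EuclideanSpace ℝ (Fin n)}
    (hy : y ∈ e.target) :
    finrank ℝ (LinearMap.ker (fderiv ℝ (f ∘ e.symm) y).toLinearMap) = m := by
  have hq := e.map_target hy
  have hb := mvfderiv_chart_bijective he hq
  let D := LinearEquiv.ofBijective (mvfderiv (𝓡 n) e (e.symm y)).toLinearMap hb
  have h1 : LinearMap.ker (mvfderiv (𝓡 n) f (e.symm y)).toLinearMap =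
      (LinearMap.ker (fderiv ℝ (f ∘ e.symm) y).toLinearMap).comap D.toLinearMap := by
    ext v
    have := mvfderiv_eq_fderiv_comp_chart hf.smooth he hq v
    rw [e.right_inv hy] at this
    simp only [LinearMap.mem_ker, Submodule.mem_comap]
    exact Eq.congr_left this
  rw [← hf.finrank_ker (e.symm y), h1]
  have h2 := (D.submoduleMap ((LinearMap.ker (fderiv ℝ (f ∘ e.symm) y).toLinearMap).comap
    D.toLinearMap)).finrank_eq
  rw [h2, Submodule.map_comap_eq_of_surjective D.surjective]

/-- Keep `m` coordinates along the kernel at `p` and replace the others by linear functions of `f`,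
then apply the inverse function theorem. Only the kernel at the single point `p` enters; constancy
of the rank is used afterwards, in `IsFlatChart.ker_fderiv`. -/
lemma HasConstantCorank.exists_isFlatChart [IsManifold (𝓡 n) ∞ M] [FiniteDimensional ℝ Y]
    (hf : HasConstantCorank n f m) (p : M) :
    ∃ e : OpenPartialHomeomorph M (EuclideanSpace ℝ (Fin n)), p ∈ e.source ∧ IsFlatChart f m e := by
  have hm := hf.le p
  let e₀ := chartAt (EuclideanSpace ℝ (Fin n)) p
  have he₀ : e₀ ∈ IsManifold.maximalAtlas (𝓡 n) ∞ M := chartAt_mem p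
  have hp : p ∈ e₀.source := mem_chart_source _ p
  set y₀ := e₀ p with hy₀
  have hy₀t : y₀ ∈ e₀.target := e₀.map_source hp
  set g := f ∘ e₀.symm with hg
  have hgs : ∀ y ∈ e₀.target, ContDiffAt ℝ ∞ g y := fun y hy =>
    contDiffAt_comp_chart_symm hf.smooth he₀ hy
  set A := fderiv ℝ g y₀ with hA
  obtain ⟨T, hT⟩ := exists_isometryEquiv_map_le hm _ (finrank_ker_fderiv_chart hf he₀ hy₀t)
  let T' : EuclideanSpace ℝ (Fin n) →L[ℝ] EuclideanSpace ℝ (Fin n) :=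
    T.toContinuousLinearEquiv.toContinuousLinearMap
  -- The projection that sets the first `m` coordinates to zero.
  let π : EuclideanSpace ℝ (Fin n) →L[ℝ] EuclideanSpace ℝ (Fin n) :=
    ContinuousLinearMap.id ℝ _ - (padZero hm).toContinuousLinearMap ∘L takeFirst hm
  have hπ1 : ∀ v, ∀ j : Fin n, m ≤ (j : ℕ) → π v j = v j := by
    intro v j hj
    have : π v j = v j - padZero hm (takeFirst hm v) j := rfl
    rw [this, padZero_apply_of_le hm _ hj, sub_zero]
  have hπ2 : ∀ v, takeFirst hm (π v) = 0 := by
    intro v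
    have : π v = v - padZero hm (takeFirst hm v) := rfl
    rw [this, map_sub, takeFirst_padZero, sub_self]
  have hππ : ∀ v, π (π v) = π v := fun v =>
    ext_takeFirst hm (by rw [hπ2, hπ2]) fun j hj => hπ1 _ j hj
  obtain ⟨P₀, hP₀⟩ := exists_comp_eq_of_ker_le A.toLinearMap (π ∘L T').toLinearMap (by
    intro v hv
    refine ext_takeFirst hm ?_ fun j hj => ?_
    · exact (hπ2 _).trans (map_zero _).symm
    · exact (hπ1 _ j hj).trans (hT v hv j hj))
  let P : Y →L[ℝ] EuclideanSpace ℝ (Fin n) := LinearMap.toContinuousLinearMap P₀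
  have hP : ∀ v, P (A v) = π (T' v) := fun v => DFunLike.congr_fun hP₀ v
  -- The last coordinates of `T' y` are replaced by those of `P (g y)`. Since `P ∘ A = π ∘ T'`, the
  -- derivative at `y₀` remains the isomorphism `T`.
  let Φ : EuclideanSpace ℝ (Fin n) → EuclideanSpace ℝ (Fin n) :=
    fun y => T' y - π (T' y) + π (P (g y))
  have hΦs : ∀ y ∈ e₀.target, ContDiffAt ℝ ∞ Φ y := by
    intro y hy
    exact (T'.contDiff.contDiffAt.sub ((π ∘L T').contDiff.contDiffAt)).add
      ((π ∘L P).contDiff.contDiffAt.comp y (hgs y hy))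
  have hΦd : HasFDerivAt Φ (T.toContinuousLinearEquiv : _ →L[ℝ] _) y₀ := by
    have h1 := ((T'.hasFDerivAt (x := y₀)).sub ((π ∘L T').hasFDerivAt)).add
      ((π ∘L P).hasFDerivAt.comp y₀ ((hgs y₀ hy₀t).differentiableAt (by simp)).hasFDerivAt)
    refine HasFDerivAt.congr_fderiv h1 ?_
    ext1 v
    change T' v - π (T' v) + π (P (A v)) = T' v
    rw [hP, hππ, sub_add_cancel]
  let G := (hΦs y₀ hy₀t).toOpenPartialHomeomorph Φ hΦd (by simp)
  have hGc : ∀ y, G y = Φ y := fun y => rfl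
  have hGy : y₀ ∈ G.source := (hΦs y₀ hy₀t).mem_toOpenPartialHomeomorph_source hΦd (by simp)
  -- the points where the inverse of `G` is known to be smooth
  have hinv : ∀ᶠ z in 𝓝 (Φ y₀), ContDiffAt ℝ ∞ G.symm z := by
    have h1 : ContDiffAt ℝ ∞ G.symm (Φ y₀) := (hΦs y₀ hy₀t).to_localInverse hΦd (by simp)
    have h2 : ∀ᶠ y in 𝓝 y₀, y ∈ e₀.target ∧ y ∈ G.source ∧
        ∃ B : EuclideanSpace ℝ (Fin n) ≃L[ℝ] EuclideanSpace ℝ (Fin n), (B : _ →L[ℝ] _) =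
          fderiv ℝ Φ y := by
      refine (e₀.open_target.eventually_mem hy₀t).and ((G.open_source.eventually_mem hGy).and ?_)
      have hc : ContinuousAt (fderiv ℝ Φ) y₀ :=
        ((hΦs y₀ hy₀t).fderiv_right (m := ∞) (by simp)).continuousAt
      have hmem : range ((↑) : (EuclideanSpace ℝ (Fin n) ≃L[ℝ] EuclideanSpace ℝ (Fin n)) →
          EuclideanSpace ℝ (Fin n) →L[ℝ] EuclideanSpace ℝ (Fin n)) ∈ 𝓝 (fderiv ℝ Φ y₀) := by
        rw [hΦd.fderiv]
        exact ContinuousLinearEquiv.nhds T.toContinuousLinearEquiv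
      exact hc hmem
    have h3 : ContinuousAt G.symm (Φ y₀) := h1.continuousAt
    have h4 : G.symm (Φ y₀) = y₀ := G.left_inv hGy
    have h5 : ∀ᶠ z in 𝓝 (Φ y₀), z ∈ G.target := G.open_target.mem_nhds (G.map_source hGy)
    rw [← h4] at h2
    filter_upwards [h3.eventually h2, h5] with z ⟨hz1, hz2, B, hB⟩ hz3
    refine G.contDiffAt_symm (f₀' := B) hz3 ?_ (hΦs _ hz1)
    rw [hB]
    exact ((hΦs _ hz1).differentiableAt (by simp)).hasFDerivAt
  let e₁ := e₀ ≫ₕ G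
  have he₁p : e₁ p = Φ y₀ := rfl
  have hpe₁ : p ∈ e₁.source := by
    rw [OpenPartialHomeomorph.trans_source]
    exact ⟨hp, hGy⟩
  -- Restricting the target to a ball makes it convex, so that plaques can be traversed along
  -- segments.
  obtain ⟨r, hr, hball⟩ := Metric.eventually_nhds_iff_ball.mp
    (hinv.and (e₁.open_target.eventually_mem (e₁.map_source hpe₁)))
  let e := (e₁.symm.restrOpen (ball (Φ y₀) r) isOpen_ball).symm
  have hcoe : ∀ q, e q = Φ (e₀ q) := fun q => rfl
  have hcoes : ∀ z, e.symm z = e₀.symm (G.symm z) := fun z => rfl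
  have htarget : e.target = ball (Φ y₀) r := by
    have : e.target = e₁.target ∩ ball (Φ y₀) r := rfl
    rw [this]
    exact inter_eq_right.mpr fun z hz => (hball z hz).2
  have hsub : ∀ q ∈ e.source, q ∈ e₀.source := fun q hq => by
    have h1 : e.symm (e q) ∈ e₁.source := by
      have := e.map_source hq
      rw [htarget] at this
      exact e₁.map_target (hball _ this).2
    rw [e.left_inv hq, OpenPartialHomeomorph.trans_source] at h1
    exact h1.1
  refine ⟨e, ?_, ⟨?_, ?_, π ∘L P, ?_⟩⟩
  · have : e.symm (Φ y₀) = p := by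
      rw [← he₁p]
      exact e₁.left_inv hpe₁
    rw [← this]
    exact e.map_target (by rw [htarget]; exact mem_ball_self hr)
  · apply OpenPartialHomeomorph.mem_maximalAtlas_of_contMDiffOn
    · intro q hq
      exact ((hΦs _ (e₀.map_source (hsub q hq))).contMDiffAt.comp q
        (contMDiffAt_of_mem_maximalAtlas he₀ (hsub q hq))).contMDiffWithinAt
    · intro z hz
      rw [htarget] at hz
      have h1 := (hball z hz).1.contMDiffAt
      have h2 := contMDiffAt_symm_of_mem_maximalAtlas he₀ (x := G.symm z) (by
        have h3 := (hball z hz).2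
        rw [OpenPartialHomeomorph.trans_target] at h3
        exact h3.2)
      exact (h2.comp z h1).contMDiffWithinAt
  · rw [htarget]
    exact convex_ball _ _
  · intro q hq j hj
    have h1 : f q = g (e₀ q) := by simp [hg, e₀.left_inv (hsub q hq)]
    have h2 : e q j = T' (e₀ q) j - π (T' (e₀ q)) j + π (P (g (e₀ q))) j := rfl
    rw [h2, hπ1 _ j hj, sub_self, zero_add, ← h1]
    rfl

namespace IsFlatChart

lemma apply_eq_of_eq (he : IsFlatChart f m e) {q q' : M} (hq : q ∈ e.source) (hq' : q' ∈ e.source)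
    (hqq : f q = f q') {j : Fin n} (hj : m ≤ (j : ℕ)) : e q j = e q' j := by
  obtain ⟨P, hP⟩ := he.factors
  rw [hP q hq j hj, hP q' hq' j hj, hqq]

/-- In a flat chart the kernel of the derivative is spanned by the first `m` coordinates. -/
lemma ker_fderiv (he : IsFlatChart f m e) (hf : HasConstantCorank n f m) (hm : m ≤ n)
    {y : EuclideanSpace ℝ (Fin n)} (hy : y ∈ e.target) :
    LinearMap.ker (fderiv ℝ (f ∘ e.symm) y).toLinearMap =
      LinearMap.range (padZero hm).toLinearMap := by
  apply Submodule.eq_of_le_of_finrank_eq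
  · intro v hv
    rw [mem_range_padZero]
    intro j hj
    -- The last coordinates are linear in `f`, so they vanish on vectors killed by its derivative.
    -- Equality then follows from the constant dimension of the kernel.
    obtain ⟨P, hP⟩ := he.factors
    have hd := ((contDiffAt_comp_chart_symm hf.smooth he.mem_atlas hy).differentiableAt
      (by simp)).hasFDerivAt
    let ev : EuclideanSpace ℝ (Fin n) →L[ℝ] ℝ := EuclideanSpace.proj j
    have h1 := (ev ∘L P).hasFDerivAt.comp y hd
    have h2 : ((ev ∘L P) ∘ (f ∘ e.symm)) =ᶠ[𝓝 y] ev := by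
      filter_upwards [e.open_target.mem_nhds hy] with z hz
      have := hP _ (e.map_target hz) j hj
      rw [e.right_inv hz] at this
      exact this.symm
    have h3 := (h1.congr_of_eventuallyEq h2.symm).unique ev.hasFDerivAt
    have h4 := DFunLike.congr_fun h3 v
    have h5 : fderiv ℝ (f ∘ e.symm) y v = 0 := hv
    have h6 : ev (P (fderiv ℝ (f ∘ e.symm) y v)) = ev v := h4
    rw [h5, map_zero, map_zero] at h6
    exact h6.symm
  · rw [finrank_range_padZero, finrank_ker_fderiv_chart hf he.mem_atlas hy]

lemma mem_ker_iff (he : IsFlatChart f m e) (hf : HasConstantCorank n f m) (hm : m ≤ n)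
    {q : M} (hq : q ∈ e.source) (v : TangentSpace (𝓡 n) q) :
    v ∈ LinearMap.ker (mvfderiv (𝓡 n) f q).toLinearMap ↔
      ∀ j : Fin n, m ≤ (j : ℕ) → mvfderiv (𝓡 n) e q v j = 0 := by
  rw [← mem_range_padZero hm, ← he.ker_fderiv hf hm (e.map_source hq), LinearMap.mem_ker,
    LinearMap.mem_ker]
  exact Eq.congr_left (mvfderiv_eq_fderiv_comp_chart hf.smooth he.mem_atlas hq v)

/-- The map is constant on the plaques of a flat chart. -/
lemma map_eq_of_apply_eq (he : IsFlatChart f m e) (hf : HasConstantCorank n f m) (hm : m ≤ n)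
    {y z : EuclideanSpace ℝ (Fin n)} (hy : y ∈ e.target) (hz : z ∈ e.target)
    (hyz : ∀ j : Fin n, m ≤ (j : ℕ) → y j = z j) : f (e.symm y) = f (e.symm z) := by
  -- By convexity this segment stays in the target, and its direction lies in the kernel throughout.
  let c : ℝ → EuclideanSpace ℝ (Fin n) := fun t => y + t • (z - y)
  have hct : ∀ t ∈ Icc (0 : ℝ) 1, c t ∈ e.target := fun t ht =>
    he.convex.add_smul_sub_mem hy hz ht
  have hzy : z - y ∈ LinearMap.range (padZero hm).toLinearMap := by
    rw [mem_range_padZero]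
    intro j hj
    simp [hyz j hj]
  have hd : ∀ t ∈ Icc (0 : ℝ) 1, HasDerivAt (fun t => (f ∘ e.symm) (c t)) 0 t := by
    intro t ht
    have h1 : HasDerivAt c (z - y) t := by
      simpa [c] using! ((hasDerivAt_id t).smul_const (z - y)).const_add y
    have h2 := ((contDiffAt_comp_chart_symm hf.smooth he.mem_atlas (hct t ht)).differentiableAt
      (by simp)).hasFDerivAt.comp_hasDerivAt t h1
    have h3 : fderiv ℝ (f ∘ e.symm) (c t) (z - y) = 0 := by
      rw [← he.ker_fderiv hf hm (hct t ht)] at hzy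
      exact hzy
    rw [h3] at h2
    exact h2
  have h := constant_of_has_deriv_right_zero (a := (0 : ℝ)) (b := 1)
    (fun t ht => (hd t ht).continuousAt.continuousWithinAt)
    (fun t ht => (hd t ⟨ht.1, ht.2.le⟩).hasDerivWithinAt) 1 (by simp)
  simpa [c] using h.symm

/-- The range of the derivative is the same at all points of a plaque of a flat chart. -/
lemma range_mvfderiv_eq (he : IsFlatChart f m e) (hf : HasConstantCorank n f m) (hm : m ≤ n)
    {q q' : M} (hq : q ∈ e.source) (hq' : q' ∈ e.source) (hqq : f q = f q') :
    LinearMap.range (mvfderiv (𝓡 n) f q).toLinearMap =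
      LinearMap.range (mvfderiv (𝓡 n) f q').toLinearMap := by
  have hrange : ∀ q ∈ e.source, LinearMap.range (mvfderiv (𝓡 n) f q).toLinearMap =
      LinearMap.range (fderiv ℝ (f ∘ e.symm) (e q)).toLinearMap := by
    intro q hq
    ext w
    constructor
    · rintro ⟨v, rfl⟩
      exact ⟨mvfderiv (𝓡 n) e q v, (mvfderiv_eq_fderiv_comp_chart hf.smooth he.mem_atlas hq v).symm⟩
    · rintro ⟨v, rfl⟩
      obtain ⟨v, rfl⟩ := (mvfderiv_chart_bijective he.mem_atlas hq).2 v
      exact ⟨v, mvfderiv_eq_fderiv_comp_chart hf.smooth he.mem_atlas hq v⟩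
  rw [hrange q hq, hrange q' hq']
  congr 2
  -- The translation by `a` preserves the last coordinates, hence preserves `f` in the chart, so the
  -- derivatives at the two points coincide.
  set a := e q' - e q with ha
  have haj : ∀ j : Fin n, m ≤ (j : ℕ) → a j = 0 := fun j hj => by
    rw [ha]
    simp [he.apply_eq_of_eq hq hq' hqq hj]
  have h1 : (f ∘ e.symm) =ᶠ[𝓝 (e q)] fun z => (f ∘ e.symm) (z + a) := by
    have hc : ContinuousAt (fun z => z + a) (e q) := by fun_prop
    have hmem : ∀ᶠ z in 𝓝 (e q), z + a ∈ e.target :=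
      hc (e.open_target.mem_nhds (by simpa [ha] using e.map_source hq'))
    filter_upwards [hmem, e.open_target.mem_nhds (e.map_source hq)] with z hz hz'
    exact he.map_eq_of_apply_eq hf hm hz' hz fun j hj => by simp [haj j hj]
  rw [h1.fderiv_eq, fderiv_comp_add_right, ha, add_sub_cancel]

end IsFlatChart

/-- The kernel of the derivative of a map of constant rank is an integrable distribution. -/
lemma HasConstantCorank.isIntegrable [IsManifold (𝓡 n) ∞ M] [FiniteDimensional ℝ Y]
    (hf : HasConstantCorank n f m) :
    IsIntegrable (fun p => LinearMap.ker (mvfderiv (𝓡 n) f p).toLinearMap) m := by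
  intro p
  obtain ⟨e, hp, he⟩ := hf.exists_isFlatChart p
  exact ⟨hf.le p, e, he.mem_atlas, hp, fun q hq v => he.mem_ker_iff hf (hf.le p) hq v⟩

end ConstantRank

/-! ### The manifold structure on a fibre. -/

section Fibre

variable {n m : ℕ} {M : Type*} [TopologicalSpace M] [ChartedSpace (EuclideanSpace ℝ (Fin n)) M]
  {Y : Type*} [NormedAddCommGroup Y] [NormedSpace ℝ Y]
  {e : OpenPartialHomeomorph M (EuclideanSpace ℝ (Fin n))} {f : M → Y} {c : Y}

/-- The parametrization by `ℝ^m` of the points having the same last coordinates as `z`. -/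
def plaqueSection (hm : m ≤ n) (z : EuclideanSpace ℝ (Fin n)) (y : EuclideanSpace ℝ (Fin m)) :
    EuclideanSpace ℝ (Fin n) :=
  padZero hm y + (z - padZero hm (takeFirst hm z))

lemma plaqueSection_apply_of_le (hm : m ≤ n) (z : EuclideanSpace ℝ (Fin n))
    (y : EuclideanSpace ℝ (Fin m)) {j : Fin n} (hj : m ≤ (j : ℕ)) :
    plaqueSection hm z y j = z j := by
  simp [plaqueSection, padZero_apply_of_le hm _ hj]

lemma takeFirst_plaqueSection (hm : m ≤ n) (z : EuclideanSpace ℝ (Fin n))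
    (y : EuclideanSpace ℝ (Fin m)) : takeFirst hm (plaqueSection hm z y) = y := by
  simp [plaqueSection, takeFirst_padZero]

lemma plaqueSection_takeFirst (hm : m ≤ n) {z w : EuclideanSpace ℝ (Fin n)}
    (h : ∀ j : Fin n, m ≤ (j : ℕ) → w j = z j) : plaqueSection hm z (takeFirst hm w) = w :=
  ext_takeFirst hm (takeFirst_plaqueSection hm _ _) fun j hj => by
    rw [plaqueSection_apply_of_le hm _ _ hj, h j hj]

lemma contDiff_plaqueSection (hm : m ≤ n) (z : EuclideanSpace ℝ (Fin n)) :
    ContDiff ℝ ∞ (plaqueSection hm z) :=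
  (padZero hm).contDiff.add contDiff_const

open Classical in
/-- The chart of a fibre of a map of constant rank given by a flat chart of the manifold. -/
def fibreChart (hf : HasConstantCorank n f m) (hm : m ≤ n) (he : IsFlatChart f m e)
    (q : f ⁻¹' {c}) (hq : (q : M) ∈ e.source) :
    OpenPartialHomeomorph (f ⁻¹' {c}) (EuclideanSpace ℝ (Fin m)) where
  toFun k := takeFirst hm (e k)
  -- Off the target the value `q` is arbitrary.
  invFun y := if hy : plaqueSection hm (e q) y ∈ e.target then
    ⟨e.symm (plaqueSection hm (e q) y), by
      have := he.map_eq_of_apply_eq hf hm hy (e.map_source hq)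
        fun j hj => plaqueSection_apply_of_le hm _ _ hj
      rw [e.left_inv hq] at this
      exact this.trans q.2⟩ else q
  -- The last coordinates are functions of `f`, so all points of the fibre in the domain of `e` lie
  -- on one plaque, where the first `m` coordinates are enough.
  source := {k | (k : M) ∈ e.source}
  target := {y | plaqueSection hm (e q) y ∈ e.target}
  map_source' k hk := by
    change plaqueSection hm (e q) (takeFirst hm (e k)) ∈ e.target
    rw [plaqueSection_takeFirst hm fun j hj =>
      he.apply_eq_of_eq hk hq (k.2.trans q.2.symm) hj]
    exact e.map_source hk
  map_target' y hy := by
    rw [dif_pos (show plaqueSection hm (e q) y ∈ e.target from hy)]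
    exact e.map_target hy
  left_inv' k hk := by
    have h1 : plaqueSection hm (e q) (takeFirst hm (e k)) = e k :=
      plaqueSection_takeFirst hm fun j hj => he.apply_eq_of_eq hk hq (k.2.trans q.2.symm) hj
    have h2 : plaqueSection hm (e q) (takeFirst hm (e k)) ∈ e.target := by
      rw [h1]
      exact e.map_source hk
    rw [dif_pos h2]
    ext1
    change e.symm (plaqueSection hm (e q) (takeFirst hm (e k))) = k
    rw [h1, e.left_inv hk]
  right_inv' y hy := by
    rw [dif_pos (show plaqueSection hm (e q) y ∈ e.target from hy)]
    change takeFirst hm (e (e.symm _)) = y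
    rw [e.right_inv hy, takeFirst_plaqueSection]
  open_source := e.open_source.preimage continuous_subtype_val
  open_target := e.open_target.preimage (contDiff_plaqueSection hm _).continuous
  continuousOn_toFun := (takeFirst hm).continuous.comp_continuousOn
    (e.continuousOn.comp continuous_subtype_val.continuousOn fun _ hk => hk)
  continuousOn_invFun := by
    rw [IsInducing.subtypeVal.continuousOn_iff]
    refine (e.continuousOn_symm.comp (contDiff_plaqueSection hm (e q)).continuous.continuousOn
      fun _ hy => hy).congr fun y hy => ?_
    simp only [Function.comp_apply]
    rw [dif_pos (show plaqueSection hm (e q) y ∈ e.target from hy)]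

section

variable (hf : HasConstantCorank n f m) (hm : m ≤ n) (he : IsFlatChart f m e)
  (q : f ⁻¹' {c}) (hq : (q : M) ∈ e.source)

lemma fibreChart_apply (k : f ⁻¹' {c}) : fibreChart hf hm he q hq k = takeFirst hm (e k) := rfl

lemma mem_fibreChart_source (k : f ⁻¹' {c}) :
    k ∈ (fibreChart hf hm he q hq).source ↔ (k : M) ∈ e.source := Iff.rfl

lemma coe_fibreChart_symm {y : EuclideanSpace ℝ (Fin m)}
    (hy : y ∈ (fibreChart hf hm he q hq).target) :
    ((fibreChart hf hm he q hq).symm y : M) = e.symm (plaqueSection hm (e q) y) := by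
  have : (fibreChart hf hm he q hq).symm y = _ :=
    dif_pos (show plaqueSection hm (e q) y ∈ e.target from hy)
  rw [this]

end

variable [IsManifold (𝓡 n) ∞ M] [FiniteDimensional ℝ Y]

/-- A flat chart around a given point. -/
def flatChart (hf : HasConstantCorank n f m) (p : M) :
    OpenPartialHomeomorph M (EuclideanSpace ℝ (Fin n)) :=
  (hf.exists_isFlatChart p).choose

lemma mem_flatChart_source (hf : HasConstantCorank n f m) (p : M) : p ∈ (flatChart hf p).source :=
  (hf.exists_isFlatChart p).choose_spec.1

lemma isFlatChart_flatChart (hf : HasConstantCorank n f m) (p : M) :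
    IsFlatChart f m (flatChart hf p) :=
  (hf.exists_isFlatChart p).choose_spec.2

/-- The charts on the fibre of a map of constant rank. -/
@[reducible] def fibreChartedSpace (hf : HasConstantCorank n f m) (c : Y) :
    ChartedSpace (EuclideanSpace ℝ (Fin m)) (f ⁻¹' {c}) where
  atlas := range fun q : f ⁻¹' {c} => fibreChart hf (hf.le (q : M)) (isFlatChart_flatChart hf q) q
    (mem_flatChart_source hf q)
  chartAt q := fibreChart hf (hf.le (q : M)) (isFlatChart_flatChart hf q) q
    (mem_flatChart_source hf q)
  mem_chart_source q := mem_flatChart_source hf q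
  chart_mem_atlas q := mem_range_self q

lemma isManifold_fibre (hf : HasConstantCorank n f m) (c : Y) :
    letI := fibreChartedSpace hf c
    IsManifold (𝓡 m) ∞ (f ⁻¹' {c}) := by
  let _ := fibreChartedSpace hf c
  apply isManifold_of_contDiffOn
  rintro _ _ ⟨q, rfl⟩ ⟨q', rfl⟩
  simp only [modelWithCornersSelf_coe, modelWithCornersSelf_coe_symm, Function.id_comp,
    Function.comp_id, preimage_id, range_id, inter_univ]
  set hm := hf.le (q : M)
  set e := flatChart hf (q : M)
  set e' := flatChart hf (q' : M)
  intro y hy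
  rw [OpenPartialHomeomorph.trans_source] at hy
  obtain ⟨hy1, hy2⟩ := hy
  have hy2' : e.symm (plaqueSection hm (e q) y) ∈ e'.source := by
    have : (fibreChart hf hm (isFlatChart_flatChart hf q) q (mem_flatChart_source hf q)).symm y ∈
      (fibreChart hf hm (isFlatChart_flatChart hf q') q' (mem_flatChart_source hf q')).source := hy2
    rw [mem_fibreChart_source, coe_fibreChart_symm _ _ _ _ _ hy1] at this
    exact this
  have h1 := contMDiffAt_symm_of_mem_maximalAtlas (isFlatChart_flatChart hf (q : M)).mem_atlas hy1
  have h2 := contMDiffAt_of_mem_maximalAtlas (isFlatChart_flatChart hf (q' : M)).mem_atlas hy2'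
  have h3 : ContDiffAt ℝ ∞ (e' ∘ e.symm) (plaqueSection hm (e q) y) := (h2.comp _ h1).contDiffAt
  have h4 := (takeFirst hm).contDiff.contDiffAt.comp y
    (h3.comp y (contDiff_plaqueSection hm (e q)).contDiffAt)
  refine (h4.congr_of_eventuallyEq ?_).contDiffWithinAt
  filter_upwards [(fibreChart hf hm (isFlatChart_flatChart hf q) q
    (mem_flatChart_source hf q)).open_target.mem_nhds hy1] with z hz
  have := coe_fibreChart_symm hf hm (isFlatChart_flatChart hf q) q (mem_flatChart_source hf q) hz
  simp only [OpenPartialHomeomorph.coe_trans, Function.comp_apply, fibreChart_apply]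
  rw [this]

lemma contMDiff_fibre_val (hf : HasConstantCorank n f m) (c : Y) :
    letI := fibreChartedSpace hf c
    ContMDiff (𝓡 m) (𝓡 n) ∞ (Subtype.val : f ⁻¹' {c} → M) := by
  let _ := fibreChartedSpace hf c
  have := isManifold_fibre hf c
  intro q
  set hm := hf.le (q : M)
  set e := flatChart hf (q : M)
  have hq := mem_flatChart_source hf (q : M)
  let χ := chartAt (EuclideanSpace ℝ (Fin m)) q
  have hqχ : q ∈ χ.source := mem_chart_source _ q
  have hχ : χ = fibreChart hf hm (isFlatChart_flatChart hf q) q hq := rfl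
  have hχa : ContMDiffAt (𝓡 m) (𝓡 m) ∞ χ q :=
    contMDiffAt_of_mem_maximalAtlas (IsManifold.chart_mem_maximalAtlas q) hqχ
  have h0 : plaqueSection hm (e q) (χ q) = e q := plaqueSection_takeFirst hm fun _ _ => rfl
  have h1 := contMDiffAt_symm_of_mem_maximalAtlas (isFlatChart_flatChart hf (q : M)).mem_atlas
    ((flatChart hf (q : M)).map_source hq)
  rw [← h0] at h1
  have h2 := h1.comp (χ q) (contDiff_plaqueSection hm (e q)).contDiffAt.contMDiffAt
  have h3 := h2.comp q hχa
  refine h3.congr_of_eventuallyEq ?_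
  filter_upwards [χ.open_source.mem_nhds hqχ] with k hk
  have h4 := coe_fibreChart_symm hf hm (isFlatChart_flatChart hf q) q hq (χ.map_source hk)
  rw [← hχ, χ.left_inv hk] at h4
  exact h4

/-- The chart of the fibre factors as `takeFirst ∘ e ∘ Subtype.val` and has injective derivative, so
its innermost factor does too. -/
lemma injective_mfderiv_fibre_val (hf : HasConstantCorank n f m) (c : Y) (q : f ⁻¹' {c}) :
    letI := fibreChartedSpace hf c
    Function.Injective (mfderiv (𝓡 m) (𝓡 n) (Subtype.val : f ⁻¹' {c} → M) q) := by
  let _ := fibreChartedSpace hf c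
  have := isManifold_fibre hf c
  set hm := hf.le (q : M)
  set e := flatChart hf (q : M)
  have hq := mem_flatChart_source hf (q : M)
  let χ := chartAt (EuclideanSpace ℝ (Fin m)) q
  have hqχ : q ∈ χ.source := mem_chart_source _ q
  have h1 := ((contMDiff_fibre_val hf c).mdifferentiableAt (x := q) (by simp)).hasMFDerivAt
  have h2 := ((contMDiffAt_of_mem_maximalAtlas (isFlatChart_flatChart hf (q : M)).mem_atlas
    hq).mdifferentiableAt (by simp)).hasMFDerivAt
  have h3 : HasMFDerivAt (𝓡 n) (𝓡 m) (takeFirst hm) (e q) (takeFirst hm) :=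
    (takeFirst hm).hasFDerivAt.hasMFDerivAt
  have h4 := (h3.comp (q : M) h2).comp q h1
  have h5 : mfderiv (𝓡 m) (𝓡 m) χ q = _ := h4.mfderiv
  have h6 := (mdifferentiable_of_mem_maximalAtlas
    (IsManifold.chart_mem_maximalAtlas (I := 𝓡 m) (n := ∞) q)).mfderiv_bijective hqχ
  have h7 : Function.Injective (mfderiv (𝓡 m) (𝓡 m) χ q) := h6.1
  rw [h5] at h7
  intro v w hvw
  refine h7 ?_
  change takeFirst hm (mfderiv (𝓡 n) (𝓡 n) (flatChart hf (q : M)) (q : M) (mfderiv (𝓡 m) (𝓡 n)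
    (Subtype.val : f ⁻¹' {c} → M) q v)) = takeFirst hm (mfderiv (𝓡 n) (𝓡 n)
      (flatChart hf (q : M)) (q : M) (mfderiv (𝓡 m) (𝓡 n) (Subtype.val : f ⁻¹' {c} → M) q w))
  rw [hvw]

end Fibre

universe u

/-! ### Integral manifolds as components of fibres. -/

section Leaf

variable {n m : ℕ} {M : Type u} [TopologicalSpace M] [ChartedSpace (EuclideanSpace ℝ (Fin n)) M]
  {Y : Type*} [NormedAddCommGroup Y] [NormedSpace ℝ Y] {f : M → Y}

open Classical in
-- The map `g`, extended by a junk value off `U`, is a left inverse of the inclusion and is smooth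
-- at `a`.
lemma injective_mfderiv_opens_val {K : Type*} [TopologicalSpace K]
    [ChartedSpace (EuclideanSpace ℝ (Fin m)) K] (U : TopologicalSpace.Opens K) (a : U) :
    Function.Injective (mfderiv (𝓡 m) (𝓡 m) (Subtype.val : U → K) a) := by
  let g : K → U := fun k => if hk : k ∈ U then ⟨k, hk⟩ else a
  have hg : (fun z : U => g z) = id := by
    funext z
    simp [g]
  have h1 : ContMDiffAt (𝓡 m) (𝓡 m) ∞ g (a : K) := by
    rw [← contMDiffAt_subtype_iff, hg]
    exact contMDiffAt_id
  have h2 := ((contMDiff_subtype_val (I := 𝓡 m) (n := ∞) (U := U)).mdifferentiableAt (x := a)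
    (by simp)).hasMFDerivAt
  have h3 := ((h1.mdifferentiableAt (by simp)).hasMFDerivAt.comp a h2).mfderiv
  have h4 : g ∘ (Subtype.val : U → K) = id := hg
  rw [h4, mfderiv_id] at h3
  intro v w hvw
  have hv := DFunLike.congr_fun h3 v
  have hw := DFunLike.congr_fun h3 w
  change v = mfderiv (𝓡 m) (𝓡 m) g (a : K) (mfderiv (𝓡 m) (𝓡 m) (Subtype.val : U → K) a v) at hv
  change w = mfderiv (𝓡 m) (𝓡 m) g (a : K) (mfderiv (𝓡 m) (𝓡 m) (Subtype.val : U → K) a w) at hw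
  rw [hv, hw, hvw]

/-- Constancy of `f ∘ g` puts the range inside the kernel; both have dimension `m`. -/
lemma range_mfderiv_eq_ker {N : Type*} [TopologicalSpace N]
    [ChartedSpace (EuclideanSpace ℝ (Fin m)) N] (hf : HasConstantCorank n f m) {g : N → M} {a : N}
    (hg : MDifferentiableAt (𝓡 m) (𝓡 n) g a)
    (hinj : Function.Injective (mfderiv (𝓡 m) (𝓡 n) g a)) {c : Y} (hc : ∀ b, f (g b) = c) :
    LinearMap.range (mfderiv (𝓡 m) (𝓡 n) g a).toLinearMap =
      LinearMap.ker (mvfderiv (𝓡 n) f (g a)).toLinearMap := by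
  apply Submodule.eq_of_le_of_finrank_eq
  · rintro _ ⟨v, rfl⟩
    have h1 := (hf.smooth.mdifferentiableAt (x := g a) (by simp)).hasMFDerivAt.comp a
      hg.hasMFDerivAt
    have h2 : f ∘ g = fun _ => c := funext hc
    rw [h2] at h1
    have h3 := h1.mfderiv
    rw [mfderiv_const] at h3
    exact (DFunLike.congr_fun h3 v).symm
  · rw [hf.finrank_ker, LinearMap.finrank_range_of_inj hinj, finrank_tangentSpace]

/-- A map of constant rank is constant on the connected integral manifolds of its kernel. -/
lemma IntegralManifold.map_eq (hf : HasConstantCorank n f m)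
    (N : IntegralManifold (fun p => LinearMap.ker (mvfderiv (𝓡 n) f p).toLinearMap) m)
    (a b : N.carrier) : f (N.incl a) = f (N.incl b) := by
  have hs : ContMDiff (𝓡 m) 𝓘(ℝ, Y) ∞ (f ∘ N.incl) := hf.smooth.comp N.smooth
  have hzero : ∀ a v, mvfderiv (𝓡 m) (f ∘ N.incl) a v = 0 := by
    intro a v
    have h1 := (hf.smooth.mdifferentiableAt (x := N.incl a) (by simp)).hasMFDerivAt.comp a
      (N.smooth.mdifferentiableAt (x := a) (by simp)).hasMFDerivAt
    have h2 : mvfderiv (𝓡 m) (f ∘ N.incl) a v =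
      mvfderiv (𝓡 n) f (N.incl a) (mfderiv (𝓡 m) (𝓡 n) N.incl a v) := DFunLike.congr_fun h1.mfderiv v
    rw [h2]
    have h3 : mfderiv (𝓡 m) (𝓡 n) N.incl a v ∈
        LinearMap.ker (mvfderiv (𝓡 n) f (N.incl a)).toLinearMap := by
      rw [← N.tangent a]
      exact ⟨v, rfl⟩
    exact h3
  have hloc : IsLocallyConstant (f ∘ N.incl) := by
    rw [IsLocallyConstant.iff_eventually_eq]
    intro a
    let χ := chartAt (EuclideanSpace ℝ (Fin m)) a
    have hχ : χ ∈ IsManifold.maximalAtlas (𝓡 m) ∞ N.carrier := chartAt_mem a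
    have ha : a ∈ χ.source := mem_chart_source _ a
    obtain ⟨r, hr, hball⟩ := Metric.isOpen_iff.mp χ.open_target _ (χ.map_source ha)
    have hd : ∀ y ∈ ball (χ a) r, DifferentiableAt ℝ ((f ∘ N.incl) ∘ χ.symm) y := fun y hy =>
      (contDiffAt_comp_chart_symm hs hχ (hball hy)).differentiableAt (by simp)
    have hd0 : ∀ y ∈ ball (χ a) r, fderiv ℝ ((f ∘ N.incl) ∘ χ.symm) y = 0 := by
      intro y hy
      ext1 w
      have hy' := χ.map_target (hball hy)
      obtain ⟨v, rfl⟩ := (mvfderiv_chart_bijective hχ hy').2 w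
      have h1 := mvfderiv_eq_fderiv_comp_chart hs hχ hy' v
      rw [χ.right_inv (hball hy), hzero] at h1
      exact h1.symm
    have hc : ContinuousAt χ a := χ.continuousAt ha
    filter_upwards [hc (ball_mem_nhds _ hr), χ.open_source.mem_nhds ha] with b hb hb'
    have := isOpen_ball.is_const_of_fderiv_eq_zero (convex_ball (χ a) r).isPreconnected
      (fun y hy => (hd y hy).differentiableWithinAt) hd0 hb (mem_ball_self hr)
    simpa [χ.left_inv hb', χ.left_inv ha] using this
  exact hloc.apply_eq_of_preconnectedSpace a b

lemma IntegralManifold.image_subset (hf : HasConstantCorank n f m)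
    (N : IntegralManifold (fun p => LinearMap.ker (mvfderiv (𝓡 n) f p).toLinearMap) m) {p : M}
    (hp : p ∈ N.image) : N.image ⊆ connectedComponentIn (f ⁻¹' {f p}) p := by
  obtain ⟨a, rfl⟩ := hp
  refine (isPreconnected_range N.smooth.continuous).subset_connectedComponentIn ⟨a, rfl⟩ ?_
  rintro _ ⟨b, rfl⟩
  exact N.map_eq hf b a

/-- A fibre is locally connected, so its component through `p` is open in it and inherits the
manifold structure. With `IntegralManifold.image_subset` this is the largest connected integral
manifold through `p`. -/
lemma HasConstantCorank.exists_leaf [T2Space M] [SecondCountableTopology M]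
    [IsManifold (𝓡 n) ∞ M] [FiniteDimensional ℝ Y] (hf : HasConstantCorank n f m) (p : M) :
    ∃ L : IntegralManifold (fun p => LinearMap.ker (mvfderiv (𝓡 n) f p).toLinearMap) m,
      L.image = connectedComponentIn (f ⁻¹' {f p}) p := by
  set c := f p with hc
  let _ := fibreChartedSpace hf c
  have := isManifold_fibre hf c
  let p' : f ⁻¹' {c} := ⟨p, rfl⟩
  have : LocallyConnectedSpace (f ⁻¹' {c}) :=
    ChartedSpace.locallyConnectedSpace (EuclideanSpace ℝ (Fin m)) _
  let U : TopologicalSpace.Opens (f ⁻¹' {c}) := ⟨connectedComponent p', isOpen_connectedComponent⟩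
  have : ConnectedSpace U := Subtype.connectedSpace isConnected_connectedComponent
  let incl : U → M := fun a => ((a : f ⁻¹' {c}) : M)
  have hsm : ContMDiff (𝓡 m) (𝓡 n) ∞ incl := (contMDiff_fibre_val hf c).comp contMDiff_subtype_val
  have himm : ∀ a, Function.Injective (mfderiv (𝓡 m) (𝓡 n) incl a) := by
    intro a
    have h1 := ((contMDiff_fibre_val hf c).mdifferentiableAt (x := (a : f ⁻¹' {c}))
      (by simp)).hasMFDerivAt
    have h2 := ((contMDiff_subtype_val (I := 𝓡 m) (n := ∞) (U := U)).mdifferentiableAt (x := a)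
      (by simp)).hasMFDerivAt
    have h3 : mfderiv (𝓡 m) (𝓡 n) incl a = _ := (h1.comp a h2).mfderiv
    rw [h3]
    refine (injective_mfderiv_fibre_val hf c a).comp ?_
    exact injective_mfderiv_opens_val U a
  refine ⟨{ carrier := U
            incl := incl
            smooth := hsm
            injective := Subtype.val_injective.comp Subtype.val_injective
            immersion := himm
            tangent := fun a => range_mfderiv_eq_ker hf (hsm.mdifferentiableAt (by simp)) (himm a)
              (c := c) fun b => (b : f ⁻¹' {c}).2 }, ?_⟩
  have h1 : connectedComponentIn (f ⁻¹' {c}) p = Subtype.val '' connectedComponent p' :=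
    connectedComponentIn_eq_image (F := f ⁻¹' {c}) rfl
  rw [h1]
  ext q
  constructor
  · rintro ⟨a, rfl⟩
    exact ⟨a, a.2, rfl⟩
  · rintro ⟨a, ha, rfl⟩
    exact ⟨⟨a, ha⟩, rfl⟩

end Leaf

/-! ### Lifting Lipschitz paths through a local homeomorphism. -/

section PathLifting

variable {X Y : Type*} [TopologicalSpace X] [PseudoEMetricSpace Y] {p : X → Y}
  {d : X → X → ℝ≥0∞} {C : ℝ≥0}

/-- A lift on `[0, T]` of the path `γ` which starts at `a` and is Lipschitz for the distance `d`. -/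
structure IsLiftUpTo (p : X → Y) (d : X → X → ℝ≥0∞) (γ : ℝ → Y) (L : ℝ≥0∞) (a : X) (T : ℝ)
    (Γ : ℝ → X) : Prop where
  continuousOn : ContinuousOn Γ (Icc 0 T)
  start : Γ 0 = a
  lifts : ∀ t ∈ Icc 0 T, p (Γ t) = γ t
  bound : ∀ s ∈ Icc 0 T, ∀ t ∈ Icc 0 T, s ≤ t → d (Γ s) (Γ t) ≤ L * ENNReal.ofReal (t - s)

lemma IsLiftUpTo.mono {γ : ℝ → Y} {L : ℝ≥0∞} {a : X} {T T' : ℝ} {Γ : ℝ → X}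
    (h : IsLiftUpTo p d γ L a T Γ) (hT : T' ≤ T) : IsLiftUpTo p d γ L a T' Γ :=
  have hsub : Icc 0 T' ⊆ Icc 0 T := Icc_subset_Icc_right hT
  ⟨h.continuousOn.mono hsub, h.start, fun t ht => h.lifts t (hsub ht),
    fun s hs t ht => h.bound s (hsub hs) t (hsub ht)⟩

lemma IsLiftUpTo.apply_eq [T2Space X] (hp : IsLocalHomeomorph p) {γ : ℝ → Y} {L : ℝ≥0∞} {a : X} {T T' t : ℝ}
    {Γ Γ' : ℝ → X} (h : IsLiftUpTo p d γ L a T Γ) (h' : IsLiftUpTo p d γ L a T' Γ')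
    (ht0 : 0 ≤ t) (ht : t ≤ T) (ht' : t ≤ T') : Γ t = Γ' t := by
  have h1 := h.mono ht
  have h2 := h'.mono ht'
  exact (T2Space.isSeparatedMap p).eqOn_of_comp_eqOn hp.isLocallyInjective isPreconnected_Icc
    h1.continuousOn h2.continuousOn (fun s hs => (h1.lifts s hs).trans (h2.lifts s hs).symm)
    (left_mem_Icc.mpr ht0) (h1.start.trans h2.start.symm) (right_mem_Icc.mpr ht0)

/-- Lifts of a path can be continued across every point over which the end points of the lifts
accumulate. -/
lemma exists_lift_extension (hp : IsLocalHomeomorph p)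
    (htri : ∀ x y z, d x z ≤ d x y + d y z)
    (hloc : ∀ a, ∃ U ∈ 𝓝 a, ∀ b ∈ U, ∀ b' ∈ U, d b b' ≤ C * edist (p b) (p b'))
    {γ : ℝ → Y} {K : ℝ≥0} (hγ : LipschitzOnWith K γ (Icc 0 1)) {b : X} {t₀ : ℝ}
    (ht₀ : t₀ ∈ Icc (0 : ℝ) 1) (hb : p b = γ t₀) :
    ∃ U ∈ 𝓝 b, ∃ δ > 0, ∀ a Γ t₁, t₁ ∈ Icc (0 : ℝ) 1 → |t₁ - t₀| < δ →
      IsLiftUpTo p d γ (C * K) a t₁ Γ → Γ t₁ ∈ U → ∀ t₂ ∈ Icc t₁ 1, |t₂ - t₀| < δ →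
        ∃ Γ', IsLiftUpTo p d γ (C * K) a t₂ Γ' := by
  obtain ⟨e, heb, rfl⟩ := hp b
  obtain ⟨U₀, hU₀, hU₀d⟩ := hloc b
  obtain ⟨W, hWU, hWo, hbW⟩ := mem_nhds_iff.mp (inter_mem hU₀ (e.open_source.mem_nhds heb))
  have hVo : IsOpen (e.target ∩ e.symm ⁻¹' W) := e.isOpen_inter_preimage_symm hWo
  have hV : e.target ∩ e.symm ⁻¹' W ∈ 𝓝 (γ t₀) := by
    rw [← hb]
    exact hVo.mem_nhds ⟨e.map_source heb, by simpa [e.left_inv heb] using hbW⟩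
  -- `δ` depends only on `b` and `t₀`, not on the lift to be extended; this uniformity lets a
  -- sequence of lifts reach past its limit time.
  obtain ⟨δ, hδ, hδV⟩ := Metric.mem_nhdsWithin_iff.mp (hγ.continuousOn t₀ ht₀ hV)
  refine ⟨W, hWo.mem_nhds hbW, δ, hδ, fun a Γ t₁ ht₁ ht₁δ hΓ hΓW t₂ ht₂ ht₂δ => ?_⟩
  have hmem : ∀ t ∈ Icc t₁ t₂, γ t ∈ e.target ∩ e.symm ⁻¹' W := by
    intro t ht
    refine hδV ⟨?_, ⟨ht₁.1.trans ht.1, ht.2.trans ht₂.2⟩⟩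
    rw [mem_ball, Real.dist_eq]
    rw [abs_lt] at *
    exact ⟨by linarith [ht.1], by linarith [ht.2]⟩
  have hglue : e.symm (γ t₁) = Γ t₁ := by
    rw [← hΓ.lifts t₁ ⟨ht₁.1, le_rfl⟩, e.left_inv (hWU hΓW).2]
  let Γ' : ℝ → X := fun t => if t ≤ t₁ then Γ t else e.symm (γ t)
  have h1 : ∀ t, t ≤ t₁ → Γ' t = Γ t := fun t ht => if_pos ht
  have h2 : ∀ t, t₁ ≤ t → Γ' t = e.symm (γ t) := by
    intro t ht
    rcases ht.eq_or_lt with rfl | h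
    · rw [h1 _ le_rfl, hglue]
    · exact if_neg (not_le.mpr h)
  have hsub : Icc t₁ t₂ ⊆ Icc 0 1 := Icc_subset_Icc ht₁.1 ht₂.2
  have hb2 : ∀ s ∈ Icc t₁ t₂, ∀ t ∈ Icc t₁ t₂, s ≤ t →
      d (Γ' s) (Γ' t) ≤ C * K * ENNReal.ofReal (t - s) := by
    intro s hs t ht hst
    rw [h2 s hs.1, h2 t ht.1]
    refine (hU₀d _ (hWU (hmem s hs).2).1 _ (hWU (hmem t ht).2).1).trans ?_
    rw [e.right_inv (hmem s hs).1, e.right_inv (hmem t ht).1, mul_assoc]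
    gcongr
    refine (hγ (hsub hs) (hsub ht)).trans_eq ?_
    rw [edist_dist, Real.dist_eq, abs_sub_comm, abs_of_nonneg (sub_nonneg.mpr hst)]
  refine ⟨Γ', ⟨?_, ?_, ?_, ?_⟩⟩
  · rw [← Icc_union_Icc_eq_Icc ht₁.1 ht₂.1]
    refine ContinuousOn.union_of_isClosed ?_ ?_ isClosed_Icc isClosed_Icc
    · exact hΓ.continuousOn.congr fun t ht => h1 t ht.2
    · exact (e.continuousOn_symm.comp (hγ.continuousOn.mono hsub) fun t ht => (hmem t ht).1).congr
        fun t ht => h2 t ht.1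
  · rw [h1 0 ht₁.1, hΓ.start]
  · intro t ht
    rcases le_total t t₁ with h | h
    · rw [h1 t h, hΓ.lifts t ⟨ht.1, h⟩]
    · rw [h2 t h, e.right_inv (hmem t ⟨h, ht.2⟩).1]
  · intro s hs t ht hst
    rcases le_total t t₁ with h | h
    · rw [h1 t h, h1 s (hst.trans h)]
      exact hΓ.bound s ⟨hs.1, hst.trans h⟩ t ⟨ht.1, h⟩ hst
    rcases le_total s t₁ with h' | h'
    · have h3 := hΓ.bound s ⟨hs.1, h'⟩ t₁ ⟨ht₁.1, le_rfl⟩ h'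
      have h4 := hb2 t₁ ⟨le_rfl, ht₂.1⟩ t ⟨h, ht.2⟩ h
      rw [← h1 s h', ← h1 t₁ le_rfl] at h3
      calc d (Γ' s) (Γ' t) ≤ d (Γ' s) (Γ' t₁) + d (Γ' t₁) (Γ' t) := htri _ _ _
        _ ≤ C * K * ENNReal.ofReal (t₁ - s) + C * K * ENNReal.ofReal (t - t₁) := add_le_add h3 h4
        _ = C * K * ENNReal.ofReal (t - s) := by
          rw [← mul_add, ← ENNReal.ofReal_add (sub_nonneg.mpr h') (sub_nonneg.mpr h)]
          congr 2
          ring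
    · exact hb2 s ⟨h', hs.2⟩ t ⟨h, ht.2⟩ hst

/-- Lipschitz paths can be lifted through a local homeomorphism whose domain is complete. -/
lemma exists_path_lift [T2Space X] (hp : IsLocalHomeomorph p) (hsymm : ∀ x y, d x y = d y x)
    (htri : ∀ x y z, d x z ≤ d x y + d y z)
    (hloc : ∀ a, ∃ U ∈ 𝓝 a, ∀ b ∈ U, ∀ b' ∈ U, d b b' ≤ C * edist (p b) (p b'))
    (hcomp : ∀ s : ℕ → X, (∀ ε : ℝ≥0∞, 0 < ε → ∃ k, ∀ i ≥ k, ∀ j ≥ k, d (s i) (s j) < ε) →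
      ∃ b, Tendsto s atTop (𝓝 b))
    (hsep : ∀ y y' : Y, edist y y' = 0 → y = y')
    {γ : ℝ → Y} {K : ℝ≥0} (hγ : LipschitzOnWith K γ (Icc 0 1)) {a : X} (ha : p a = γ 0) :
    ∃ Γ : ℝ → X, ContinuousOn Γ (Icc 0 1) ∧ Γ 0 = a ∧ ∀ t ∈ Icc (0 : ℝ) 1, p (Γ t) = γ t := by
  let S : Set ℝ := {T | T ∈ Icc (0 : ℝ) 1 ∧ ∃ Γ, IsLiftUpTo p d γ (C * K) a T Γ}
  have hdself : ∀ b, d b b = 0 := by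
    intro b
    obtain ⟨U, hU, hd⟩ := hloc b
    simpa using hd b (mem_of_mem_nhds hU) b (mem_of_mem_nhds hU)
  have h0S : (0 : ℝ) ∈ S := by
    refine ⟨by simp, fun _ => a, continuousOn_const, rfl, fun t ht => ?_, fun s hs t ht _ => ?_⟩
    · rw [ha, le_antisymm ht.2 ht.1]
    · rw [hdself]
      exact bot_le
  have hbdd : BddAbove S := ⟨1, fun T hT => hT.1.2⟩
  set T := sSup S with hT
  have hT01 : T ∈ Icc (0 : ℝ) 1 := ⟨le_csSup hbdd h0S, csSup_le ⟨0, h0S⟩ fun t ht => ht.1.2⟩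
  -- Times approaching the supremum `T` of the liftable ones. Lifts agree where both are defined, so
  -- their end points inherit the Lipschitz bound, form a Cauchy sequence and converge by
  -- completeness.
  obtain ⟨τ, -, hτT, hτS⟩ := exists_seq_tendsto_sSup ⟨0, h0S⟩ hbdd
  choose hτ01 G hG using hτS
  have hle : ∀ i j, τ i ≤ τ j → d (G i (τ i)) (G j (τ j)) ≤ C * K * edist (τ i) (τ j) := by
    intro i j hij
    rw [(hG i).apply_eq hp (hG j) (hτ01 i).1 le_rfl hij, edist_dist, Real.dist_eq, abs_sub_comm,
      abs_of_nonneg (sub_nonneg.mpr hij)]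
    exact (hG j).bound _ ⟨(hτ01 i).1, hij⟩ _ ⟨(hτ01 j).1, le_rfl⟩ hij
  have hle' : ∀ i j, d (G i (τ i)) (G j (τ j)) ≤ C * K * edist (τ i) (τ j) := by
    intro i j
    rcases le_total (τ i) (τ j) with h | h
    · exact hle i j h
    · rw [hsymm, edist_comm]
      exact hle j i h
  obtain ⟨b, hb⟩ := hcomp (fun i => G i (τ i)) (by
    intro ε hε
    have hCK : (C * K : ℝ≥0∞) ≠ (⊤ : ℝ≥0∞) := ENNReal.mul_ne_top ENNReal.coe_ne_top ENNReal.coe_ne_top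
    -- The summand `1` guards against division by zero when `C * K = 0`.
    obtain ⟨k, hk⟩ := EMetric.cauchySeq_iff.mp hτT.cauchySeq (ε / (C * K + 1))
      (ENNReal.div_pos hε.ne' (by simp [hCK]))
    refine ⟨k, fun i hi j hj => ?_⟩
    have h1 := hk i hi j hj
    rw [ENNReal.lt_div_iff_mul_lt (by simp) (by simp [hCK])] at h1
    calc d (G i (τ i)) (G j (τ j)) ≤ C * K * edist (τ i) (τ j) := hle' i j
      _ ≤ edist (τ i) (τ j) * (C * K + 1) := by
        rw [mul_comm]
        gcongr
        exact le_self_add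
      _ < ε := h1)
  have hpb : p b = γ T := by
    have h1 : Tendsto (fun i => p (G i (τ i))) atTop (𝓝 (p b)) :=
      (hp.continuous.tendsto b).comp hb
    have h2 : Tendsto (fun i => γ (τ i)) atTop (𝓝 (γ T)) :=
      (hγ.continuousOn T hT01).tendsto.comp
        (tendsto_nhdsWithin_iff.mpr ⟨hτT, Eventually.of_forall hτ01⟩)
    have h3 : (fun i => p (G i (τ i))) = fun i => γ (τ i) :=
      funext fun i => (hG i).lifts _ ⟨(hτ01 i).1, le_rfl⟩
    rw [h3] at h1
    refine hsep _ _ ?_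
    have h4 : Tendsto (fun i => edist (γ (τ i)) (γ (τ i))) atTop (𝓝 (edist (p b) (γ T))) :=
      h1.edist h2
    simp only [edist_self] at h4
    exact (tendsto_nhds_unique h4 tendsto_const_nhds)
  obtain ⟨U, hU, δ, hδ, hext⟩ := exists_lift_extension hp htri hloc hγ hT01 hpb
  have hτδ : ∀ᶠ i in atTop, |τ i - T| < δ := by
    have := hτT (ball_mem_nhds T hδ)
    filter_upwards [this] with i hi
    simpa [Real.dist_eq] using! hi
  obtain ⟨i, hiU, hiδ⟩ := ((hb.eventually_mem hU).and hτδ).exists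
  have hiT : τ i ≤ T := le_csSup hbdd ⟨hτ01 i, G i, hG i⟩
  -- A lift ending close to the limit point extends beyond `T` unless `T = 1`, so the supremum can
  -- only be `1`.
  have hmem : min 1 (T + δ / 2) ∈ S := by
    refine ⟨⟨le_min zero_le_one (by linarith [hT01.1]), min_le_left _ _⟩, ?_⟩
    refine hext a (G i) (τ i) (hτ01 i) hiδ (hG i) hiU _ ⟨le_min (hτ01 i).2 (by linarith),
      min_le_left _ _⟩ ?_
    rw [abs_lt]
    have h1 : T ≤ min 1 (T + δ / 2) := le_min hT01.2 (by linarith)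
    have h2 : min 1 (T + δ / 2) ≤ T + δ / 2 := min_le_right _ _
    exact ⟨by linarith, by linarith⟩
  have h1S : (1 : ℝ) ∈ S := by
    have h1 : min 1 (T + δ / 2) ≤ T := le_csSup hbdd hmem
    rcases min_choice 1 (T + δ / 2) with h2 | h2
    · rwa [h2] at hmem
    · rw [h2] at h1
      linarith
  obtain ⟨-, Γ, hΓ⟩ := h1S
  exact ⟨Γ, hΓ.continuousOn, hΓ.start, hΓ.lifts⟩

end PathLifting

/-! ### Sections over charts: even covering and injectivity. -/

section Sections

variable {X Y Z : Type*} [TopologicalSpace X] [TopologicalSpace Y]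
  [NormedAddCommGroup Z] [NormedSpace ℝ Z] {p : X → Y}

/-- Through every point over the domain of the chart `χ` there is a section of `p`. -/
def HasSections {X Y Z : Type*} [TopologicalSpace X] [TopologicalSpace Y] [TopologicalSpace Z]
    (p : X → Y) (χ : OpenPartialHomeomorph Y Z) : Prop :=
  ∀ a, p a ∈ χ.source → ∃ σ : Z → X, Continuous σ ∧ (∀ z, p (σ z) = χ.symm z) ∧ σ (χ (p a)) = a

/-- The composite `p ∘ σ = χ.symm` is an open embedding and `p` is a local homeomorphism, so `σ` is
an open embedding. -/
lemma isOpen_range_section (hp : IsLocalHomeomorph p) {χ : OpenPartialHomeomorph Y Z}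
    (hχ : χ.target = univ) {σ : Z → X} (hσ : Continuous σ) (h : ∀ z, p (σ z) = χ.symm z) :
    IsOpen (range σ) := by
  have h1 : IsOpenEmbedding χ.symm := χ.symm.isOpenEmbedding hχ
  exact (hp.isOpenEmbedding_of_comp (by convert h1; exact funext h) hσ).isOpen_range

variable [T2Space X]

/-- Lift every segment issuing from `z₀` and take end points. Lifts from a fixed starting point
depend continuously on the path, and the constant segment lifts to the constant path at `a`. -/
lemma hasSections_of_path_lift (hp : IsLocalHomeomorph p) {χ : OpenPartialHomeomorph Y Z}
    (hχ : χ.target = univ)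
    (hlift : ∀ (z₀ z : Z) (a : X), p a = χ.symm z₀ → ∃ Γ : ℝ → X, ContinuousOn Γ (Icc 0 1) ∧
      Γ 0 = a ∧ ∀ t ∈ Icc (0 : ℝ) 1, p (Γ t) = χ.symm (z₀ + t • (z - z₀))) :
    HasSections p χ := by
  intro a ha
  set z₀ := χ (p a) with hz₀
  have ha' : p a = χ.symm z₀ := (χ.left_inv ha).symm
  choose Γ hΓc hΓ0 hΓl using fun z => hlift z₀ z a ha'
  have hχc : Continuous χ.symm := by
    have := χ.continuousOn_symm
    rwa [hχ, continuousOn_univ] at this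
  let f : C(unitInterval × Z, Y) :=
    ⟨fun q => χ.symm (z₀ + (q.1 : ℝ) • (q.2 - z₀)), hχc.comp (by fun_prop)⟩
  have hg := hp.continuous_lift (T2Space.isSeparatedMap p) f
    (g := fun q => Γ q.2 q.1) (funext fun q => hΓl q.2 q.1 q.1.2)
    (by simp only [Set.Icc.coe_zero, hΓ0]; exact continuous_const)
    (fun z => (hΓc z).comp_continuous continuous_subtype_val fun t => t.2)
  refine ⟨fun z => Γ z 1, ?_, fun z => ?_, ?_⟩
  · exact hg.comp (Continuous.prodMk_right (1 : unitInterval))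
  · have := hΓl z 1 (by simp)
    simpa using this
  · have h1 : EqOn (Γ z₀) (fun _ => a) (Icc 0 1) :=
      (T2Space.isSeparatedMap p).eqOn_of_comp_eqOn hp.isLocallyInjective isPreconnected_Icc
        (hΓc z₀) continuousOn_const (fun t ht => by
          simp only [Function.comp_apply]
          rw [hΓl z₀ t ht, ha', sub_self, smul_zero, add_zero])
        (left_mem_Icc.mpr zero_le_one) (hΓ0 z₀)
    exact h1 (right_mem_Icc.mpr zero_le_one)

lemma section_eq (hp : IsLocalHomeomorph p) {χ : OpenPartialHomeomorph Y Z} {σ σ' : Z → X}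
    (hσ : Continuous σ) (hσ' : Continuous σ') (h : ∀ z, p (σ z) = χ.symm z)
    (h' : ∀ z, p (σ' z) = χ.symm z) {z : Z} (hz : σ z = σ' z) : σ = σ' :=
  (T2Space.isSeparatedMap p).eq_of_comp_eq hp.isLocallyInjective hσ hσ'
    (funext fun z => (h z).trans (h' z).symm) z hz

/-- The sheets are the ranges of the sections through the points of the fibre over `y`. They are
open, are disjoint because sections that meet coincide, and exhaust the preimage because a section
passes through each of its points. -/
lemma isEvenlyCovered_of_hasSections (hp : IsLocalHomeomorph p) {χ : OpenPartialHomeomorph Y Z}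
    (hχ : χ.target = univ) (hs : HasSections p χ) {y : Y} (hy : y ∈ χ.source) :
    IsEvenlyCovered p y (p ⁻¹' {y}) := by
  have hd : DiscreteTopology (p ⁻¹' {y}) := by
    rw [discreteTopology_iff_locallyInjective y]
    have h1 := hp.isLocallyInjective.comp_right continuous_subtype_val
      (Subtype.val_injective (p := (· ∈ p ⁻¹' {y})))
    convert h1 using 1
    funext q
    exact q.2.symm
  rcases isEmpty_or_nonempty (p ⁻¹' {y}) with hemp | hne
  · refine .of_preimage_eq_empty _ (χ.open_source.mem_nhds hy) ?_
    rw [eq_empty_iff_forall_notMem]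
    intro a ha
    obtain ⟨σ, -, hσp, -⟩ := hs a ha
    exact hemp.elim ⟨σ (χ y), (hσp _).trans (χ.left_inv hy)⟩
  have hsec : ∀ i : p ⁻¹' {y}, ∃ σ : Z → X, Continuous σ ∧ (∀ z, p (σ z) = χ.symm z) ∧
      σ (χ y) = i := by
    rintro ⟨i, rfl⟩
    exact hs i hy
  choose σ hσc hσp hσi using hsec
  have : Nonempty X := ⟨hne.some⟩
  let t : Bundle.Trivialization (p ⁻¹' {y}) p := IsOpen.trivializationDiscrete (fun i => range (σ i))
    χ.source χ.open_source
    (fun i W hW => ⟨fun hWo => (hWo.preimage hp.continuous).inter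
      (isOpen_range_section hp hχ (hσc i) (hσp i)), fun hWo => by
        have h1 : W = p '' (p ⁻¹' W ∩ range (σ i)) := by
          ext w
          constructor
          · intro hw
            have h2 : p (σ i (χ w)) = w := by rw [hσp, χ.left_inv (hW hw)]
            exact ⟨σ i (χ w), ⟨by rwa [mem_preimage, h2], mem_range_self _⟩, h2⟩
          · rintro ⟨x, ⟨hx, -⟩, rfl⟩
            exact hx
        rw [h1]
        exact hp.isOpenMap _ hWo⟩)
    (fun i => by
      rintro _ ⟨z, rfl⟩ _ ⟨z', rfl⟩ h
      rw [hσp, hσp] at h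
      rw [χ.symm.injOn (by simp [hχ]) (by simp [hχ]) h])
    (fun i w hw => ⟨σ i (χ w), mem_range_self _, by rw [hσp, χ.left_inv hw]⟩)
    (fun i j hij => by
      rw [Function.onFun, Set.disjoint_left]
      rintro _ ⟨z, rfl⟩ ⟨z', h⟩
      have h1 : χ.symm z' = χ.symm z := by rw [← hσp j, ← hσp i, h]
      have h2 : z' = z := χ.symm.injOn (by simp [hχ]) (by simp [hχ]) h1
      rw [h2] at h
      have h3 := section_eq hp (hσc j) (hσc i) (hσp j) (hσp i) h
      exact hij (Subtype.ext (by rw [← hσi i, ← hσi j, h3])))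
    (fun x hx => by
      obtain ⟨τ, hτc, hτp, hτx⟩ := hs x hx
      let i : p ⁻¹' {y} := ⟨τ (χ y), (hτp _).trans (χ.left_inv hy)⟩
      have h1 := section_eq hp (hσc i) hτc (hσp i) hτp (hσi i)
      exact mem_iUnion.mpr ⟨i, χ (p x), by rw [h1, hτx]⟩)
  exact .of_trivialization (t := t) hy

/-- A local homeomorphism with sections over two charts that cover the base and have a connected
intersection is injective. -/
lemma injective_of_hasSections {Z' : Type*} [NormedAddCommGroup Z'] [NormedSpace ℝ Z']
    [PreconnectedSpace X] (hp : IsLocalHomeomorph p) {χ : OpenPartialHomeomorph Y Z}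
    {χ' : OpenPartialHomeomorph Y Z'} (hχ : χ.target = univ) (hχ' : χ'.target = univ)
    (hs : HasSections p χ) (hs' : HasSections p χ') (hcov : χ.source ∪ χ'.source = univ)
    (hconn : IsConnected (χ.source ∩ χ'.source)) : Function.Injective p := by
  obtain ⟨y₀, hy₀, hy₀'⟩ := hconn.nonempty
  rcases isEmpty_or_nonempty X with hX | ⟨⟨x₀⟩⟩
  · exact fun x => hX.elim x
  obtain ⟨a, ha⟩ : ∃ a, p a = y₀ := by
    have h1 : p x₀ ∈ χ.source ∪ χ'.source := hcov ▸ mem_univ _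
    rcases h1 with h | h
    · obtain ⟨τ, -, hτ, -⟩ := hs x₀ h
      exact ⟨τ (χ y₀), (hτ _).trans (χ.left_inv hy₀)⟩
    · obtain ⟨τ, -, hτ, -⟩ := hs' x₀ h
      exact ⟨τ (χ' y₀), (hτ _).trans (χ'.left_inv hy₀')⟩
  subst ha
  obtain ⟨σ, hσc, hσp, hσa⟩ := hs a hy₀
  obtain ⟨σ', hσc', hσp', hσa'⟩ := hs' a hy₀'
  have hagree : EqOn (fun y => σ (χ y)) (fun y => σ' (χ' y)) (χ.source ∩ χ'.source) :=
    (T2Space.isSeparatedMap p).eqOn_of_comp_eqOn hp.isLocallyInjective hconn.isPreconnected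
      (hσc.comp_continuousOn (χ.continuousOn.mono inter_subset_left))
      (hσc'.comp_continuousOn (χ'.continuousOn.mono inter_subset_right))
      (fun y hy => by
        simp only [Function.comp_apply]
        rw [hσp, hσp', χ.left_inv hy.1, χ'.left_inv hy.2]) ⟨hy₀, hy₀'⟩ (hσa.trans hσa'.symm)
  have hsrc : ∀ z, χ.symm z ∈ χ.source := fun z => χ.map_target (by simp [hχ])
  have hsrc' : ∀ z, χ'.symm z ∈ χ'.source := fun z => χ'.map_target (by simp [hχ'])
  have hrinv : ∀ z, χ (χ.symm z) = z := fun z => χ.right_inv (by simp [hχ])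
  have hrinv' : ∀ z, χ' (χ'.symm z) = z := fun z => χ'.right_inv (by simp [hχ'])
  have hmeet : ∀ x ∈ range σ', p x ∈ χ.source → x = σ (χ (p x)) := by
    rintro _ ⟨z, rfl⟩ hz
    rw [hσp'] at hz ⊢
    have := hagree ⟨hz, hsrc' z⟩
    simp only [hrinv'] at this
    exact this.symm
  have hmeet' : ∀ x ∈ range σ, p x ∈ χ'.source → x = σ' (χ' (p x)) := by
    rintro _ ⟨z, rfl⟩ hz
    rw [hσp] at hz ⊢
    have := hagree ⟨hsrc z, hz⟩
    simp only [hrinv] at this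
    exact this
  -- For closedness: the section through a point outside the union has an open range. If that range
  -- met the union, it would coincide with `σ` or `σ'`.
  have hclopen : IsClopen (range σ ∪ range σ') := by
    refine ⟨?_, (isOpen_range_section hp hχ hσc hσp).union
      (isOpen_range_section hp hχ' hσc' hσp')⟩
    rw [← isOpen_compl_iff, isOpen_iff_mem_nhds]
    intro x hx
    have h1 : p x ∈ χ.source ∪ χ'.source := hcov ▸ mem_univ _
    rcases h1 with h | h
    · obtain ⟨τ, hτc, hτp, hτx⟩ := hs x h
      refine mem_of_superset ((isOpen_range_section hp hχ hτc hτp).mem_nhds ⟨_, hτx⟩) ?_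
      rintro _ ⟨z, rfl⟩ hz
      have h2 : τ z = σ z := by
        rcases hz with ⟨w, hw⟩ | hz
        · have h3 : χ.symm w = χ.symm z := by rw [← hσp, ← hτp, hw]
          rw [← hw, χ.symm.injOn (by simp [hχ]) (by simp [hχ]) h3]
        · have h3 := hmeet _ hz (by rw [hτp]; exact hsrc z)
          rwa [hτp, hrinv] at h3
      have h4 := section_eq hp hτc hσc hτp hσp h2
      exact hx (Or.inl ⟨_, by rw [← h4, hτx]⟩)
    · obtain ⟨τ, hτc, hτp, hτx⟩ := hs' x h
      refine mem_of_superset ((isOpen_range_section hp hχ' hτc hτp).mem_nhds ⟨_, hτx⟩) ?_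
      rintro _ ⟨z, rfl⟩ hz
      have h2 : τ z = σ' z := by
        rcases hz with hz | ⟨w, hw⟩
        · have h3 := hmeet' _ hz (by rw [hτp]; exact hsrc' z)
          rwa [hτp, hrinv'] at h3
        · have h3 : χ'.symm w = χ'.symm z := by rw [← hσp', ← hτp, hw]
          rw [← hw, χ'.symm.injOn (by simp [hχ']) (by simp [hχ']) h3]
      have h4 := section_eq hp hτc hσc' hτp hσp' h2
      exact hx (Or.inr ⟨_, by rw [← h4, hτx]⟩)
  have huniv : range σ ∪ range σ' = univ := hclopen.eq_univ ⟨a, Or.inl ⟨_, hσa⟩⟩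
  have hform : ∀ x, p x ∈ χ.source → x = σ (χ (p x)) := by
    intro x hx
    have h1 : x ∈ range σ ∪ range σ' := huniv ▸ mem_univ x
    rcases h1 with ⟨z, rfl⟩ | h
    · rw [hσp, hrinv]
    · exact hmeet x h hx
  have hform' : ∀ x, p x ∈ χ'.source → x = σ' (χ' (p x)) := by
    intro x hx
    have h1 : x ∈ range σ ∪ range σ' := huniv ▸ mem_univ x
    rcases h1 with h | ⟨z, rfl⟩
    · exact hmeet' x h hx
    · rw [hσp', hrinv']
  intro x x' hxx
  have h1 : p x ∈ χ.source ∪ χ'.source := hcov ▸ mem_univ _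
  rcases h1 with h | h
  · rw [hform x h, hform x' (hxx ▸ h), hxx]
  · rw [hform' x h, hform' x' (hxx ▸ h), hxx]

end Sections

/-! ### Quantitative local injectivity of immersions. -/

section Immersions

variable {E Y : Type*} [NormedAddCommGroup E] [NormedSpace ℝ E] [FiniteDimensional ℝ E]
  [NormedAddCommGroup Y] [NormedSpace ℝ Y]

/-- Near a point where its derivative is injective, a map expands distances about as much as
its derivatives do. -/
lemma exists_ball_norm_fderiv_le {k : E → Y} {y₀ : E} (hk : ContDiffAt ℝ ∞ k y₀)
    (hinj : Function.Injective (fderiv ℝ k y₀)) :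
    ∃ r > 0, ∀ z ∈ ball y₀ r, ∀ y ∈ ball y₀ r, ∀ y' ∈ ball y₀ r,
      ‖fderiv ℝ k z (y' - y)‖ ≤ 3 * ‖k y' - k y‖ := by
  obtain ⟨K, hK, hD⟩ := (fderiv ℝ k y₀).toLinearMap.exists_antilipschitzWith
    (LinearMap.ker_eq_bot.mpr hinj)
  have hKpos : (0 : ℝ) < K := hK
  have hD' : ∀ w, ‖w‖ ≤ K * ‖fderiv ℝ k y₀ w‖ := fun w => by
    simpa using! hD.le_mul_dist w 0
  have hε : (0 : ℝ) < (2 * (K : ℝ))⁻¹ := by positivity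
  have h1 := (hk.hasStrictFDerivAt (by simp)).isLittleO.def hε
  have h2 : ContinuousAt (fderiv ℝ k) y₀ := (hk.fderiv_right (m := 0) (by simp)).continuousAt
  have h3 : ∀ᶠ z in 𝓝 y₀, ‖fderiv ℝ k z - fderiv ℝ k y₀‖ < (2 * (K : ℝ))⁻¹ := by
    have := h2 (ball_mem_nhds _ hε)
    filter_upwards [this] with z hz
    simpa [dist_eq_norm] using! hz
  rw [nhds_prod_eq] at h1
  obtain ⟨T, hT, hT'⟩ := Filter.mem_prod_same_iff.mp h1
  obtain ⟨r, hr, hrs⟩ := Metric.mem_nhds_iff.mp (inter_mem hT h3)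
  refine ⟨r, hr, fun z hz y hy y' hy' => ?_⟩
  have h4 : ‖k y' - k y - fderiv ℝ k y₀ (y' - y)‖ ≤ (2 * (K : ℝ))⁻¹ * ‖y' - y‖ :=
    hT' (mk_mem_prod (hrs hy').1 (hrs hy).1)
  have h5 : ‖fderiv ℝ k z - fderiv ℝ k y₀‖ < (2 * (K : ℝ))⁻¹ := (hrs hz).2
  set w := y' - y
  set a := ‖fderiv ℝ k y₀ w‖
  -- Both errors, of the difference quotient and of the derivative at `z`, are at most `a / 2`.
  -- Hence `‖D_z w‖ ≤ 3a/2` and `a ≤ 2‖k y' - k y‖`, whence the factor `3`.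
  have h6 : (2 * K : ℝ)⁻¹ * ‖w‖ ≤ a / 2 := by
    rw [inv_mul_le_iff₀ (by positivity)]
    linarith [hD' w]
  have h7 : ‖fderiv ℝ k z w‖ ≤ a + a / 2 := by
    have h8 : ‖(fderiv ℝ k z - fderiv ℝ k y₀) w‖ ≤ a / 2 :=
      ((ContinuousLinearMap.le_opNorm _ _).trans
        (mul_le_mul_of_nonneg_right h5.le (norm_nonneg _))).trans h6
    have h9 : fderiv ℝ k z w = fderiv ℝ k y₀ w + (fderiv ℝ k z - fderiv ℝ k y₀) w := by simp
    rw [h9]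
    exact (norm_add_le _ _).trans (by gcongr)
  have h8 : a ≤ ‖k y' - k y‖ + a / 2 := by
    have h9 : fderiv ℝ k y₀ w = (k y' - k y) - (k y' - k y - fderiv ℝ k y₀ w) := by abel
    calc a = ‖(k y' - k y) - (k y' - k y - fderiv ℝ k y₀ w)‖ := by rw [← h9]
      _ ≤ ‖k y' - k y‖ + ‖k y' - k y - fderiv ℝ k y₀ w‖ := norm_sub_le _ _
      _ ≤ _ := by gcongr; exact h4.trans h6
  linarith

variable {m : ℕ} {K : Type*} [TopologicalSpace K] [ChartedSpace (EuclideanSpace ℝ (Fin m)) K]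
  {e : OpenPartialHomeomorph K (EuclideanSpace ℝ (Fin m))} {g : K → Y} {a : K}

lemma injective_fderiv_comp_chart_symm (he : e ∈ IsManifold.maximalAtlas (𝓡 m) ∞ K)
    (ha : a ∈ e.source) (hg : ContMDiff (𝓡 m) 𝓘(ℝ, Y) ∞ g)
    (hinj : Function.Injective (mvfderiv (𝓡 m) g a)) :
    Function.Injective (fderiv ℝ (g ∘ e.symm) (e a)) := by
  intro w w' hw
  obtain ⟨v, rfl⟩ := (mvfderiv_chart_bijective he ha).2 w
  obtain ⟨v', rfl⟩ := (mvfderiv_chart_bijective he ha).2 w'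
  rw [← mvfderiv_eq_fderiv_comp_chart hg he ha, ← mvfderiv_eq_fderiv_comp_chart hg he ha] at hw
  rw [hinj hw]

lemma exists_nhds_injOn_of_immersion [IsManifold (𝓡 m) ∞ K] (hg : ContMDiff (𝓡 m) 𝓘(ℝ, Y) ∞ g)
    (hinj : Function.Injective (mvfderiv (𝓡 m) g a)) : ∃ U ∈ 𝓝 a, InjOn g U := by
  let χ := chartAt (EuclideanSpace ℝ (Fin m)) a
  have hχ : χ ∈ IsManifold.maximalAtlas (𝓡 m) ∞ K := chartAt_mem a
  have ha : a ∈ χ.source := mem_chart_source _ a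
  have h1 := injective_fderiv_comp_chart_symm hχ ha hg hinj
  obtain ⟨r, hr, hrk⟩ := exists_ball_norm_fderiv_le
    (contDiffAt_comp_chart_symm hg hχ (χ.map_source ha)) h1
  refine ⟨χ.source ∩ χ ⁻¹' ball (χ a) r, inter_mem (χ.open_source.mem_nhds ha)
    (χ.continuousAt ha (ball_mem_nhds _ hr)), fun b hb b' hb' hbb => ?_⟩
  have h2 := hrk (χ a) (mem_ball_self hr) (χ b) hb.2 (χ b') hb'.2
  simp only [Function.comp_apply] at h2
  rw [χ.left_inv hb.1, χ.left_inv hb'.1, hbb, sub_self, norm_zero, mul_zero] at h2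
  have h3 := h1 ((norm_le_zero_iff.mp h2).trans (map_zero _).symm)
  exact χ.injOn hb.1 hb'.1 (sub_eq_zero.mp h3).symm

end Immersions

/-! ### Maps to the sphere through which an immersion factors. -/

section Gauss

variable {m : ℕ} {K : Type*} [TopologicalSpace K] [ChartedSpace (EuclideanSpace ℝ (Fin m)) K]
  {V : Type*} [NormedAddCommGroup V] [InnerProductSpace ℝ V]
  {Y : Type*} [NormedAddCommGroup Y] [NormedSpace ℝ Y]
  {N : K → sphere (0 : V) 1} {g : K → Y} {H : V → Y}

lemma continuous_of_contMDiff_coe (hN : ContMDiff (𝓡 m) 𝓘(ℝ, V) ∞ fun a => (N a : V)) :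
    Continuous N :=
  continuous_induced_rng.mpr hN.continuous

variable [IsManifold (𝓡 m) ∞ K]

/-- If `g = H ∘ N` is an immersion then so is `N`. -/
lemma injective_fderiv_of_factor (hN : ContMDiff (𝓡 m) 𝓘(ℝ, V) ∞ fun a => (N a : V))
    (hg : ContMDiff (𝓡 m) 𝓘(ℝ, Y) ∞ g) (himm : ∀ a, Function.Injective (mvfderiv (𝓡 m) g a))
    (hH : ∀ v : V, v ≠ 0 → ContDiffAt ℝ ∞ H v) (hgH : ∀ a, g a = H (N a)) (a : K) :
    Function.Injective (fderiv ℝ ((fun a => (N a : V)) ∘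
      (chartAt (EuclideanSpace ℝ (Fin m)) a).symm) (chartAt (EuclideanSpace ℝ (Fin m)) a a)) := by
  set χ := chartAt (EuclideanSpace ℝ (Fin m)) a
  have hχ : χ ∈ IsManifold.maximalAtlas (𝓡 m) ∞ K := chartAt_mem a
  have ha : a ∈ χ.source := mem_chart_source _ a
  have h1 := injective_fderiv_comp_chart_symm hχ ha hg (himm a)
  have h2 : g ∘ χ.symm = H ∘ ((fun a => (N a : V)) ∘ χ.symm) := by
    funext y
    exact hgH _
  have h3 : DifferentiableAt ℝ H (((fun a => (N a : V)) ∘ χ.symm) (χ a)) :=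
    (hH _ (ne_zero_of_mem_unit_sphere _)).differentiableAt (by simp)
  rw [h2, fderiv_comp _ h3
    ((contDiffAt_comp_chart_symm hN hχ (χ.map_source ha)).differentiableAt (by simp))] at h1
  exact Function.Injective.of_comp (f := fderiv ℝ H _) h1

/-- If `g = H ∘ N` is an immersion and the sphere has the right dimension, then `N` is a local
homeomorphism. -/
lemma isLocalHomeomorph_of_factor [FiniteDimensional ℝ V] (hV : finrank ℝ V = m + 1)
    (hN : ContMDiff (𝓡 m) 𝓘(ℝ, V) ∞ fun a => (N a : V))
    (hg : ContMDiff (𝓡 m) 𝓘(ℝ, Y) ∞ g) (himm : ∀ a, Function.Injective (mvfderiv (𝓡 m) g a))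
    (hH : ∀ v : V, v ≠ 0 → ContDiffAt ℝ ∞ H v) (hgH : ∀ a, g a = H (N a)) :
    IsLocalHomeomorph N := by
  refine IsLocalHomeomorph.mk N fun a => ?_
  have hD := injective_fderiv_of_factor hN hg himm hH hgH a
  set χ := chartAt (EuclideanSpace ℝ (Fin m)) a
  have hχ : χ ∈ IsManifold.maximalAtlas (𝓡 m) ∞ K := chartAt_mem a
  have ha : a ∈ χ.source := mem_chart_source _ a
  set k := (fun a => (N a : V)) ∘ χ.symm with hk
  have hks : ContDiffAt ℝ ∞ k (χ a) := contDiffAt_comp_chart_symm hN hχ (χ.map_source ha)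
  -- The pole is antipodal to `N a`, which therefore lies in the stereographic domain.
  let v : sphere (0 : V) 1 := -N a
  have hv : ‖(v : V)‖ = 1 := norm_eq_of_mem_sphere v
  let ψ := stereographic hv
  have hNa : N a ∈ ψ.source := by
    simp only [ψ, stereographic_source, mem_compl_iff, mem_singleton_iff]
    exact ne_neg_of_mem_unit_sphere ℝ (N a)
  have hNc := continuous_of_contMDiff_coe hN
  let G := stereoToFun (v : V) ∘ k
  have hGs : ContDiffAt ℝ ∞ G (χ a) := by
    refine ContDiffAt.comp _ (contDiffOn_stereoToFun.contDiffAt ?_) hks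
    refine IsOpen.mem_nhds ?_ ?_
    · exact isOpen_ne_fun (innerSL ℝ (v : V)).continuous continuous_const
    · simp only [k, v, Function.comp_apply, χ.left_inv ha, mem_ofPred_eq, innerSL_apply_apply]
      simp
      norm_num
  let P : (ℝ ∙ (v : V))ᗮ → V := stereoInvFunAux (v : V) ∘ Subtype.val
  have hP : ContDiff ℝ ∞ P := contDiff_stereoInvFunAux.comp (ℝ ∙ (v : V))ᗮ.subtypeL.contDiff
  have hNψ : ∀ᶠ y in 𝓝 (χ a), N (χ.symm y) ∈ ψ.source := by
    have h1 : ContinuousAt (N ∘ χ.symm) (χ a) :=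
      hNc.continuousAt.comp (χ.continuousAt_symm (χ.map_source ha))
    refine h1 (ψ.open_source.mem_nhds ?_)
    simpa [χ.left_inv ha] using hNa
  -- As `k` factors through `G`, the derivative of `G` is injective too. The dimensions agree, so
  -- the inverse function theorem applies to `G`.
  have hPG : k =ᶠ[𝓝 (χ a)] P ∘ G := by
    filter_upwards [hNψ] with y hy
    exact congrArg Subtype.val (ψ.left_inv hy).symm
  rw [hPG.fderiv_eq, fderiv_comp _ (hP.differentiable (by simp) _)
    (hGs.differentiableAt (by simp))] at hD
  have hD' : Function.Injective (fderiv ℝ G (χ a)) :=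
    Function.Injective.of_comp (f := fderiv ℝ P _) hD
  have hdim : finrank ℝ (EuclideanSpace ℝ (Fin m)) = finrank ℝ (ℝ ∙ (v : V))ᗮ := by
    have := Fact.mk hV
    rw [finrank_euclideanSpace_fin,
      Submodule.finrank_orthogonal_span_singleton (n := m) (ne_zero_of_mem_unit_sphere v)]
  let D : EuclideanSpace ℝ (Fin m) ≃L[ℝ] (ℝ ∙ (v : V))ᗮ :=
    (LinearMap.linearEquivOfInjective (fderiv ℝ G (χ a)).toLinearMap hD'
      hdim).toContinuousLinearEquiv
  have hGD : HasFDerivAt G (D : EuclideanSpace ℝ (Fin m) →L[ℝ] (ℝ ∙ (v : V))ᗮ) (χ a) := by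
    have h1 : (D : EuclideanSpace ℝ (Fin m) →L[ℝ] (ℝ ∙ (v : V))ᗮ) = fderiv ℝ G (χ a) := by
      ext1 w
      rfl
    rw [h1]
    exact (hGs.differentiableAt (by simp)).hasFDerivAt
  let G' := hGs.toOpenPartialHomeomorph G hGD (by simp)
  let e := ((χ.trans G').trans ψ.symm).restrOpen (N ⁻¹' ψ.source) (ψ.open_source.preimage hNc)
  have hG' : ∀ y, G' y = G y := fun y => rfl
  refine ⟨e, ?_, ?_⟩
  · simp only [e, OpenPartialHomeomorph.restrOpen_source, OpenPartialHomeomorph.trans_source]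
    refine ⟨⟨⟨ha, ?_⟩, ?_⟩, hNa⟩
    · exact hGs.mem_toOpenPartialHomeomorph_source hGD (by simp)
    · simp [ψ]
  · intro b hb
    simp only [e, OpenPartialHomeomorph.restrOpen_source, OpenPartialHomeomorph.trans_source] at hb
    have h1 : e b = ψ.symm (ψ (N (χ.symm (χ b)))) := rfl
    rw [h1, χ.left_inv hb.1.1.1, ψ.left_inv hb.2]

end Gauss

/-! ### The induced distance and its comparison with the Gauss map. -/

section Distance

variable {n : ℕ} {M : Type*} [TopologicalSpace M] [ChartedSpace (EuclideanSpace ℝ (Fin n)) M]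
  {x : M → Ambient n}

/-- The length of tangent vectors in the metric induced by `x`. -/
@[reducible] def inducedENorm (x : M → Ambient n) (r : M) : ENorm (TangentSpace (𝓡 n) r) :=
  ⟨fun v => ENNReal.ofReal ‖mvfderiv (𝓡 n) x r v‖⟩

lemma enormSMulClass_inducedENorm (x : M → Ambient n) (r : M) :
    letI := inducedENorm x r
    ENormSMulClass ℝ (TangentSpace (𝓡 n) r) := by
  let _ := inducedENorm x r
  refine ⟨fun c v => ?_⟩
  change ENNReal.ofReal ‖mvfderiv (𝓡 n) x r (c • v)‖ = ‖c‖ₑ * ENNReal.ofReal ‖mvfderiv (𝓡 n) x r v‖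
  rw [map_smul, norm_smul, ENNReal.ofReal_mul (norm_nonneg c), ofReal_norm]

lemma inducedEDist_comm [IsManifold (𝓡 n) ∞ M] (p q : M) :
    inducedEDist x p q = inducedEDist x q p := by
  let _ := inducedENorm x
  have := enormSMulClass_inducedENorm x
  exact Manifold.riemannianEDist_comm

lemma inducedEDist_triangle [IsManifold (𝓡 n) ∞ M] (p q r : M) :
    inducedEDist x p r ≤ inducedEDist x p q + inducedEDist x q r := by
  let _ := inducedENorm x
  have := enormSMulClass_inducedENorm x
  exact Manifold.riemannianEDist_triangle

lemma inducedEDist_le_of_norm_deriv_le (hx : ContMDiff (𝓡 n) 𝓘(ℝ, Ambient n) ∞ x) {γ : ℝ → M}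
    (hγ : ∀ t ∈ Icc (0 : ℝ) 1, ContMDiffAt 𝓘(ℝ, ℝ) (𝓡 n) 1 γ t) {B : ℝ}
    (hB : ∀ t ∈ Icc (0 : ℝ) 1, ‖deriv (x ∘ γ) t‖ ≤ B) :
    inducedEDist x (γ 0) (γ 1) ≤ ENNReal.ofReal B := by
  let _ := inducedENorm x
  have := enormSMulClass_inducedENorm x
  have h1 : inducedEDist x (γ 0) (γ 1) ≤ Manifold.pathELength (𝓡 n) γ 0 1 :=
    Manifold.riemannianEDist_le_pathELength (fun t ht => (hγ t ht).contMDiffWithinAt) rfl rfl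
      zero_le_one
  refine h1.trans ?_
  rw [Manifold.pathELength_eq_lintegral_mfderiv_Icc]
  calc _ ≤ ∫⁻ _ in Icc (0 : ℝ) 1, ENNReal.ofReal B := by
        refine MeasureTheory.setLIntegral_mono measurable_const fun t ht => ?_
        refine ENNReal.ofReal_le_ofReal ?_
        refine le_trans (le_of_eq ?_) (hB t ht)
        congr 1
        have h2 := (hx.mdifferentiableAt (x := γ t) (by simp)).hasMFDerivAt.comp t
          ((hγ t ht).mdifferentiableAt (by simp)).hasMFDerivAt
        have h3 : mfderiv 𝓘(ℝ, ℝ) 𝓘(ℝ, Ambient n) (x ∘ γ) t (1 : ℝ) = deriv (x ∘ γ) t := by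
          rw [mfderiv_eq_fderiv]
          exact fderiv_apply_one_eq_deriv (𝕜 := ℝ) (f := x ∘ γ) (x := t)
        rw [← h3]
        exact (DFunLike.congr_fun h2.mfderiv (1 : ℝ)).symm
    _ = ENNReal.ofReal B := by simp

end Distance

section Estimate

variable {n m : ℕ} {M : Type*} [TopologicalSpace M] [ChartedSpace (EuclideanSpace ℝ (Fin n)) M]
  {x : M → Ambient n} {K : Type*} [TopologicalSpace K] [ChartedSpace (EuclideanSpace ℝ (Fin m)) K]
  [IsManifold (𝓡 m) ∞ K] {V : Type*} [NormedAddCommGroup V] [InnerProductSpace ℝ V]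
  {N : K → sphere (0 : V) 1} {H : V → Ambient n} {i : K → M}

/-- Join `b` and `b'` by a segment in a chart of `K` and map it to `M`. Along it `x` is `H ∘ N`,
whose speed is at most `C` times that of `N`; the latter is at most `3` times the distance of the
end values of `N`, by `exists_ball_norm_fderiv_le`. -/
lemma exists_nhds_inducedEDist_le (hx : ContMDiff (𝓡 n) 𝓘(ℝ, Ambient n) ∞ x)
    (hi : ContMDiff (𝓡 m) (𝓡 n) ∞ i)
    (himm : ∀ a, Function.Injective (mvfderiv (𝓡 m) (x ∘ i) a))
    (hN : ContMDiff (𝓡 m) 𝓘(ℝ, V) ∞ fun a => (N a : V))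
    (hH : ∀ v : V, v ≠ 0 → ContDiffAt ℝ ∞ H v) (hgH : ∀ a, x (i a) = H (N a))
    {C : ℝ≥0} (hC : ∀ u : sphere (0 : V) 1, ‖fderiv ℝ H u‖ ≤ C) (a : K) :
    ∃ U ∈ 𝓝 a, ∀ b ∈ U, ∀ b' ∈ U,
      inducedEDist x (i b) (i b') ≤ (3 * C : ℝ≥0) * edist (N b) (N b') := by
  have hD := injective_fderiv_of_factor hN (hx.comp hi) himm hH hgH a
  set χ := chartAt (EuclideanSpace ℝ (Fin m)) a
  have hχ : χ ∈ IsManifold.maximalAtlas (𝓡 m) ∞ K := chartAt_mem a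
  have ha : a ∈ χ.source := mem_chart_source _ a
  set k := (fun a => (N a : V)) ∘ χ.symm with hk
  have hks : ∀ y ∈ χ.target, ContDiffAt ℝ ∞ k y := fun y hy => contDiffAt_comp_chart_symm hN hχ hy
  obtain ⟨r₁, hr₁, hest⟩ := exists_ball_norm_fderiv_le (hks _ (χ.map_source ha)) hD
  obtain ⟨r₂, hr₂, hball⟩ := Metric.isOpen_iff.mp χ.open_target _ (χ.map_source ha)
  let r := min r₁ r₂
  have hr : 0 < r := lt_min hr₁ hr₂
  have hb1 : ball (χ a) r ⊆ ball (χ a) r₁ := ball_subset_ball (min_le_left _ _)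
  have hb2 : ball (χ a) r ⊆ χ.target := (ball_subset_ball (min_le_right _ _)).trans hball
  refine ⟨χ.source ∩ χ ⁻¹' ball (χ a) r, inter_mem (χ.open_source.mem_nhds ha)
    (χ.continuousAt ha (ball_mem_nhds _ hr)), fun b hb b' hb' => ?_⟩
  set y := χ b
  set w := χ b' - χ b
  let ℓ : ℝ → EuclideanSpace ℝ (Fin m) := fun t => y + t • w
  have hℓ : ∀ t ∈ Icc (0 : ℝ) 1, ℓ t ∈ ball (χ a) r := fun t ht =>
    (convex_ball (χ a) r).add_smul_sub_mem hb.2 hb'.2 ht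
  have hℓs : ContDiff ℝ ∞ ℓ := contDiff_const.add (contDiff_id.smul contDiff_const)
  have hℓd : ∀ t, HasDerivAt ℓ w t := fun t => by
    have h := ((hasDerivAt_id t).smul_const w).const_add y
    rwa [one_smul] at h
  let γ : ℝ → M := fun t => i (χ.symm (ℓ t))
  have hγ : ∀ t ∈ Icc (0 : ℝ) 1, ContMDiffAt 𝓘(ℝ, ℝ) (𝓡 n) 1 γ t := fun t ht =>
    ((hi.contMDiffAt.comp _ ((contMDiffAt_symm_of_mem_maximalAtlas hχ (hb2 (hℓ t ht))).comp t
      hℓs.contDiffAt.contMDiffAt)).of_le (by simp))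
  have h0 : γ 0 = i b := by
    simp [γ, ℓ, y, χ.left_inv hb.1]
  have h1 : γ 1 = i b' := by
    simp [γ, ℓ, y, w, χ.left_inv hb'.1]
  have hfact : x ∘ γ = H ∘ (k ∘ ℓ) := funext fun t => hgH _
  have hderiv : ∀ t ∈ Icc (0 : ℝ) 1, ‖deriv (x ∘ γ) t‖ ≤ C * (3 * dist (N b) (N b')) := by
    intro t ht
    have hkd := ((hks _ (hb2 (hℓ t ht))).differentiableAt (by simp)).hasFDerivAt.comp_hasDerivAt t
      (hℓd t)
    have hHd : HasFDerivAt H (fderiv ℝ H (k (ℓ t))) ((k ∘ ℓ) t) :=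
      ((hH _ (ne_zero_of_mem_unit_sphere (N (χ.symm (ℓ t))))).differentiableAt
        (by simp)).hasFDerivAt
    rw [hfact, (hHd.comp_hasDerivAt t hkd).deriv]
    refine (ContinuousLinearMap.le_opNorm _ _).trans ?_
    refine mul_le_mul (hC (N (χ.symm (ℓ t)))) ?_ (norm_nonneg _) C.2
    refine (hest _ (hb1 (hℓ t ht)) _ (hb1 hb.2) _ (hb1 hb'.2)).trans_eq ?_
    simp only [k, Function.comp_apply]
    rw [χ.left_inv hb.1, χ.left_inv hb'.1, ← dist_eq_norm, dist_comm]
    rfl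
  have h2 := inducedEDist_le_of_norm_deriv_le hx hγ hderiv
  rw [h0, h1] at h2
  refine h2.trans_eq ?_
  rw [edist_dist, ENNReal.ofReal_mul C.coe_nonneg, ENNReal.ofReal_mul (by norm_num),
    ENNReal.coe_mul, ENNReal.ofReal_coe_nnreal, ← mul_assoc, mul_comm (C : ℝ≥0∞)]
  simp

end Estimate

/-! ### Coverings of spheres from stereographic sections. -/

section SphereCovering

variable {K : Type*} [TopologicalSpace K] {V : Type*} [NormedAddCommGroup V] [InnerProductSpace ℝ V]
  {N : K → sphere (0 : V) 1}

/-- The stereographic chart of the sphere with pole `v`. -/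
def stereoChart (v : sphere (0 : V) 1) : OpenPartialHomeomorph (sphere (0 : V) 1) (ℝ ∙ (v : V))ᗮ :=
  stereographic (norm_eq_of_mem_sphere v)

lemma stereoChart_source (v : sphere (0 : V) 1) : (stereoChart v).source = {v}ᶜ := rfl

lemma stereoChart_target (v : sphere (0 : V) 1) : (stereoChart v).target = univ := rfl

lemma stereoChart_neg (v : sphere (0 : V) 1) : stereoChart v (-v) = 0 :=
  stereographic_apply_neg v

lemma neg_ne_self (v : sphere (0 : V) 1) : -v ≠ v := (ne_neg_of_mem_unit_sphere ℝ v).symm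

lemma exists_lipschitzOnWith_stereoChart_symm (v : sphere (0 : V) 1) (z₀ z : (ℝ ∙ (v : V))ᗮ) :
    ∃ C : ℝ≥0, LipschitzOnWith C
      (fun t : ℝ => (stereoChart v).symm (z₀ + t • (z - z₀))) (Icc 0 1) := by
  have h1 : ContDiff ℝ 1 fun t : ℝ =>
      stereoInvFunAux (v : V) ((z₀ + t • (z - z₀) : (ℝ ∙ (v : V))ᗮ) : V) :=
    contDiff_stereoInvFunAux.comp ((ℝ ∙ (v : V))ᗮ.subtypeL.contDiff.comp
      (contDiff_const.add (contDiff_id.smul contDiff_const)))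
  obtain ⟨C, hC⟩ := h1.locallyLipschitz.locallyLipschitzOn.exists_lipschitzOnWith_of_compact
    (isCompact_Icc (a := (0 : ℝ)) (b := 1))
  exact ⟨C, fun s hs t ht => hC hs ht⟩

lemma hasSections_stereoChart [T2Space K] (hp : IsLocalHomeomorph N) {d : K → K → ℝ≥0∞}
    {C : ℝ≥0} (hsymm : ∀ x y, d x y = d y x) (htri : ∀ x y z, d x z ≤ d x y + d y z)
    (hloc : ∀ a, ∃ U ∈ 𝓝 a, ∀ b ∈ U, ∀ b' ∈ U, d b b' ≤ C * edist (N b) (N b'))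
    (hcomp : ∀ s : ℕ → K, (∀ ε : ℝ≥0∞, 0 < ε → ∃ k, ∀ i ≥ k, ∀ j ≥ k, d (s i) (s j) < ε) →
      ∃ b, Tendsto s atTop (𝓝 b)) (v : sphere (0 : V) 1) : HasSections N (stereoChart v) := by
  refine hasSections_of_path_lift hp (stereoChart_target v) fun z₀ z a ha => ?_
  obtain ⟨L, hL⟩ := exists_lipschitzOnWith_stereoChart_symm v z₀ z
  exact exists_path_lift hp hsymm htri hloc hcomp (fun _ _ => edist_eq_zero.mp) hL
    (by simpa using ha)

lemma isCoveringMap_of_hasSections_stereoChart [T2Space K] (hp : IsLocalHomeomorph N)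
    (hs : ∀ v : sphere (0 : V) 1, HasSections N (stereoChart v)) : IsCoveringMap N := fun y =>
  isEvenlyCovered_of_hasSections hp (stereoChart_target (-y)) (hs (-y)) (neg_ne_self y).symm

/-- The image is open. It is also closed: if it meets the stereographic chart around `y`, a section
through that point reaches `y`. The rank condition makes the sphere connected, including the circle.
-/
lemma surjective_of_hasSections_stereoChart [Nonempty K] (hp : IsLocalHomeomorph N)
    (hV : 1 < Module.rank ℝ V) (hs : ∀ v : sphere (0 : V) 1, HasSections N (stereoChart v)) :
    Function.Surjective N := by
  have : PreconnectedSpace (sphere (0 : V) 1) :=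
    Subtype.preconnectedSpace (isConnected_sphere hV 0 zero_le_one).isPreconnected
  rw [← range_eq_univ]
  refine IsClopen.eq_univ ⟨?_, hp.isOpenMap.isOpen_range⟩ (range_nonempty N)
  rw [← isOpen_compl_iff, isOpen_iff_mem_nhds]
  intro y hy
  filter_upwards [(stereoChart (-y)).open_source.mem_nhds
    (show y ∈ (stereoChart (-y)).source from (neg_ne_self y).symm)]
  rintro _ hz ⟨a, rfl⟩
  obtain ⟨σ, -, hσ, -⟩ := hs _ a hz
  exact hy ⟨σ (stereoChart (-y) y), (hσ _).trans ((stereoChart (-y)).left_inv (neg_ne_self y).symm)⟩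

/-- The charts with poles `v` and `-v` cover the sphere. Their intersection is a punctured vector
space of dimension `m`, connected because `m ≥ 2`. -/
lemma injective_of_hasSections_stereoChart [T2Space K] [ConnectedSpace K] {m : ℕ} (hm : 2 ≤ m)
    (hV : finrank ℝ V = m + 1) (hp : IsLocalHomeomorph N)
    (hs : ∀ v : sphere (0 : V) 1, HasSections N (stereoChart v)) : Function.Injective N := by
  obtain ⟨a⟩ : Nonempty K := inferInstance
  let v := N a
  refine injective_of_hasSections hp (stereoChart_target v) (stereoChart_target (-v)) (hs v) (hs (-v))
    ?_ ?_
  · rw [stereoChart_source, stereoChart_source, ← compl_inter, compl_univ_iff]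
    exact singleton_inter_eq_empty.mpr (neg_ne_self v).symm
  · have h1 : (stereoChart v).source ∩ (stereoChart (-v)).source =
        (stereoChart v).symm '' {0}ᶜ := by
      rw [stereoChart_source (-v)]
      ext u
      constructor
      · rintro ⟨hu, hu'⟩
        refine ⟨stereoChart v u, fun h => hu' ?_, (stereoChart v).left_inv hu⟩
        exact (stereoChart v).injOn hu (neg_ne_self v) (h.trans (stereoChart_neg v).symm)
      · rintro ⟨z, hz, rfl⟩
        refine ⟨(stereoChart v).map_target (mem_univ z), fun h => hz ?_⟩
        have h2 := congrArg (stereoChart v) h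
        rwa [(stereoChart v).right_inv (mem_univ z), stereoChart_neg] at h2
    have := Fact.mk hV
    have h2 : finrank ℝ (ℝ ∙ (v : V))ᗮ = m :=
      Submodule.finrank_orthogonal_span_singleton (n := m) (ne_zero_of_mem_unit_sphere v)
    have : FiniteDimensional ℝ V := .of_finrank_eq_succ hV
    have h3 : 1 < Module.rank ℝ (ℝ ∙ (v : V))ᗮ := by
      rw [← finrank_eq_rank, h2]
      exact_mod_cast hm
    rw [h1]
    refine (isConnected_compl_singleton_of_one_lt_rank h3 0).image _ ?_
    exact (stereoChart v).continuousOn_symm.mono (subset_univ _)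

end SphereCovering

/-! ### Maximal leaves. -/

lemma isClosed_connectedComponentIn {X : Type*} [TopologicalSpace X] {S : Set X} (hS : IsClosed S)
    (p : X) : IsClosed (connectedComponentIn S p) := by
  by_cases hp : p ∈ S
  · refine isClosed_of_closure_subset ?_
    exact isPreconnected_connectedComponentIn.closure.subset_connectedComponentIn
      (subset_closure (mem_connectedComponentIn hp))
      (closure_minimal (connectedComponentIn_subset S p) hS)
  · rw [connectedComponentIn_eq_empty hp]
    exact isClosed_empty

section Leaves

variable {n m : ℕ} {M : Type u} [TopologicalSpace M]
  [ChartedSpace (EuclideanSpace ℝ (Fin n)) M] [IsManifold (𝓡 n) ∞ M]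
  {Y : Type*} [NormedAddCommGroup Y] [NormedSpace ℝ Y] [FiniteDimensional ℝ Y] {f : M → Y}

/-- Locally the range depends only on the plaque, and the leaf is connected. -/
lemma IntegralManifold.range_mvfderiv_eq (hf : HasConstantCorank n f m)
    (L : IntegralManifold (fun p => LinearMap.ker (mvfderiv (𝓡 n) f p).toLinearMap) m)
    (a b : L.carrier) : LinearMap.range (mvfderiv (𝓡 n) f (L.incl a)).toLinearMap =
      LinearMap.range (mvfderiv (𝓡 n) f (L.incl b)).toLinearMap := by
  have hloc : IsLocallyConstant fun a : L.carrier =>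
      (LinearMap.range (mvfderiv (𝓡 n) f (L.incl a)).toLinearMap : Submodule ℝ Y) := by
    rw [IsLocallyConstant.iff_eventually_eq]
    intro a
    obtain ⟨e, hp, he⟩ := hf.exists_isFlatChart (L.incl a)
    filter_upwards [L.smooth.continuous.continuousAt (e.open_source.mem_nhds hp)] with b hb
    exact he.range_mvfderiv_eq hf (hf.le (L.incl a)) hb hp (L.map_eq hf b a)
  exact hloc.apply_eq_of_preconnectedSpace a b

variable [T2Space M] [SecondCountableTopology M]

lemma HasConstantCorank.exists_isMaximal (hf : HasConstantCorank n f m) (p : M) :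
    ∃ L : IntegralManifold (fun p => LinearMap.ker (mvfderiv (𝓡 n) f p).toLinearMap) m,
      p ∈ L.image ∧ L.IsMaximal ∧
        ∀ N : IntegralManifold (fun p => LinearMap.ker (mvfderiv (𝓡 n) f p).toLinearMap) m,
          p ∈ N.image → N.image ⊆ L.image := by
  obtain ⟨L, hL⟩ := hf.exists_leaf p
  have hp : p ∈ L.image := hL ▸ mem_connectedComponentIn rfl
  have h1 : ∀ N : IntegralManifold (fun p => LinearMap.ker (mvfderiv (𝓡 n) f p).toLinearMap) m,
      p ∈ N.image → N.image ⊆ L.image := fun N hN => hL ▸ N.image_subset hf hN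
  exact ⟨L, hp, fun N hN => (h1 N (hN hp)).antisymm hN, h1⟩

variable {L : IntegralManifold (fun p => LinearMap.ker (mvfderiv (𝓡 n) f p).toLinearMap) m}

/-- By maximality the image is a whole component of a closed fibre of `f`. Thus limits in `M` of
sequences in the leaf stay in it. -/
lemma IntegralManifold.IsMaximal.isClosed_image (hL : L.IsMaximal) (hf : HasConstantCorank n f m) :
    IsClosed L.image := by
  obtain ⟨a⟩ : Nonempty L.carrier := inferInstance
  obtain ⟨L', hL'⟩ := hf.exists_leaf (L.incl a)
  have h1 : L'.image = L.image := hL L' (hL' ▸ L.image_subset hf (mem_range_self a))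
  rw [← h1, hL']
  exact isClosed_connectedComponentIn (isClosed_singleton.preimage hf.smooth.continuous) _

end Leaves

/-! ### The sphere and its homothetic Wulff copy. -/

section WulffHomeomorph

variable {n : ℕ} {F : UnitSphere n → ℝ} {V : Submodule ℝ (Ambient n)}

/-- The inclusion of the unit sphere of a subspace into the unit sphere. -/
def sphereIncl (V : Submodule ℝ (Ambient n)) (u : sphere (0 : V) 1) : UnitSphere n :=
  ⟨(u : V), mem_sphere_zero_iff_norm.mpr (norm_eq_of_mem_sphere u)⟩

lemma continuous_sphereIncl : Continuous (sphereIncl V) :=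
  (continuous_subtype_val.comp continuous_subtype_val).subtype_mk _

lemma sphereIncl_injective : Function.Injective (sphereIncl V) := fun _ _ huv =>
  Subtype.ext (Subtype.ext (congrArg (Subtype.val : UnitSphere n → Ambient n) huv))

lemma wulffMap_sphereIncl_mem (q : Ambient n) (c : ℝ) (u : sphere (0 : V) 1) :
    q + c • wulffMap F (sphereIncl V u) ∈ (fun y => q + c • y) '' subWulff F V :=
  ⟨_, ⟨sphereIncl V u, (u : V).2, rfl⟩, rfl⟩

/-- A homothetic copy of the Wulff shape is homeomorphic to the sphere. -/
def wulffHomeomorph (hF : IsAnisotropyFunction F) (V : Submodule ℝ (Ambient n)) (q : Ambient n)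
    {c : ℝ} (hc : c ≠ 0) : sphere (0 : V) 1 ≃ₜ (fun y => q + c • y) '' subWulff F V :=
  Continuous.homeoOfEquivCompactToT2
    (f := Equiv.ofBijective (fun u => ⟨q + c • wulffMap F (sphereIncl V u),
      wulffMap_sphereIncl_mem q c u⟩) (by
    refine ⟨fun u v huv => ?_, ?_⟩
    · have h1 := congrArg Subtype.val huv
      simp only [add_right_inj] at h1
      exact sphereIncl_injective (wulffMap_injective hF (smul_right_injective _ hc h1))
    · rintro ⟨_, _, ⟨u, hu, rfl⟩, rfl⟩
      exact ⟨⟨⟨u, hu⟩, by simp⟩, rfl⟩))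
    ((continuous_const.add (((continuous_wulffMap hF.smooth).comp
      continuous_sphereIncl).const_smul c)).subtype_mk _)

end WulffHomeomorph

/-! ### The Gauss map of a leaf. -/

section WulffLeaf

variable {n m : ℕ} {M : Type u} [TopologicalSpace M]
  [ChartedSpace (EuclideanSpace ℝ (Fin n)) M] {x : M → Ambient n} {ν : M → UnitSphere n}
  {F : UnitSphere n → ℝ} {D : ∀ p : M, Submodule ℝ (TangentSpace (𝓡 n) p)}
  {L : IntegralManifold D m} {V : Submodule ℝ (Ambient n)} {q : Ambient n} {c : ℝ}

/-- The integral manifold `L` has normal vectors in `V` and is mapped to the homothetic copy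
`q + c φ(S(V))` of the Wulff shape of `V`. -/
structure IsWulffLeaf (x : M → Ambient n) (ν : M → UnitSphere n) (F : UnitSphere n → ℝ)
    (L : IntegralManifold D m) (V : Submodule ℝ (Ambient n)) (q : Ambient n) (c : ℝ) : Prop where
  finrank_eq : finrank ℝ V = m + 1
  ne_zero : c ≠ 0
  normal_mem : ∀ a, (ν (L.incl a) : Ambient n) ∈ V
  apply_eq : ∀ a, x (L.incl a) = q + c • wulffMap F (ν (L.incl a))

namespace IsWulffLeaf

/-- The Gauss map of the leaf. -/
def gauss (hL : IsWulffLeaf x ν F L V q c) (a : L.carrier) : sphere (0 : V) 1 :=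
  ⟨⟨ν (L.incl a), hL.normal_mem a⟩, by simp⟩

lemma contMDiff_gauss (hL : IsWulffLeaf x ν F L V q c) (h : IsOrientedHypersurface x ν) :
    ContMDiff (𝓡 m) 𝓘(ℝ, V) ∞ fun a => (hL.gauss a : V) := by
  -- Projecting onto `V` does not change the normal and exhibits the map into `V` as smooth.
  have h1 : (fun a => (hL.gauss a : V)) =
      fun a => V.orthogonalProjectionOnto (ν (L.incl a) : Ambient n) := by
    funext a
    exact (Submodule.orthogonalProjectionOnto_mem_subspace_eq_self (hL.gauss a : V)).symm
  rw [h1]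
  exact V.orthogonalProjectionOnto.contMDiff.comp (h.contMDiff_normal.comp L.smooth)

/-- The map whose restriction to the sphere is the parametrization of the homothetic copy of the
Wulff shape. -/
def ext (_ : IsWulffLeaf x ν F L V q c) (v : V) : Ambient n := q + c • wulffExt F (v : Ambient n)

lemma contDiffAt_ext (hL : IsWulffLeaf x ν F L V q c) (hF : ContMDiff (𝓡 n) 𝓘(ℝ, ℝ) ∞ F) {v : V}
    (hv : v ≠ 0) : ContDiffAt ℝ ∞ hL.ext v :=
  contDiffAt_const.add (((contDiffAt_wulffExt hF (by simpa using hv)).comp v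
    V.subtypeL.contDiff.contDiffAt).const_smul c)

lemma apply_eq_ext (hL : IsWulffLeaf x ν F L V q c) (hF : ContMDiff (𝓡 n) 𝓘(ℝ, ℝ) ∞ F)
    (a : L.carrier) : x (L.incl a) = hL.ext (hL.gauss a) := by
  rw [hL.apply_eq, ← wulffExt_coe hF]
  rfl

lemma exists_bound_fderiv_ext (hL : IsWulffLeaf x ν F L V q c)
    (hF : ContMDiff (𝓡 n) 𝓘(ℝ, ℝ) ∞ F) :
    ∃ C : ℝ≥0, ∀ u : sphere (0 : V) 1, ‖fderiv ℝ hL.ext u‖ ≤ C := by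
  obtain ⟨C, hC0, hC⟩ := exists_bound_fderiv_wulffExt hF
  refine ⟨⟨|c| * C, by positivity⟩, fun u => ?_⟩
  have h1 : HasFDerivAt (wulffExt F) (fderiv ℝ (wulffExt F) (sphereIncl V u)) (V.subtypeL (u : V)) :=
    ((contDiffAt_wulffExt hF (sphereIncl V u).ne_zero).differentiableAt (by simp)).hasFDerivAt
  have h2 := ((h1.comp (u : V) V.subtypeL.hasFDerivAt).const_smul c).const_add q
  have h3 : fderiv ℝ hL.ext u =
    c • (fderiv ℝ (wulffExt F) (sphereIncl V u)).comp V.subtypeL := h2.fderiv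
  refine ContinuousLinearMap.opNorm_le_bound _ (mul_nonneg (abs_nonneg c) hC0.le) fun w => ?_
  rw [h3]
  change ‖c • fderiv ℝ (wulffExt F) (sphereIncl V u) (w : Ambient n)‖ ≤ |c| * C * ‖w‖
  rw [norm_smul, Real.norm_eq_abs, mul_assoc]
  gcongr
  exact ContinuousLinearMap.le_of_opNorm_le _ (hC _) _

lemma injective_mvfderiv (h : IsOrientedHypersurface x ν) (L : IntegralManifold D m)
    (a : L.carrier) : Function.Injective (mvfderiv (𝓡 m) (x ∘ L.incl) a) := by
  have h1 := ((h.smooth.mdifferentiableAt (x := L.incl a) (by simp)).hasMFDerivAt.comp a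
    (L.smooth.mdifferentiableAt (x := a) (by simp)).hasMFDerivAt).mfderiv
  intro v w hvw
  have hv : mvfderiv (𝓡 m) (x ∘ L.incl) a v =
    mvfderiv (𝓡 n) x (L.incl a) (mfderiv (𝓡 m) (𝓡 n) L.incl a v) := DFunLike.congr_fun h1 v
  have hw : mvfderiv (𝓡 m) (x ∘ L.incl) a w =
    mvfderiv (𝓡 n) x (L.incl a) (mfderiv (𝓡 m) (𝓡 n) L.incl a w) := DFunLike.congr_fun h1 w
  rw [hv, hw] at hvw
  exact L.immersion a (h.immersion _ hvw)

lemma isLocalHomeomorph_gauss (hL : IsWulffLeaf x ν F L V q c) (h : IsOrientedHypersurface x ν)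
    (hF : ContMDiff (𝓡 n) 𝓘(ℝ, ℝ) ∞ F) : IsLocalHomeomorph hL.gauss :=
  isLocalHomeomorph_of_factor hL.finrank_eq (hL.contMDiff_gauss h) (h.smooth.comp L.smooth)
    (injective_mvfderiv h L) (fun _ => hL.contDiffAt_ext hF) (hL.apply_eq_ext hF)

lemma wulffHomeomorph_gauss (hL : IsWulffLeaf x ν F L V q c) (hF : IsAnisotropyFunction F)
    (a : L.carrier) : (wulffHomeomorph hF V q hL.ne_zero (hL.gauss a) : Ambient n) =
      x (L.incl a) := (hL.apply_eq a).symm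

lemma image_eq (hL : IsWulffLeaf x ν F L V q c) (hF : IsAnisotropyFunction F) :
    x '' L.image = Subtype.val '' (wulffHomeomorph hF V q hL.ne_zero '' range hL.gauss) := by
  rw [IntegralManifold.image, ← range_comp, ← range_comp, ← range_comp]
  exact congrArg range (funext fun a => (hL.wulffHomeomorph_gauss hF a).symm)

lemma exists_isOpen (hL : IsWulffLeaf x ν F L V q c) (h : IsOrientedHypersurface x ν)
    (hF : IsAnisotropyFunction F) : ∃ O : Set (Ambient n), IsOpen O ∧
      x '' L.image = O ∩ (fun y => q + c • y) '' subWulff F V := by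
  have h1 := (wulffHomeomorph hF V q hL.ne_zero).isOpenMap _
    (hL.isLocalHomeomorph_gauss h hF.smooth).isOpenMap.isOpen_range
  obtain ⟨O, hO, hO'⟩ := isOpen_induced_iff.mp h1
  refine ⟨O, hO, ?_⟩
  rw [hL.image_eq hF, ← hO', Subtype.image_preimage_coe, inter_comm]

/-- Completeness of `M` gives a limit in `M`, lying on the closed leaf; convergence in the topology
of the leaf itself still has to be shown, since its inclusion is only an injective immersion. -/
lemma exists_tendsto [IsManifold (𝓡 n) ∞ M] (hL : IsWulffLeaf x ν F L V q c)
    (h : IsOrientedHypersurface x ν) (hF : ContMDiff (𝓡 n) 𝓘(ℝ, ℝ) ∞ F)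
    (hcl : IsClosed L.image) (hx : IsCompleteHypersurface x) (s : ℕ → L.carrier)
    (hs : ∀ ε : ℝ≥0∞, 0 < ε → ∃ k, ∀ i ≥ k, ∀ j ≥ k,
      inducedEDist x (L.incl (s i)) (L.incl (s j)) < ε) : ∃ b, Tendsto s atTop (𝓝 b) := by
  obtain ⟨p, hp⟩ := hx (fun i => L.incl (s i)) hs
  obtain ⟨b, rfl⟩ : p ∈ L.image :=
    hcl.mem_of_tendsto hp (Eventually.of_forall fun i => mem_range_self (s i))
  refine ⟨b, ?_⟩
  obtain ⟨e, hbe, he⟩ := hL.isLocalHomeomorph_gauss h hF b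
  have h1 : Tendsto (fun i => hL.gauss (s i)) atTop (𝓝 (hL.gauss b)) := by
    rw [tendsto_subtype_rng, tendsto_subtype_rng]
    exact (h.contMDiff_normal.continuous.tendsto (L.incl b)).comp hp
  have hgb : hL.gauss b ∈ e.target := he ▸ e.map_source hbe
  have hsymm : e.symm (hL.gauss b) = b := by
    rw [he, e.left_inv hbe]
  -- These points converge in the leaf and have the same Gauss image as `s i`, hence the same image
  -- under `x`. Both lie eventually near `L.incl b`, where `x` is injective, so they are the points
  -- `s i` themselves.
  have h2 : Tendsto (fun i => e.symm (hL.gauss (s i))) atTop (𝓝 b) := by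
    have h3 := (e.continuousAt_symm hgb).tendsto.comp h1
    rwa [hsymm] at h3
  obtain ⟨U, hU, hinj⟩ := exists_nhds_injOn_of_immersion h.smooth (h.immersion (L.incl b))
  have h4 := ((L.smooth.continuous.tendsto b).comp h2).eventually_mem hU
  refine h2.congr' ?_
  filter_upwards [h4, hp.eventually_mem hU, h1.eventually_mem (e.open_target.mem_nhds hgb)]
    with i hi hi' hit
  refine L.injective (hinj hi hi' ?_)
  have h5 : hL.gauss (e.symm (hL.gauss (s i))) = hL.gauss (s i) := by
    nth_rw 1 [he]
    exact e.right_inv hit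
  change x (L.incl (e.symm (hL.gauss (s i)))) = x (L.incl (s i))
  rw [hL.apply_eq_ext hF, hL.apply_eq_ext hF, h5]

lemma hasSections_gauss [IsManifold (𝓡 n) ∞ M] (hL : IsWulffLeaf x ν F L V q c)
    (h : IsOrientedHypersurface x ν) (hF : ContMDiff (𝓡 n) 𝓘(ℝ, ℝ) ∞ F)
    (hcl : IsClosed L.image) (hx : IsCompleteHypersurface x) (v : sphere (0 : V) 1) :
    HasSections hL.gauss (stereoChart v) := by
  obtain ⟨C, hC⟩ := hL.exists_bound_fderiv_ext hF
  exact hasSections_stereoChart (hL.isLocalHomeomorph_gauss h hF)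
    (d := fun a b => inducedEDist x (L.incl a) (L.incl b)) (fun _ _ => inducedEDist_comm _ _)
    (fun _ _ _ => inducedEDist_triangle _ _ _)
    (exists_nhds_inducedEDist_le h.smooth L.smooth (injective_mvfderiv h L) (hL.contMDiff_gauss h)
      (fun _ => hL.contDiffAt_ext hF) (hL.apply_eq_ext hF) hC)
    (hL.exists_tendsto h hF hcl hx) v

end IsWulffLeaf

end WulffLeaf

/-! ### Leaves of the focal map lie in homothetic Wulff copies. -/

section Focal

variable {n m : ℕ} {M : Type u} [TopologicalSpace M]
  [ChartedSpace (EuclideanSpace ℝ (Fin n)) M] [IsManifold (𝓡 n) ∞ M] {x : M → Ambient n}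
  {ν : M → UnitSphere n} {F : UnitSphere n → ℝ} {lam : ℝ}

namespace IsOrientedHypersurface

lemma hasConstantCorank_focalMap (h : IsOrientedHypersurface x ν) (hF : IsAnisotropyFunction F)
    {Λ : Multiset ℝ} (hΛ : h.IsAnisotropicIsoparametric F Λ) (lam : ℝ) :
    HasConstantCorank n (h.focalMap F lam) (Λ.count lam) :=
  ⟨h.contMDiff_focalMap hF.smooth lam, fun p => by
    rw [← h.eigenDistribution_eq_ker hF.smooth, h.finrank_eigenDistribution hF hΛ]⟩

lemma exists_isWulffLeaf (h : IsOrientedHypersurface x ν) (hF : ContMDiff (𝓡 n) 𝓘(ℝ, ℝ) ∞ F)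
    (hf : HasConstantCorank n (h.focalMap F lam) m) (hlam : lam ≠ 0)
    (L : IntegralManifold
      (fun p => LinearMap.ker (mvfderiv (𝓡 n) (h.focalMap F lam) p).toLinearMap) m) :
    ∃ V q c, IsWulffLeaf x ν F L V q c := by
  obtain ⟨a⟩ : Nonempty L.carrier := inferInstance
  let R : Submodule ℝ (Ambient n) :=
    LinearMap.range (mvfderiv (𝓡 n) (h.focalMap F lam) (L.incl a)).toLinearMap
  -- Solving `lam • x + φ(ν) = const` for `x` gives the centre and the factor `-lam⁻¹`. The range
  -- `R` is tangent at every point of the leaf, so the normals lie in `Rᗮ`, of dimension `(n + 1) -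
  -- (n - m)`.
  refine ⟨Rᗮ, lam⁻¹ • h.focalMap F lam (L.incl a), -lam⁻¹, ?_, by simpa using hlam, ?_, ?_⟩
  · have h1 : finrank ℝ R + m = n := by
      have := LinearMap.finrank_range_add_finrank_ker
        (mvfderiv (𝓡 n) (h.focalMap F lam) (L.incl a)).toLinearMap
      rwa [hf.finrank_ker, finrank_tangentSpace] at this
    have h2 := R.finrank_add_finrank_orthogonal
    rw [finrank_euclideanSpace_fin] at h2
    omega
  · intro b
    change _ ∈ Rᗮ
    have hR : R = _ := L.range_mvfderiv_eq hf a b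
    rw [hR, Submodule.mem_orthogonal']
    rintro _ ⟨v, rfl⟩
    change inner ℝ _ (mvfderiv (𝓡 n) (h.focalMap F lam) (L.incl b) v) = 0
    rw [h.mvfderiv_focalMap hF]
    exact h.normal _ _
  · intro b
    rw [L.map_eq hf a b, focalMap, smul_add, smul_smul, inv_mul_cancel₀ hlam, one_smul, neg_smul,
      add_neg_cancel_right]

end IsOrientedHypersurface

end Focal

end AnisoIso

end

theorem mainTheorem3 {n : ℕ}
    (F : AnisoIso.UnitSphere n → ℝ) (hF : AnisoIso.IsAnisotropyFunction F)
    {M : Type*} [TopologicalSpace M] [T2Space M] [SecondCountableTopology M]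
    [ChartedSpace (EuclideanSpace ℝ (Fin n)) M] [IsManifold (𝓡 n) ∞ M]
    (x : M → AnisoIso.Ambient n) (ν : M → AnisoIso.UnitSphere n)
    (h : AnisoIso.IsOrientedHypersurface x ν)
    (Λ : Multiset ℝ) (hΛ : h.IsAnisotropicIsoparametric F Λ)
    (lam : ℝ) (hlam : lam ∈ Λ) (m : ℕ) (hm : m = Λ.count lam) :
    -- the eigen-distribution is integrable
    AnisoIso.IsIntegrable (h.eigenDistribution F lam) m ∧
    -- through each point there is a unique maximal integral manifold
    (∀ p : M, ∃ L : AnisoIso.IntegralManifold (h.eigenDistribution F lam) m,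
      p ∈ L.image ∧ L.IsMaximal ∧
        ∀ N : AnisoIso.IntegralManifold (h.eigenDistribution F lam) m,
          p ∈ N.image → N.image ⊆ L.image) ∧
    -- if `lam ≠ 0`, the maximal integral manifolds are open parts of translated homothetic copies
    -- `W` of some `W^m_F`; if `M` is complete they cover all of `W`, and injectively if `m ≥ 2`
    (lam ≠ 0 → ∀ L : AnisoIso.IntegralManifold (h.eigenDistribution F lam) m, L.IsMaximal →
      ∃ (V : Submodule ℝ (AnisoIso.Ambient n)) (q : AnisoIso.Ambient n) (c : ℝ)
        (W : Set (AnisoIso.Ambient n)),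
        Module.finrank ℝ V = m + 1 ∧ c ≠ 0 ∧
        W = (fun y => q + c • y) '' AnisoIso.subWulff F V ∧
        (∃ O : Set (AnisoIso.Ambient n), IsOpen O ∧ x '' L.image = O ∩ W) ∧
        (AnisoIso.IsCompleteHypersurface x →
          x '' L.image = W ∧
          (∃ hW : ∀ a : L.carrier, x (L.incl a) ∈ W,
            IsCoveringMap (fun a : L.carrier => (⟨x (L.incl a), hW a⟩ : W))) ∧
          (2 ≤ m → Set.InjOn x L.image))) := by
  subst hm
  have hf := h.hasConstantCorank_focalMap hF hΛ lam
  rw [show h.eigenDistribution F lam =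
    fun p => LinearMap.ker (mvfderiv (𝓡 n) (h.focalMap F lam) p).toLinearMap from
      funext fun p => h.eigenDistribution_eq_ker hF.smooth lam p]
  refine ⟨hf.isIntegrable, hf.exists_isMaximal, fun hlam0 L hmax => ?_⟩
  obtain ⟨V, q, c, hL⟩ := h.exists_isWulffLeaf hF.smooth hf hlam0 L
  refine ⟨V, q, c, _, hL.finrank_eq, hL.ne_zero, rfl, hL.exists_isOpen h hF, fun hx => ?_⟩
  have hp := hL.isLocalHomeomorph_gauss h hF.smooth
  have hs := hL.hasSections_gauss h hF.smooth (hmax.isClosed_image hf) hx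
  -- Since `lam` occurs in `Λ`, its multiplicity is at least one, so the sphere of `V` is connected.
  have hrank : 1 < Module.rank ℝ V := by
    rw [← finrank_eq_rank, hL.finrank_eq]
    exact_mod_cast Nat.succ_lt_succ (Multiset.count_pos.mpr hlam)
  refine ⟨?_, ⟨fun a => ?_, ?_⟩, ?_⟩
  · rw [hL.image_eq hF, (AnisoIso.surjective_of_hasSections_stereoChart hp hrank hs).range_eq, image_univ,
      (AnisoIso.wulffHomeomorph hF V q hL.ne_zero).surjective.range_eq, image_univ, Subtype.range_coe]
  · rw [← hL.wulffHomeomorph_gauss hF a]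
    exact Subtype.coe_prop _
  -- On the leaf, `x` is the Gauss map followed by the homeomorphism of the sphere with `W`.
  · have h1 := (AnisoIso.isCoveringMap_of_hasSections_stereoChart hp hs).homeomorph_comp
      (AnisoIso.wulffHomeomorph hF V q hL.ne_zero)
    refine (congrArg IsCoveringMap ?_).mp h1
    exact funext fun a => Subtype.ext (hL.wulffHomeomorph_gauss hF a)
  · rintro hm _ ⟨a, rfl⟩ _ ⟨b, rfl⟩ hab
    rw [← hL.wulffHomeomorph_gauss hF, ← hL.wulffHomeomorph_gauss hF] at hab
    rw [AnisoIso.injective_of_hasSections_stereoChart hm hL.finrank_eq hp hs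
      ((AnisoIso.wulffHomeomorph hF V q hL.ne_zero).injective (Subtype.ext hab))]
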